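/- Let $k$ be a field, $Q$ a finite quiver, and $kQ$ its path algebra, graded by path length, with paths composed from right to left; let $e_j$ be the trivial path at the vertex $j$. Let $I\subseteq kQ_{\ge 2}$ be a homogeneous two-sided ideal and $\Lambda=kQ/I$, with $S=\Lambda_0=\Lambda/\Lambda_{\ge1}$ and $S_j=e_jS$, a graded simple right $\Lambda$-module in degree $0$. Modules below are $\mathbb Z$-graded right modules unless said otherwise, homomorphisms preserve degrees, and $M(i)_n=M_{i+n}$. For a graded module $M$, a syzygy $\Omega M$ is the kernel of a graded projective cover of $M$, a cosyzygy $\Omega^{-1}M$ is the cokernel of a graded injective hull of $M$, and $FM=(\Omega M)(1)$, $F^{-1}M=(\Omega^{-1}M)(-1)$ (all are defined up to isomorphism, whenever the cover or hull exists); $F^n$, $F^{-n}$, $\Omega^n$ are iterates. A graded (left or right) module is Koszul if it is generated in degree $0$ and has a minimal graded projective resolution $\cdots\to P_1\to P_0\to M\to0$ with $P_i$ generated in degree $i$ for all $i$. The algebra $\Lambda$ is Koszul if the graded left module $S$ is Koszul; it satisfies the Koszul syzygy condition if for all $i\ge0$, all vertices $j,\ell$ and every graded homomorphism $f:\Omega^i(S_j)(i)\to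 S_\ell$ of right modules, $\ker f$ is Koszul. Write $h_M(t)=\sum_n(\dim_kM_n)t^n$, let $B_{ji}$ be the number of arrows from $i$ to $j$, and let the indegree of a vertex be the number of arrows with that target. Suppose that $\Lambda$ is finite-dimensional, quasi-Frobenius (that is, injective as a right module over itself) and Koszul, that the socle of $\Lambda$ as a right module is $\Lambda_2$, and that every vertex of $Q$ has indegree at least $2$. Then: 1. for every vertex $j$, $h_{e_j\Lambda}(t)=1+d_jt+t^2$, where $d_j=\sum_iB_{ji}\ge2$; 2. for all $n\ge0$ and all $j$, the module $F^n(S_j)$ exists, and there are integers $a>b\ge 0$ with $h_{F^n(S_j)}(t)=a+bt$; 3. for all $n\ge0$ and all $j$, the module $F^{-n}(S_j(-1))$ exists, and there are integers $0\le a<b$ with $h_{F^{-n}(S_j(-1))}(t)=a+bt$; 4. $\Lambda$ satisfies the Koszul syzygy condition. -/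

import Mathlib

universe u v w a

noncomputable section

namespace KoszulQuiver

open DirectSum

section Internal

variable {R : Type u} [CommRing R] {M : Type v} [AddCommGroup M] [Module R M]

/-- A family of submodules that spans and is separated by linear maps `π i` (the identity on the
`i`-th submodule, zero on the others) is a direct sum decomposition. -/
theorem isInternal_of_proj {ι : Type w} [DecidableEq ι] (ℳ : ι → Submodule R M)
    (π : ι → M →ₗ[R] M) (hid : ∀ i, ∀ x ∈ ℳ i, π i x = x)
    (hne : ∀ i j, i ≠ j → ∀ x ∈ ℳ i, π j x = 0) (hspan : iSup ℳ = ⊤) :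
    DirectSum.IsInternal ℳ := by
  refine DirectSum.isInternal_submodule_of_iSupIndep_of_iSup_eq_top ?_ hspan
  intro i
  rw [Submodule.disjoint_def]
  intro x hx hx'
  rw [← hid i x hx]
  have : (⨆ j, ⨆ (_ : j ≠ i), ℳ j) ≤ LinearMap.ker (π i) :=
    iSup₂_le fun j hj y hy => hne j i hj y hy
  exact this hx'

end Internal

section PathAlgebra

variable (k : Type u) [Field k] (Q : Type v) [Quiver.{w} Q]

/-- The paths of a quiver: a source, a target, and a path from the source to the target. -/
abbrev Paths := Σ i j : Q, Quiver.Path i j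

/-- The path algebra `kQ`: the `k`-vector space with basis the paths of `Q`. -/
def PathAlgebra := Paths Q →₀ k

instance : AddCommGroup (PathAlgebra k Q) := inferInstanceAs (AddCommGroup (Paths Q →₀ k))
instance : Module k (PathAlgebra k Q) := inferInstanceAs (Module k (Paths Q →₀ k))

variable {Q}

variable (Q) in
/-- The basis of the path algebra given by the paths. -/
def pathBasis : Module.Basis (Paths Q) k (PathAlgebra k Q) :=
  Module.Basis.ofRepr (LinearEquiv.refl k (Paths Q →₀ k))

/-- The basis element of the path algebra given by a path. -/
def pathElt (p : Paths Q) : PathAlgebra k Q := pathBasis k Q p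

open Classical in
/-- The product of two paths, composed from right to left: `p * q` is "first `q`, then `p`" if `q`
ends where `p` starts, and `0` otherwise. -/
def pathMul (p q : Paths Q) : PathAlgebra k Q :=
  if h : q.2.1 = p.1 then pathElt k ⟨q.1, p.2.1, (h ▸ q.2.2 : Quiver.Path q.1 p.1).comp p.2.2⟩
  else 0

/-- The bilinear extension of `pathMul`. -/
def mulLin : PathAlgebra k Q →ₗ[k] PathAlgebra k Q →ₗ[k] PathAlgebra k Q :=
  (pathBasis k Q).constr k fun p => (pathBasis k Q).constr k fun q => pathMul k p q

instance : Mul (PathAlgebra k Q) := ⟨fun x y => mulLin k x y⟩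

variable {k}

theorem mul_def (x y : PathAlgebra k Q) : x * y = mulLin k x y := rfl

theorem pathElt_mul_pathElt (p q : Paths Q) : pathElt k p * pathElt k q = pathMul k p q := by
  rw [mul_def, mulLin, pathElt, pathElt, Module.Basis.constr_basis, Module.Basis.constr_basis]

theorem pathMul_comp {i j l : Q} (p : Quiver.Path j l) (q : Quiver.Path i j) :
    pathMul k ⟨j, l, p⟩ ⟨i, j, q⟩ = pathElt k ⟨i, l, q.comp p⟩ := by
  simp [pathMul]

theorem pathMul_ne {p q : Paths Q} (h : q.2.1 ≠ p.1) : pathMul k p q = 0 := by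
  simp [pathMul, h]

theorem induction_linear {C : PathAlgebra k Q → Prop} (x : PathAlgebra k Q) (h0 : C 0)
    (hadd : ∀ x y, C x → C y → C (x + y)) (hsmul : ∀ (c : k) x, C x → C (c • x))
    (hs : ∀ p, C (pathElt k p)) : C x := by
  have hx : x ∈ Submodule.span k (Set.range (pathBasis k Q)) := by
    rw [(pathBasis k Q).span_eq]; trivial
  induction hx using Submodule.span_induction with
  | mem x hx => obtain ⟨p, rfl⟩ := hx; exact hs p
  | zero => exact h0
  | add x y _ _ hx hy => exact hadd _ _ hx hy
  | smul c x _ hx => exact hsmul c x hx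

theorem mul_add' (x y z : PathAlgebra k Q) : x * (y + z) = x * y + x * z := by simp [mul_def]
theorem add_mul' (x y z : PathAlgebra k Q) : (x + y) * z = x * z + y * z := by simp [mul_def]
theorem smul_mul' (c : k) (x y : PathAlgebra k Q) : (c • x) * y = c • (x * y) := by simp [mul_def]
theorem mul_smul' (c : k) (x y : PathAlgebra k Q) : x * (c • y) = c • (x * y) := by simp [mul_def]
theorem zero_mul' (x : PathAlgebra k Q) : 0 * x = 0 := by simp [mul_def]
theorem mul_zero' (x : PathAlgebra k Q) : x * 0 = 0 := by simp [mul_def]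

theorem mul_assoc_path (p q r : Paths Q) :
    pathElt k p * pathElt k q * pathElt k r = pathElt k p * (pathElt k q * pathElt k r) := by
  obtain ⟨p1, p2, p⟩ := p
  obtain ⟨q1, q2, q⟩ := q
  obtain ⟨r1, r2, r⟩ := r
  simp only [pathElt_mul_pathElt]
  by_cases h1 : q2 = p1
  · subst h1
    rw [pathMul_comp]
    by_cases h2 : r2 = q1
    · subst h2
      simp [pathMul_comp, pathElt_mul_pathElt]
    · rw [pathMul_ne (p := ⟨q1, q2, q⟩) (q := ⟨r1, r2, r⟩) h2, mul_zero', pathElt_mul_pathElt,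
        pathMul_ne h2]
  · rw [pathMul_ne (p := ⟨p1, p2, p⟩) (q := ⟨q1, q2, q⟩) h1, zero_mul']
    by_cases h2 : r2 = q1
    · subst h2
      rw [pathMul_comp, pathElt_mul_pathElt, pathMul_ne h1]
    · rw [pathMul_ne (p := ⟨q1, q2, q⟩) (q := ⟨r1, r2, r⟩) h2, mul_zero']

theorem mul_assoc' (x y z : PathAlgebra k Q) : x * y * z = x * (y * z) := by
  refine induction_linear (C := fun x => x * y * z = x * (y * z)) x (by simp only [zero_mul'])
    (fun a b ha hb => by simp only [add_mul', ha, hb])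
    (fun c a ha => by simp only [smul_mul', ha]) fun p => ?_
  refine induction_linear (C := fun y => pathElt k p * y * z = pathElt k p * (y * z)) y (by simp only [zero_mul', mul_zero'])
    (fun a b ha hb => by simp only [add_mul', mul_add', ha, hb])
    (fun c a ha => by simp only [smul_mul', mul_smul', ha]) fun q => ?_
  refine induction_linear
    (C := fun z => pathElt k p * pathElt k q * z = pathElt k p * (pathElt k q * z)) z (by simp only [mul_zero'])
    (fun a b ha hb => by simp only [mul_add', ha, hb])
    (fun c a ha => by simp only [mul_smul', ha]) fun r => ?_
  exact mul_assoc_path p q r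

variable (k) in
/-- The trivial path `e_i` at the vertex `i`. -/
def vertexElt (i : Q) : PathAlgebra k Q := pathElt k ⟨i, i, Quiver.Path.nil⟩

variable [Fintype Q]

instance : One (PathAlgebra k Q) := ⟨∑ i : Q, vertexElt k i⟩

theorem one_def : (1 : PathAlgebra k Q) = ∑ i : Q, vertexElt k i := rfl

theorem one_mul_path (p : Paths Q) : 1 * pathElt k p = pathElt k p := by
  obtain ⟨i, j, p⟩ := p
  rw [one_def, mul_def, map_sum, LinearMap.sum_apply, Finset.sum_eq_single j]
  · rw [← mul_def, vertexElt, pathElt_mul_pathElt, pathMul_comp, Quiver.Path.comp_nil]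
  · intro l _ hl
    rw [← mul_def, vertexElt, pathElt_mul_pathElt, pathMul_ne]
    exact fun h => hl h.symm
  · simp

theorem path_mul_one (p : Paths Q) : pathElt k p * 1 = pathElt k p := by
  obtain ⟨i, j, p⟩ := p
  rw [one_def, mul_def, map_sum, Finset.sum_eq_single i]
  · rw [← mul_def, vertexElt, pathElt_mul_pathElt, pathMul_comp, Quiver.Path.nil_comp]
  · intro l _ hl
    rw [← mul_def, vertexElt, pathElt_mul_pathElt, pathMul_ne]
    exact hl
  · simp

theorem one_mul' (x : PathAlgebra k Q) : 1 * x = x :=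
  induction_linear (C := fun x => 1 * x = x) x (mul_zero' 1)
    (fun a b ha hb => by rw [mul_add', ha, hb])
    (fun c a ha => by rw [mul_smul', ha]) one_mul_path

theorem mul_one' (x : PathAlgebra k Q) : x * 1 = x :=
  induction_linear (C := fun x => x * 1 = x) x (zero_mul' 1)
    (fun a b ha hb => by rw [add_mul', ha, hb])
    (fun c a ha => by rw [smul_mul', ha]) path_mul_one

instance : Ring (PathAlgebra k Q) where
  left_distrib := mul_add'
  right_distrib := add_mul'
  zero_mul := zero_mul'
  mul_zero := mul_zero'
  mul_assoc := mul_assoc'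
  one_mul := one_mul'
  mul_one := mul_one'
  zsmul := fun n x => n • x
  zsmul_zero' := SubNegMonoid.zsmul_zero'
  zsmul_succ' := SubNegMonoid.zsmul_succ'
  zsmul_neg' := SubNegMonoid.zsmul_neg'
  neg_add_cancel := neg_add_cancel
  sub_eq_add_neg := sub_eq_add_neg

instance : Algebra k (PathAlgebra k Q) := Algebra.ofModule smul_mul' mul_smul'

variable (k Q) in
/-- The grading of the path algebra by path length: the component of degree `n` is the span of
the paths of length `n`. -/
def pathGrading (n : ℕ) : Submodule k (PathAlgebra k Q) :=
  Submodule.span k (pathElt k '' {p : Paths Q | p.2.2.length = n})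

theorem pathElt_mem (p : Paths Q) : pathElt k p ∈ pathGrading k Q p.2.2.length :=
  Submodule.subset_span ⟨p, rfl, rfl⟩

variable (k Q) in
/-- The projection of the path algebra onto its component of degree `n`. -/
def pathProj (n : ℕ) : PathAlgebra k Q →ₗ[k] PathAlgebra k Q :=
  (pathBasis k Q).constr k fun p => if p.2.2.length = n then pathElt k p else 0

theorem pathProj_pathElt (n : ℕ) (p : Paths Q) :
    pathProj k Q n (pathElt k p) = if p.2.2.length = n then pathElt k p else 0 := by
  rw [pathProj, pathElt, Module.Basis.constr_basis]
  rfl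

theorem pathGrading_isInternal : DirectSum.IsInternal (pathGrading k Q) := by
  refine isInternal_of_proj _ (pathProj k Q) (fun i x hx => ?_) (fun i j hij x hx => ?_) ?_
  · induction hx using Submodule.span_induction with
    | mem x hx => obtain ⟨p, hp, rfl⟩ := hx; rw [pathProj_pathElt]; exact if_pos hp
    | zero => simp
    | add x y _ _ hx hy => rw [map_add, hx, hy]
    | smul c x _ hx => rw [map_smul, hx]
  · induction hx using Submodule.span_induction with
    | mem x hx =>
      obtain ⟨p, hp, rfl⟩ := hx
      rw [pathProj_pathElt, if_neg]
      exact fun h => hij (hp.symm.trans h)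
    | zero => simp
    | add x y _ _ hx hy => rw [map_add, hx, hy, add_zero]
    | smul c x _ hx => rw [map_smul, hx, smul_zero]
  · rw [eq_top_iff]
    intro x _
    refine induction_linear x (zero_mem _) (fun a b => add_mem)
      (fun c a ha => Submodule.smul_mem _ c ha) fun p => ?_
    exact Submodule.mem_iSup_of_mem _ (pathElt_mem p)

instance pathGrading_gradedMonoid : SetLike.GradedMonoid (pathGrading k Q) where
  one_mem := by
    rw [one_def]
    exact sum_mem fun i _ => pathElt_mem (k := k) (⟨i, i, Quiver.Path.nil⟩ : Paths Q)
  mul_mem := by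
    intro m n x y hx hy
    induction hx using Submodule.span_induction with
    | mem x hx =>
      induction hy using Submodule.span_induction with
      | mem y hy =>
        obtain ⟨⟨i, j, p⟩, hp, rfl⟩ := hx
        obtain ⟨⟨i', j', q⟩, hq, rfl⟩ := hy
        rw [pathElt_mul_pathElt]
        by_cases h : j' = i
        · subst h
          rw [pathMul_comp]
          have := pathElt_mem (k := k) (⟨i', j, q.comp p⟩ : Paths Q)
          rwa [show (⟨i', j, q.comp p⟩ : Paths Q).2.2.length = m + n from by
            simp only [Set.mem_ofPred_eq] at hp hq
            rw [Quiver.Path.length_comp, hp, hq, add_comm]] at this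
        · rw [pathMul_ne h]
          exact zero_mem _
      | zero => rw [mul_zero]; exact zero_mem _
      | add x y _ _ hx hy => rw [mul_add]; exact add_mem hx hy
      | smul c x _ hx => rw [mul_smul_comm]; exact Submodule.smul_mem _ _ hx
    | zero => rw [zero_mul]; exact zero_mem _
    | add x y _ _ hx hy => rw [add_mul]; exact add_mem hx hy
    | smul c x _ hx => rw [smul_mul_assoc]; exact Submodule.smul_mem _ _ hx

instance pathGrading_decomposition : DirectSum.Decomposition (pathGrading k Q) :=
  pathGrading_isInternal.chooseDecomposition

instance pathGrading_gradedAlgebra : GradedAlgebra (pathGrading k Q) where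

end PathAlgebra

section Gradings

variable {k : Type u} [Field k] {A : Type a} [Ring A] [Algebra k A]

/-- The opposite of a graded algebra, with the same grading. Right modules over `A` are left
modules over `Aᵐᵒᵖ`. -/
def opGrading (𝒜 : ℕ → Submodule k A) (n : ℕ) : Submodule k Aᵐᵒᵖ :=
  (𝒜 n).map (MulOpposite.opLinearEquiv k : A ≃ₗ[k] Aᵐᵒᵖ).toLinearMap

theorem mem_opGrading {𝒜 : ℕ → Submodule k A} {n : ℕ} {x : Aᵐᵒᵖ} :
    x ∈ opGrading 𝒜 n ↔ x.unop ∈ 𝒜 n := by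
  constructor
  · rintro ⟨y, hy, rfl⟩
    exact hy
  · intro h
    exact ⟨x.unop, h, rfl⟩

variable (𝒜 : ℕ → Submodule k A) [GradedAlgebra 𝒜]

theorem opGrading_isInternal : DirectSum.IsInternal (opGrading 𝒜) := by
  let e : A ≃ₗ[k] Aᵐᵒᵖ := MulOpposite.opLinearEquiv k
  refine isInternal_of_proj _
    (fun n => e.toLinearMap ∘ₗ GradedAlgebra.proj 𝒜 n ∘ₗ e.symm.toLinearMap)
    (fun i x hx => ?_) (fun i j hij x hx => ?_) ?_
  · obtain ⟨y, hy, rfl⟩ := hx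
    simp [e, GradedAlgebra.proj_apply, decompose_of_mem_same 𝒜 hy]
  · obtain ⟨y, hy, rfl⟩ := hx
    simp [e, GradedAlgebra.proj_apply, decompose_of_mem_ne 𝒜 hy hij]
  · change (⨆ n, (𝒜 n).map e.toLinearMap) = ⊤
    rw [← Submodule.map_iSup, (Decomposition.isInternal 𝒜).submodule_iSup_eq_top,
      Submodule.map_top, LinearEquiv.range]

instance opGrading_gradedMonoid : SetLike.GradedMonoid (opGrading 𝒜) where
  one_mem := mem_opGrading.2 (SetLike.GradedOne.one_mem (A := 𝒜))
  mul_mem := by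
    intro m n x y hx hy
    rw [mem_opGrading] at hx hy ⊢
    rw [MulOpposite.unop_mul, add_comm]
    exact SetLike.GradedMul.mul_mem hy hx

instance opGrading_decomposition : DirectSum.Decomposition (opGrading 𝒜) :=
  (opGrading_isInternal 𝒜).chooseDecomposition

instance opGrading_gradedAlgebra : GradedAlgebra (opGrading 𝒜) where

end Gradings

section QuiverAlgebra

variable (k : Type u) [Field k] (Q : Type v) [Fintype Q] [Quiver.{w} Q]

/-- A homogeneous two-sided ideal of the path algebra `kQ` that is contained in the span `kQ_{≥2}`
of the paths of length at least two. -/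
structure RelationIdeal where
  ideal : Ideal (PathAlgebra k Q)
  isTwoSided : ideal.IsTwoSided
  isHomogeneous : ideal.IsHomogeneous (pathGrading k Q)
  le_two : ∀ x ∈ ideal, ∀ p : Paths Q, (pathBasis k Q).repr x p ≠ 0 → 2 ≤ p.2.2.length

namespace RelationIdeal

attribute [instance] RelationIdeal.isTwoSided

variable {k Q} (I : RelationIdeal k Q)

/-- The algebra `Λ = kQ/I`. -/
abbrev Alg := PathAlgebra k Q ⧸ I.ideal

/-- The quotient map from `kQ` to `kQ/I`. -/
def quot : PathAlgebra k Q →ₐ[k] I.Alg := Ideal.Quotient.mkₐ k I.ideal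

/-- The grading of `Λ = kQ/I` induced by path length. -/
def grading (n : ℕ) : Submodule k I.Alg := (pathGrading k Q n).map I.quot.toLinearMap

/-- The idempotent of `Λ` given by the trivial path at the vertex `i`. -/
def idem (i : Q) : I.Alg := I.quot (vertexElt k i)

theorem quot_surjective : Function.Surjective I.quot := Ideal.Quotient.mk_surjective

theorem quot_eq_zero {x : PathAlgebra k Q} : I.quot x = 0 ↔ x ∈ I.ideal :=
  Ideal.Quotient.eq_zero_iff_mem

/-- The projection of `Λ` onto its component of degree `n`. -/
def proj (n : ℕ) : I.Alg →ₗ[k] I.Alg :=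
  (Submodule.liftQ (I.ideal.restrictScalars k)
    (I.quot.toLinearMap ∘ₗ GradedAlgebra.proj (pathGrading k Q) n) (fun x hx => by
      change I.quot (GradedAlgebra.proj (pathGrading k Q) n x) = 0
      rw [I.quot_eq_zero, GradedAlgebra.proj_apply]
      exact I.isHomogeneous n hx) : (PathAlgebra k Q ⧸ I.ideal.restrictScalars k) →ₗ[k] I.Alg)

theorem proj_quot (n : ℕ) (x : PathAlgebra k Q) :
    I.proj n (I.quot x) = I.quot (decompose (pathGrading k Q) x n) := rfl

theorem grading_isInternal : DirectSum.IsInternal I.grading := by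
  refine isInternal_of_proj _ I.proj (fun i x hx => ?_) (fun i j hij x hx => ?_) ?_
  · obtain ⟨y, hy, rfl⟩ := hx
    change I.proj i (I.quot y) = I.quot y
    rw [proj_quot, decompose_of_mem_same _ hy]
  · obtain ⟨y, hy, rfl⟩ := hx
    change I.proj j (I.quot y) = 0
    rw [proj_quot, decompose_of_mem_ne _ hy hij, map_zero]
  · change (⨆ n, (pathGrading k Q n).map I.quot.toLinearMap) = ⊤
    rw [← Submodule.map_iSup, pathGrading_isInternal.submodule_iSup_eq_top,
      Submodule.map_top, LinearMap.range_eq_top]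
    exact I.quot_surjective

instance grading_gradedMonoid : SetLike.GradedMonoid I.grading where
  one_mem := ⟨1, SetLike.GradedOne.one_mem (A := pathGrading k Q), map_one I.quot⟩
  mul_mem := by
    rintro m n _ _ ⟨x, hx, rfl⟩ ⟨y, hy, rfl⟩
    exact ⟨x * y, SetLike.GradedMul.mul_mem hx hy, map_mul I.quot x y⟩

instance grading_decomposition : DirectSum.Decomposition I.grading :=
  I.grading_isInternal.chooseDecomposition

instance grading_gradedAlgebra : GradedAlgebra I.grading where

theorem idem_mem (i : Q) : I.idem i ∈ I.grading 0 :=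
  ⟨_, pathElt_mem (k := k) (⟨i, i, Quiver.Path.nil⟩ : Paths Q), rfl⟩

end RelationIdeal

end QuiverAlgebra

section GradedModules

/-- A `ℤ`-graded left module `M = ⨁ M_n` over an `ℕ`-graded `k`-algebra `A = ⨁ A_n`. -/
structure GrMod {k : Type u} [Field k] {A : Type a} [Ring A] [Algebra k A]
    (𝒜 : ℕ → Submodule k A) where
  carrier : Type a
  [addCommGroup : AddCommGroup carrier]
  [moduleBase : Module k carrier]
  [module : Module A carrier]
  [isScalarTower : IsScalarTower k A carrier]
  deg : ℤ → Submodule k carrier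
  [decomposition : DirectSum.Decomposition deg]
  smul_mem : ∀ (i : ℕ) (n : ℤ) (r : A) (x : carrier), r ∈ 𝒜 i → x ∈ deg n → r • x ∈ deg (i + n)

/-- Graded right modules over a graded algebra. -/
abbrev GrModRight {k : Type u} [Field k] {A : Type a} [Ring A] [Algebra k A]
    (𝒜 : ℕ → Submodule k A) := GrMod (opGrading 𝒜)

namespace GrMod

attribute [instance] GrMod.addCommGroup GrMod.moduleBase GrMod.module GrMod.isScalarTower
  GrMod.decomposition

variable {k : Type u} [Field k] {A : Type a} [Ring A] [Algebra k A] {𝒜 : ℕ → Submodule k A}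

/-- Degree-preserving module homomorphisms. -/
structure Hom (M N : GrMod 𝒜) where
  toLinearMap : M.carrier →ₗ[A] N.carrier
  map_deg : ∀ n, ∀ x ∈ M.deg n, toLinearMap x ∈ N.deg n

instance (M N : GrMod 𝒜) : CoeFun (Hom M N) (fun _ => M.carrier → N.carrier) :=
  ⟨fun f => f.toLinearMap⟩

/-- Isomorphism of graded modules. -/
def IsIso (M N : GrMod 𝒜) : Prop :=
  ∃ e : M.carrier ≃ₗ[A] N.carrier, ∀ n x, x ∈ M.deg n ↔ e x ∈ N.deg n

/-- The shift `M(i)`, with `M(i)_n = M_{i+n}`. -/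
def shift (M : GrMod 𝒜) (i : ℤ) : GrMod 𝒜 where
  carrier := M.carrier
  deg n := M.deg (i + n)
  decomposition := by
    refine (isInternal_of_proj _ (fun n => ((M.deg (i + n)).subtype ∘ₗ
      DirectSum.component k ℤ (fun n => M.deg n) (i + n) ∘ₗ
      (decomposeLinearEquiv M.deg).toLinearMap)) (fun m x hx => ?_) (fun m n hmn x hx => ?_)
      ?_).chooseDecomposition
    · exact decompose_of_mem_same M.deg hx
    · exact decompose_of_mem_ne M.deg hx (fun h => hmn (by omega))
    · rw [← (Decomposition.isInternal M.deg).submodule_iSup_eq_top]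
      exact (Equiv.addLeft i).iSup_comp (g := M.deg)
  smul_mem j n r x hr hx := by
    rw [add_left_comm]
    exact M.smul_mem j (i + n) r x hr hx

/-- The graded submodule given by a homogeneous submodule. -/
def sub (M : GrMod 𝒜) (N : Submodule A M.carrier) (hN : N.IsHomogeneous M.deg) : GrMod 𝒜 where
  carrier := N
  deg n := (M.deg n).comap (N.subtype.restrictScalars k)
  decomposition := by
    let π : ∀ n, N →ₗ[k] N := fun n =>
      LinearMap.codRestrict (N.restrictScalars k) ((M.deg n).subtype ∘ₗ
        DirectSum.component k ℤ (fun n => M.deg n) n ∘ₗ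
        (decomposeLinearEquiv M.deg).toLinearMap ∘ₗ N.subtype.restrictScalars k)
        (fun x => hN n x.2)
    have hπ : ∀ n (x : N), (π n x : M.carrier) = decompose M.deg (x : M.carrier) n :=
      fun n x => rfl
    refine (isInternal_of_proj _ π (fun m x hx => ?_) (fun m n hmn x hx => ?_)
      ?_).chooseDecomposition
    · apply Subtype.ext
      rw [hπ]
      exact decompose_of_mem_same M.deg hx
    · apply Subtype.ext
      rw [hπ]
      exact decompose_of_mem_ne M.deg hx hmn
    · classical
      rw [eq_top_iff]
      intro x _
      have hx : x = ∑ n ∈ (decompose M.deg (x : M.carrier)).support, π n x := by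
        apply Subtype.ext
        rw [AddSubmonoidClass.coe_finsetSum]
        simp only [hπ]
        exact (sum_support_decompose M.deg (x : M.carrier)).symm
      rw [hx]
      refine sum_mem fun n _ => Submodule.mem_iSup_of_mem n ?_
      change (π n x : M.carrier) ∈ M.deg n
      rw [hπ]
      exact SetLike.coe_mem _
  smul_mem j n r x hr hx := M.smul_mem j n r x hr hx

theorem Hom.decompose_map {M N : GrMod 𝒜} (f : Hom M N) (x : M.carrier) (n : ℤ) :
    (decompose N.deg (f x) n : N.carrier) = f (decompose M.deg x n) := by
  classical
  induction x using Decomposition.inductionOn M.deg with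
  | zero => simp
  | homogeneous m =>
    rename_i i
    by_cases h : i = n
    · subst h
      rw [decompose_of_mem_same N.deg (f.map_deg _ _ m.2), decompose_of_mem_same M.deg m.2]
    · rw [decompose_of_mem_ne N.deg (f.map_deg _ _ m.2) h, decompose_of_mem_ne M.deg m.2 h,
        map_zero]
  | add x y hx hy => simp [hx, hy]

/-- The kernel of a graded homomorphism, as a graded module. -/
def Hom.ker {M N : GrMod 𝒜} (f : Hom M N) : GrMod 𝒜 :=
  M.sub (LinearMap.ker f.toLinearMap) (by
    intro n x hx
    change f (decompose M.deg x n) = 0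
    change f x = 0 at hx
    rw [← f.decompose_map, hx, decompose_zero]
    rfl)

/-- A graded module is generated in degree `n` if `M_n` generates it. -/
def GeneratedInDegree (M : GrMod 𝒜) (n : ℤ) : Prop :=
  Submodule.span A (M.deg n : Set M.carrier) = ⊤

/-- Projective objects of the category of graded modules. -/
def IsProjective (P : GrMod 𝒜) : Prop :=
  ∀ (M N : GrMod 𝒜) (g : Hom M N) (f : Hom P N), Function.Surjective g →
    ∃ h : Hom P M, ∀ x, g (h x) = f x

/-- Injective objects of the category of graded modules. -/
def IsInjective (E : GrMod 𝒜) : Prop :=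
  ∀ (M N : GrMod 𝒜) (g : Hom M N) (f : Hom M E), Function.Injective g →
    ∃ h : Hom N E, ∀ x, h (g x) = f x

/-- A graded projective cover: an essential epimorphism from a projective graded module. -/
def IsProjectiveCover {P M : GrMod 𝒜} (p : Hom P M) : Prop :=
  P.IsProjective ∧ Function.Surjective p ∧
    ∀ (L : GrMod 𝒜) (g : Hom L P), Function.Surjective (p ∘ g) → Function.Surjective g

/-- A graded injective hull: an essential monomorphism to an injective graded module. -/
def IsInjectiveHull {M E : GrMod 𝒜} (i : Hom M E) : Prop :=
  E.IsInjective ∧ Function.Injective i ∧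
    ∀ (L : GrMod 𝒜) (g : Hom E L), Function.Injective (g ∘ i) → Function.Injective g

/-- `N` is a syzygy `Ω M`: there is an exact sequence `0 → N → P → M → 0` with `P → M` a graded
projective cover. -/
def IsSyzygy (M N : GrMod 𝒜) : Prop :=
  ∃ (P : GrMod 𝒜) (i : Hom N P) (p : Hom P M),
    IsProjectiveCover p ∧ Function.Injective i ∧ Function.Exact i p

/-- `N` is a cosyzygy `Ω⁻¹ M`: there is an exact sequence `0 → M → E → N → 0` with `M → E` a
graded injective hull. -/
def IsCosyzygy (M N : GrMod 𝒜) : Prop :=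
  ∃ (E : GrMod 𝒜) (i : Hom M E) (p : Hom E N),
    IsInjectiveHull i ∧ Function.Surjective p ∧ Function.Exact i p

/-- `N` is `F M = (Ω M)(1)`. -/
def IsF (M N : GrMod 𝒜) : Prop := ∃ L, IsSyzygy M L ∧ IsIso (L.shift 1) N

/-- `N` is `F⁻¹ M = (Ω⁻¹ M)(-1)`. -/
def IsFInv (M N : GrMod 𝒜) : Prop := ∃ L, IsCosyzygy M L ∧ IsIso (L.shift (-1)) N

/-- The `n`-fold iterate of an operation on graded modules that is defined up to isomorphism:
`Iterate R n M N` says that `N` is obtained from `M` by applying the operation `n` times. -/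
def Iterate (R : GrMod 𝒜 → GrMod 𝒜 → Prop) : ℕ → GrMod 𝒜 → GrMod 𝒜 → Prop
  | 0, M, N => IsIso M N
  | n + 1, M, N => ∃ L, Iterate R n M L ∧ R L N

/-- A minimal graded projective resolution `⋯ → P₂ → P₁ → P₀ → M → 0`, cut into the exact
sequences `0 → Z_{n+1} → P_n → Z_n → 0` with `Z_0 ≅ M` and `P_n → Z_n` a projective cover. -/
structure MinimalResolution (M : GrMod 𝒜) where
  P : ℕ → GrMod 𝒜
  Z : ℕ → GrMod 𝒜
  Z_zero : IsIso (Z 0) M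
  p : ∀ n, Hom (P n) (Z n)
  i : ∀ n, Hom (Z (n + 1)) (P n)
  cover : ∀ n, IsProjectiveCover (p n)
  injective : ∀ n, Function.Injective (i n)
  exact : ∀ n, Function.Exact (i n) (p n)

/-- A graded module is Koszul if it is generated in degree `0` and has a minimal graded projective
resolution whose `n`-th term is generated in degree `n`. -/
def IsKoszul (M : GrMod 𝒜) : Prop :=
  M.GeneratedInDegree 0 ∧ ∃ R : MinimalResolution M, ∀ n : ℕ, (R.P n).GeneratedInDegree n

/-- `M` has Hilbert series `h_M(t) = ∑ (dim_k M_n) t ^ n` equal to `h`; in particular all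
components of `M` are finite-dimensional. -/
def HasHilbertSeries (M : GrMod 𝒜) (h : LaurentPolynomial ℕ) : Prop :=
  ∀ n : ℤ, Module.Finite k (M.deg n) ∧ Module.finrank k (M.deg n) = h.coeff n

/-- A module concentrated in degree `0`. -/
def concentrated (M : Type a) [AddCommGroup M] [Module k M] [Module A M] [IsScalarTower k A M]
    (h : ∀ i : ℕ, i ≠ 0 → ∀ r ∈ 𝒜 i, ∀ x : M, r • x = 0) : GrMod 𝒜 where
  carrier := M
  deg n := if n = 0 then ⊤ else ⊥
  decomposition := by
    refine (isInternal_of_proj _ (fun n => if n = 0 then LinearMap.id else 0)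
      (fun m x hx => ?_) (fun m n hmn x hx => ?_) ?_).chooseDecomposition
    · by_cases hm : m = 0
      · simp [hm]
      · simp only [hm, if_false, Submodule.mem_bot] at hx
        simp [hx]
    · by_cases hm : m = 0
      · have : n ≠ 0 := fun h => hmn (hm.trans h.symm)
        simp [this]
      · simp only [hm, if_false, Submodule.mem_bot] at hx
        simp [hx]
    · rw [eq_top_iff]
      exact le_iSup_of_le 0 (by simp)
  smul_mem i n r x hr hx := by
    by_cases hi : i = 0
    · subst hi
      by_cases hn : n = 0
      · simp [hn]
      · simp only [hn, if_false, Submodule.mem_bot] at hx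
        simp [hx]
    · rw [h i hi r hr x]
      exact zero_mem _

variable (𝒜) [GradedAlgebra 𝒜]

/-- The graded module `A₀ = A / A_{≥1}`, concentrated in degree `0`. -/
def degreeZero : GrMod 𝒜 :=
  concentrated (A ⧸ (HomogeneousIdeal.irrelevant 𝒜).toIdeal) (by
    intro i hi r hr x
    obtain ⟨x, rfl⟩ := Submodule.Quotient.mk_surjective _ x
    rw [← Submodule.Quotient.mk_smul, Submodule.Quotient.mk_eq_zero, smul_eq_mul]
    have hr' : r ∈ RingHom.ker (GradedRing.projZeroRingHom 𝒜) :=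
      HomogeneousIdeal.mem_irrelevant_of_mem 𝒜 (Nat.pos_of_ne_zero hi) hr
    change r * x ∈ RingHom.ker (GradedRing.projZeroRingHom 𝒜)
    rw [RingHom.mem_ker] at hr' ⊢
    rw [map_mul, hr', zero_mul])

/-- The graded module `A`. -/
def regular : GrMod 𝒜 where
  carrier := A
  deg
    | Int.ofNat n => 𝒜 n
    | Int.negSucc _ => ⊥
  decomposition := by
    refine (isInternal_of_proj _ (fun n => match n with
      | Int.ofNat n => GradedAlgebra.proj 𝒜 n
      | Int.negSucc _ => 0) (fun m x hx => ?_) (fun m n hmn x hx => ?_) ?_).chooseDecomposition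
    · match m, hx with
      | Int.ofNat m, hx => exact decompose_of_mem_same 𝒜 hx
      | Int.negSucc m, hx => rw [(Submodule.mem_bot k).1 hx, map_zero]
    · match m, hx, n with
      | Int.negSucc m, hx, _ => rw [(Submodule.mem_bot k).1 hx, map_zero]
      | Int.ofNat m, hx, Int.negSucc _ => rfl
      | Int.ofNat m, hx, Int.ofNat n =>
        exact decompose_of_mem_ne 𝒜 hx (fun h => hmn (congrArg Int.ofNat h))
    · rw [eq_top_iff, ← (Decomposition.isInternal 𝒜).submodule_iSup_eq_top]
      exact iSup_le fun n => le_iSup_of_le (Int.ofNat n) le_rfl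
  smul_mem i n r x hr hx := by
    match n, hx with
    | Int.ofNat n, hx => exact SetLike.GradedMul.mul_mem hr hx
    | Int.negSucc n, hx =>
      rw [(Submodule.mem_bot k).1 hx, smul_zero]
      exact zero_mem _

variable {𝒜}

/-- The submodule generated by a homogeneous element of degree `n` is homogeneous. -/
theorem isHomogeneous_span_singleton (M : GrMod 𝒜) {n : ℤ} {e : M.carrier} (he : e ∈ M.deg n) :
    (Submodule.span A {e}).IsHomogeneous M.deg := by
  intro m x hx
  obtain ⟨r, rfl⟩ := Submodule.mem_span_singleton.1 hx
  induction r using Decomposition.inductionOn 𝒜 with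
  | zero => simp
  | homogeneous r =>
    rename_i i
    have h := M.smul_mem i n r e r.2 he
    by_cases hm : (i : ℤ) + n = m
    · subst hm
      rw [decompose_of_mem_same M.deg h]
      exact hx
    · rw [decompose_of_mem_ne M.deg h hm]
      exact zero_mem _
  | add r s hr hs =>
    rw [add_smul, decompose_add, DirectSum.add_apply, Submodule.coe_add]
    exact add_mem (hr (Submodule.mem_span_singleton.2 ⟨r, rfl⟩))
      (hs (Submodule.mem_span_singleton.2 ⟨s, rfl⟩))

/-- The graded submodule `A x` generated by a homogeneous element `x`. -/
def cyclic (M : GrMod 𝒜) {n : ℤ} {x : M.carrier} (hx : x ∈ M.deg n) : GrMod 𝒜 :=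
  M.sub (Submodule.span A {x}) (M.isHomogeneous_span_singleton hx)

end GrMod

end GradedModules

section RingConditions

/-- An artinian ring is quasi-Frobenius if it is injective as a right module over itself. -/
def IsQuasiFrobenius (A : Type a) [Ring A] : Prop :=
  IsArtinian Aᵐᵒᵖ A ∧ Module.Injective Aᵐᵒᵖ A

/-- The socle of `A` as a right module over itself: the sum of the simple right ideals. -/
def rightSocle (A : Type a) [Ring A] : Submodule Aᵐᵒᵖ A :=
  sSup {N : Submodule Aᵐᵒᵖ A | IsSimpleModule Aᵐᵒᵖ N}

/-- A graded algebra `A` with semisimple degree-zero part is Koszul if the graded left module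
`A₀ = A / A_{≥1}` is Koszul. -/
def IsKoszulAlgebra {k : Type u} [Field k] {A : Type a} [Ring A] [Algebra k A]
    (𝒜 : ℕ → Submodule k A) [GradedAlgebra 𝒜] : Prop :=
  IsSemisimpleRing (A ⧸ RingHom.ker (GradedRing.projZeroRingHom 𝒜)) ∧
    (GrMod.degreeZero 𝒜).IsKoszul

end RingConditions

section Quivers

variable (Q : Type v) [Quiver.{w} Q]

/-- The incidence matrix of a quiver: `B j i` is the number of arrows from `i` to `j`. -/
def incidence : Matrix Q Q ℕ := Matrix.of fun j i => Nat.card (i ⟶ j)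

variable {Q}

/-- The indegree of a vertex: the number of arrows with target `j`. -/
def indegree (j : Q) : ℕ := Nat.card (Σ i : Q, (i ⟶ j))

end Quivers

namespace RelationIdeal

variable {k : Type u} [Field k] {Q : Type v} [Fintype Q] [Quiver.{w} Q] (I : RelationIdeal k Q)

/-- The graded right module `e_j Λ`. -/
def projective (j : Q) : GrModRight I.grading :=
  (GrMod.regular (opGrading I.grading)).cyclic (n := 0) (x := MulOpposite.op (I.idem j))
    (mem_opGrading.2 (I.idem_mem j))

theorem idem_mem_degreeZero (j : Q) :
    (Submodule.Quotient.mk (MulOpposite.op (I.idem j)) :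
      I.Algᵐᵒᵖ ⧸ (HomogeneousIdeal.irrelevant (opGrading I.grading)).toIdeal) ∈
      (GrMod.degreeZero (opGrading I.grading)).deg 0 := by
  change _ ∈ (if (0 : ℤ) = 0 then ⊤ else ⊥ : Submodule k _)
  rw [if_pos rfl]
  exact Submodule.mem_top

/-- The graded simple right module `S_j = e_j S`, where `S = Λ₀ = Λ / Λ_{≥1}`. -/
def simple (j : Q) : GrModRight I.grading :=
  (GrMod.degreeZero (opGrading I.grading)).cyclic (I.idem_mem_degreeZero j)

/-- The Koszul syzygy condition: for all `i`, `j`, `l`, every graded homomorphism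
`Ω^i(S_j)(i) → S_l` has Koszul kernel. -/
def KoszulSyzygyCondition : Prop :=
  ∀ (i : ℕ) (j l : Q) (X : GrModRight I.grading),
    GrMod.Iterate GrMod.IsSyzygy i (I.simple j) X →
      ∀ f : GrMod.Hom (X.shift i) (I.simple l), f.ker.IsKoszul

end RelationIdeal

end KoszulQuiver

end

open KoszulQuiver LaurentPolynomial

/-!
The hypotheses force `Λ` to have Loewy length three: the top degree of `Λ` lies in the socle `Λ₂`,
so `Λ_n = 0` for `n ≥ 3`. Right multiplication by elements of positive degree kills `Λ₂`, so by
injectivity of `Λ` every linear endomorphism of `Λ₂` that commutes with the right action of the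
vertices is a left multiplication by an element of `Λ₀` (`RelationIdeal.exists_scalars`). Hence the
socle of each `e_j Λ` is one-dimensional and the vertices of these socles form a permutation of `Q`,
and `h_{e_j Λ} = 1 + d_j t + t²`. All that is used afterwards is recorded in
`GrMod.IsLoewyThree`, for left modules over the opposite algebra.

For a module `X` with Hilbert series `a + b t` that is generated in degree `0`, a projective cover
has Hilbert series `a + (∑ d) t + a t²` with `∑ d ≥ 2 a`, so `F X` has series `a' + a t` with
`a' ≥ 2 a - b`, and `b < a` implies `a < a'`. To know that `F X` is again generated in degree `0`,
one proves more: *every* nonzero graded quotient `U` of `X` satisfies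
`dim U_1 + ε ≤ dim U_0` (`GrMod.IsLinear`, with `ε ∈ {0, 1}`). A quotient generated in the wrong
degree would violate this, so the inequality implies generation in degree `0`. It passes from `X` to
its syzygy (`GrMod.IsLoewyThree.isLinear_syzygy`). Indeed, let `U` be a quotient of `Ω X`. After
division by the part of its socle in the lower degree, `U` has an injective hull `E` that is a sum
of modules `e_i Λ`. The map `Ω X → U → E` extends to the projective cover `P` of `X`, and the
extension `P → E` is onto: its image contains the socle of `E`, and a module generated in one degree
has at most as many dimensions two degrees higher
(`GrMod.IsLoewyThree.finrank_add_two_le`). So `E / U` is a quotient of `X`, and the inequality for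
`E / U` gives the one for `U`, since the middle component of `E` has at least twice the dimension of
its socle.

Simple modules satisfy the inequality with `ε = 1`, which gives the claim on `F^n(S_j)`. If `X`
satisfies it with `ε = 1` and `f : X → S_l` is a homomorphism, a quotient `ker f / L` embeds in
`X / L` with cokernel of dimension at most one in degree `0`, so `ker f` satisfies it with `ε = 0`
(`GrMod.IsLinear.ker`). That is still enough to make all syzygies of `ker f` generated in the right
degree, which is the Koszul syzygy condition.

The claim on `F^{-n}(S_j(-1))` is dual: the inequality `dim U_0 < dim U_1` for all nonzero
submodules (`GrMod.IsCoLinear`) passes to cosyzygies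
(`GrMod.IsLoewyThree.isCoLinear_cosyzygy`).
-/

noncomputable section

namespace KoszulQuiver

open DirectSum

/-! ### Graded modules: homomorphisms, quotients, products, shifts -/

namespace GrMod

section Basic

variable {k : Type u} [Field k] {A : Type a} [Ring A] [Algebra k A] {𝒜 : ℕ → Submodule k A}

/-- The projection of a graded module onto its component of degree `n`, as an endomorphism of the
underlying vector space. -/
def component (M : GrMod 𝒜) (n : ℤ) : M.carrier →ₗ[k] M.carrier :=
  (M.deg n).subtype ∘ₗ DirectSum.component k ℤ (fun n => M.deg n) n ∘ₗ
    (decomposeLinearEquiv M.deg).toLinearMap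

theorem component_mem (M : GrMod 𝒜) (n : ℤ) (x : M.carrier) : M.component n x ∈ M.deg n :=
  SetLike.coe_mem _

theorem component_of_mem (M : GrMod 𝒜) {n : ℤ} {x : M.carrier} (hx : x ∈ M.deg n) :
    M.component n x = x := decompose_of_mem_same M.deg hx

theorem component_of_mem_ne (M : GrMod 𝒜) {m n : ℤ} {x : M.carrier} (hx : x ∈ M.deg m)
    (h : m ≠ n) : M.component n x = 0 := decompose_of_mem_ne M.deg hx h

theorem Hom.component_map {M N : GrMod 𝒜} (f : Hom M N) (n : ℤ) (x : M.carrier) :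
    N.component n (f x) = f (M.component n x) := f.decompose_map x n

theorem eq_zero_of_component (M : GrMod 𝒜) {x : M.carrier} (h : ∀ n, M.component n x = 0) :
    x = 0 := by
  classical
  rw [← sum_support_decompose M.deg x]
  exact Finset.sum_eq_zero fun n _ => h n

theorem induction_homogeneous (M : GrMod 𝒜) {C : M.carrier → Prop} (x : M.carrier) (h0 : C 0)
    (hadd : ∀ x y, C x → C y → C (x + y)) (hdeg : ∀ n, ∀ x ∈ M.deg n, C x) : C x := by
  induction x using Decomposition.inductionOn M.deg with
  | zero => exact h0
  | homogeneous m => exact hdeg _ _ m.2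
  | add x y hx hy => exact hadd _ _ hx hy

theorem disjoint_deg (M : GrMod 𝒜) {m n : ℤ} (h : m ≠ n) {x : M.carrier} (hm : x ∈ M.deg m)
    (hn : x ∈ M.deg n) : x = 0 := by
  rw [← M.component_of_mem hn, M.component_of_mem_ne hm h]

theorem component_smul (M : GrMod 𝒜) {i : ℕ} {r : A} (hr : r ∈ 𝒜 i) (n : ℤ) (x : M.carrier) :
    M.component (i + n) (r • x) = r • M.component n x := by
  refine M.induction_homogeneous (C := fun x => M.component (i + n) (r • x) = r • M.component n x)
    x (by simp only [smul_zero, map_zero])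
    (fun x y hx hy => ?_) fun m x hx => ?_
  · rw [smul_add, map_add, map_add, smul_add, hx, hy]
  · by_cases h : m = n
    · subst h
      rw [M.component_of_mem hx, M.component_of_mem (M.smul_mem i m r x hr hx)]
    · rw [M.component_of_mem_ne hx h, smul_zero,
        M.component_of_mem_ne (M.smul_mem i m r x hr hx) (by omega)]

/-- Linear maps of graded modules may be tested for linearity over the algebra on homogeneous
elements. -/
theorem map_smul_of_homogeneous [Decomposition 𝒜] {M : GrMod 𝒜} {E : Type w} [AddCommGroup E]
    [Module k E] [Module A E] (h : M.carrier →ₗ[k] E)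
    (H : ∀ (i : ℕ) (r : A) (_ : r ∈ 𝒜 i) (n : ℤ) (x : M.carrier) (_ : x ∈ M.deg n),
      h (r • x) = r • h x) (r : A) (x : M.carrier) : h (r • x) = r • h x := by
  refine M.induction_homogeneous (C := fun x => h (r • x) = r • h x) x
    (by simp only [smul_zero, map_zero])
    (fun x y hx hy => ?_) fun m x hx => ?_
  · rw [smul_add, map_add, map_add, smul_add, hx, hy]
  · induction r using Decomposition.inductionOn 𝒜 with
    | zero => simp
    | homogeneous r => exact H _ _ r.2 _ _ hx
    | add r s hr hs => rw [add_smul, add_smul, map_add, hr, hs]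

namespace Hom

/-- The identity homomorphism. -/
protected def id (M : GrMod 𝒜) : Hom M M := ⟨LinearMap.id, fun _ _ h => h⟩

/-- The composition of homomorphisms. -/
def comp {M N L : GrMod 𝒜} (g : Hom N L) (f : Hom M N) : Hom M L :=
  ⟨g.toLinearMap ∘ₗ f.toLinearMap, fun n x h => g.map_deg n _ (f.map_deg n x h)⟩

@[simp] theorem comp_apply {M N L : GrMod 𝒜} (g : Hom N L) (f : Hom M N) (x : M.carrier) :
    (g.comp f) x = g (f x) := rfl

@[simp] theorem id_apply {M : GrMod 𝒜} (x : M.carrier) : (Hom.id M) x = x := rfl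

/-- A homomorphism of graded modules with the degrees of both sides shifted. -/
def shift {M N : GrMod 𝒜} (f : Hom M N) (i : ℤ) : Hom (M.shift i) (N.shift i) :=
  ⟨f.toLinearMap, fun _ x h => f.map_deg _ x h⟩

/-- The restriction of a homomorphism to the components of degree `n`. -/
def onDeg {M N : GrMod 𝒜} (f : Hom M N) (n : ℤ) : M.deg n →ₗ[k] N.deg n :=
  (f.toLinearMap.restrictScalars k).restrict (f.map_deg n)

@[simp] theorem coe_onDeg {M N : GrMod 𝒜} (f : Hom M N) (n : ℤ) (x : M.deg n) :
    (f.onDeg n x : N.carrier) = f (x : M.carrier) := rfl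

variable {M N : GrMod 𝒜} (f : Hom M N)

theorem injective_of_deg (h : ∀ n, ∀ x ∈ M.deg n, f x = 0 → x = 0) : Function.Injective f := by
  refine (injective_iff_map_eq_zero f.toLinearMap).2 fun x hx => M.eq_zero_of_component fun n => ?_
  refine h n _ (M.component_mem n x) ?_
  rw [← f.component_map, show f x = 0 from hx, map_zero]

theorem exists_mem_deg (hf : Function.Surjective f) {n : ℤ} {y : N.carrier} (hy : y ∈ N.deg n) :
    ∃ x ∈ M.deg n, f x = y := by
  obtain ⟨x, rfl⟩ := hf y
  exact ⟨M.component n x, M.component_mem n x, by rw [← f.component_map, N.component_of_mem hy]⟩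

theorem onDeg_surjective (hf : Function.Surjective f) (n : ℤ) :
    Function.Surjective (f.onDeg n) := by
  rintro ⟨y, hy⟩
  obtain ⟨x, hx, rfl⟩ := f.exists_mem_deg hf hy
  exact ⟨⟨x, hx⟩, rfl⟩

/-- A homomorphism that is onto in the degree that generates its target is onto. -/
theorem surjective_of_onDeg {p : ℤ} (hN : N.GeneratedInDegree p)
    (hf : Function.Surjective (f.onDeg p)) : Function.Surjective f := by
  refine LinearMap.range_eq_top.1 (top_le_iff.1 (hN.symm.le.trans (Submodule.span_le.2 ?_)))
  intro y hy
  obtain ⟨x, hx⟩ := hf ⟨y, hy⟩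
  exact ⟨x, congrArg Subtype.val hx⟩

theorem onDeg_injective (hf : Function.Injective f) (n : ℤ) :
    Function.Injective (f.onDeg n) := fun _ _ h => Subtype.ext (hf (congrArg Subtype.val h))

theorem mem_deg_of_injective (hf : Function.Injective f) {n : ℤ} {x : M.carrier}
    (hx : f x ∈ N.deg n) : x ∈ M.deg n := by
  have : M.component n x = x := hf (by rw [← f.component_map, N.component_of_mem hx])
  rw [← this]
  exact M.component_mem n x

/-- A homomorphism that vanishes on the kernel of a surjective one factors through it. -/
theorem exists_factor {P X V : GrMod 𝒜} (p : Hom P X) (hp : Function.Surjective p)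
    (q : Hom P V) (h : ∀ x, p x = 0 → q x = 0) : ∃ g : Hom X V, ∀ x, g (p x) = q x := by
  let g : X.carrier →ₗ[A] V.carrier :=
    (Submodule.liftQ (LinearMap.ker p.toLinearMap) q.toLinearMap (fun x hx => h x hx)) ∘ₗ
      (p.toLinearMap.quotKerEquivOfSurjective hp).symm.toLinearMap
  have hg : ∀ x, g (p x) = q x := by
    intro x
    have : (p.toLinearMap.quotKerEquivOfSurjective hp).symm (p x) = Submodule.Quotient.mk x := by
      rw [LinearEquiv.symm_apply_eq]
      rfl
    rw [show g (p x) = Submodule.liftQ (LinearMap.ker p.toLinearMap) q.toLinearMap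
      (fun x hx => h x hx) ((p.toLinearMap.quotKerEquivOfSurjective hp).symm (p x)) from rfl, this]
    rfl
  refine ⟨⟨g, fun n x hx => ?_⟩, hg⟩
  obtain ⟨y, hy, rfl⟩ := p.exists_mem_deg hp hx
  rw [hg]
  exact q.map_deg n y hy

/-- A homomorphism with values in the image of an injective one factors through it. -/
theorem exists_lift {N P V : GrMod 𝒜} (i : Hom N P) (hi : Function.Injective i)
    (q : Hom V P) (h : ∀ x, ∃ y, i y = q x) : ∃ g : Hom V N, ∀ x, i (g x) = q x := by
  let e := LinearEquiv.ofInjective i.toLinearMap hi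
  let g : V.carrier →ₗ[A] N.carrier :=
    e.symm.toLinearMap ∘ₗ q.toLinearMap.codRestrict (LinearMap.range i.toLinearMap) h
  have hg : ∀ x, i (g x) = q x := fun x =>
    congrArg Subtype.val (e.apply_symm_apply (q.toLinearMap.codRestrict _ h x))
  refine ⟨⟨g, fun n x hx => i.mem_deg_of_injective hi ?_⟩, hg⟩
  rw [hg]
  exact q.map_deg n x hx

end Hom

theorem IsIso.refl (M : GrMod 𝒜) : IsIso M M := ⟨LinearEquiv.refl A _, fun _ _ => Iff.rfl⟩

theorem IsIso.symm {M N : GrMod 𝒜} : IsIso M N → IsIso N M := fun ⟨e, he⟩ =>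
  ⟨e.symm, fun n x => by rw [he, e.apply_symm_apply]⟩

theorem IsIso.exists_hom {M N : GrMod 𝒜} : IsIso M N → ∃ f : Hom M N, Function.Bijective f :=
  fun ⟨e, he⟩ => ⟨⟨e.toLinearMap, fun n x => (he n x).1⟩, e.bijective⟩

/-- The quotient of a graded module by a homogeneous submodule. -/
def quot (M : GrMod 𝒜) (N : Submodule A M.carrier) (hN : N.IsHomogeneous M.deg) : GrMod 𝒜 where
  carrier := M.carrier ⧸ N
  deg n := (M.deg n).map (N.mkQ.restrictScalars k)
  decomposition := by
    let π : ∀ n, (M.carrier ⧸ N) →ₗ[k] (M.carrier ⧸ N) := fun n =>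
      (Submodule.liftQ (N.restrictScalars k) (N.mkQ.restrictScalars k ∘ₗ M.component n)
        (fun x hx => by
          change N.mkQ (M.component n x) = 0
          rw [Submodule.mkQ_apply, Submodule.Quotient.mk_eq_zero]
          exact hN n hx) : (M.carrier ⧸ N.restrictScalars k) →ₗ[k] (M.carrier ⧸ N))
    have hπ : ∀ n x, π n (N.mkQ x) = N.mkQ (M.component n x) := fun n x => rfl
    refine (isInternal_of_proj _ π (fun m x hx => ?_) (fun m n hmn x hx => ?_)
      ?_).chooseDecomposition
    · obtain ⟨x, hx, rfl⟩ := hx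
      exact (hπ m x).trans (by rw [M.component_of_mem hx]; rfl)
    · obtain ⟨x, hx, rfl⟩ := hx
      exact (hπ n x).trans (by rw [M.component_of_mem_ne hx hmn, map_zero])
    · rw [← Submodule.map_iSup, (Decomposition.isInternal M.deg).submodule_iSup_eq_top,
        Submodule.map_top, LinearMap.range_eq_top]
      exact N.mkQ_surjective
  smul_mem i n r x hr hx := by
    obtain ⟨x, hx, rfl⟩ := hx
    exact ⟨r • x, M.smul_mem i n r x hr hx, rfl⟩

/-- The projection onto a quotient module. -/
def toQuot (M : GrMod 𝒜) (N : Submodule A M.carrier) (hN : N.IsHomogeneous M.deg) :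
    Hom M (M.quot N hN) := ⟨N.mkQ, fun _ x hx => ⟨x, hx, rfl⟩⟩

theorem toQuot_surjective (M : GrMod 𝒜) (N : Submodule A M.carrier)
    (hN : N.IsHomogeneous M.deg) : Function.Surjective (M.toQuot N hN) := N.mkQ_surjective

theorem toQuot_eq_zero (M : GrMod 𝒜) (N : Submodule A M.carrier)
    (hN : N.IsHomogeneous M.deg) (x : M.carrier) : M.toQuot N hN x = 0 ↔ x ∈ N :=
  Submodule.Quotient.mk_eq_zero N

/-- The inclusion of a graded submodule. -/
def ofSub (M : GrMod 𝒜) (N : Submodule A M.carrier) (hN : N.IsHomogeneous M.deg) :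
    Hom (M.sub N hN) M := ⟨N.subtype, fun _ _ hx => hx⟩

theorem ofSub_injective (M : GrMod 𝒜) (N : Submodule A M.carrier)
    (hN : N.IsHomogeneous M.deg) : Function.Injective (M.ofSub N hN) := N.injective_subtype

theorem Hom.isHomogeneous_range {M N : GrMod 𝒜} (f : Hom M N) :
    (LinearMap.range f.toLinearMap).IsHomogeneous N.deg := by
  rintro n _ ⟨x, rfl⟩
  exact ⟨M.component n x, (f.component_map n x).symm⟩

theorem Hom.isHomogeneous_ker {M N : GrMod 𝒜} (f : Hom M N) :
    (LinearMap.ker f.toLinearMap).IsHomogeneous M.deg := by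
  intro n x hx
  change f (M.component n x) = 0
  rw [← f.component_map, show f x = 0 from hx, map_zero]

theorem isHomogeneous_map {M N : GrMod 𝒜} (f : Hom M N) {L : Submodule A M.carrier}
    (hL : L.IsHomogeneous M.deg) : (L.map f.toLinearMap).IsHomogeneous N.deg := by
  rintro n _ ⟨x, hx, rfl⟩
  exact ⟨M.component n x, hL n hx, (f.component_map n x).symm⟩

/-- A submodule spanned by homogeneous elements of a fixed degree is homogeneous. -/
theorem isHomogeneous_span [Decomposition 𝒜] (M : GrMod 𝒜) {n : ℤ} {s : Set M.carrier}
    (hs : s ⊆ M.deg n) : (Submodule.span A s).IsHomogeneous M.deg := by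
  suffices H : ∀ x ∈ Submodule.span A s, ∀ m, M.component m x ∈ Submodule.span A s from
    fun m x hx => H x hx m
  intro x hx
  induction hx using Submodule.span_induction with
  | mem x hx =>
    intro m
    by_cases h : n = m
    · subst h
      rw [M.component_of_mem (hs hx)]
      exact Submodule.subset_span hx
    · rw [M.component_of_mem_ne (hs hx) h]
      exact zero_mem _
  | zero => simp
  | add x y _ _ hx hy => intro m; rw [map_add]; exact add_mem (hx m) (hy m)
  | smul r x _ hx =>
    induction r using Decomposition.inductionOn 𝒜 with
    | zero => simp
    | @homogeneous i r =>
      intro m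
      rw [← add_sub_cancel (i : ℤ) m, M.component_smul r.2]
      exact Submodule.smul_mem _ _ (hx _)
    | add r s hr hs => intro m; rw [add_smul, map_add]; exact add_mem (hr m) (hs m)

/-- The product of finitely many graded modules. -/
def pi {n : ℕ} (M : Fin n → GrMod 𝒜) : GrMod 𝒜 where
  carrier := ∀ s, (M s).carrier
  deg m := Submodule.pi Set.univ fun s => (M s).deg m
  decomposition := by
    refine (isInternal_of_proj _ (fun m => LinearMap.pi fun s => (M s).component m ∘ₗ
      LinearMap.proj s) (fun m x hx => ?_) (fun m m' hmn x hx => ?_) ?_).chooseDecomposition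
    · exact funext fun s => (M s).component_of_mem (hx s trivial)
    · exact funext fun s => (M s).component_of_mem_ne (hx s trivial) hmn
    · rw [eq_top_iff]
      intro x _
      rw [← Finset.univ_sum_single x]
      refine sum_mem fun s _ => (M s).induction_homogeneous
        (C := fun y => Pi.single s y ∈ ⨆ m, Submodule.pi Set.univ fun s => (M s).deg m) (x s)
        (by rw [Pi.single_zero]; exact zero_mem _)
        (fun x y hx hy => by rw [Pi.single_add]; exact add_mem hx hy)
        fun m y hy => Submodule.mem_iSup_of_mem m fun t _ => ?_
      by_cases h : s = t
      · subst h
        rwa [Pi.single_eq_same]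
      · rw [Pi.single_eq_of_ne' h]
        exact zero_mem _
  smul_mem i n r x hr hx := fun s hs => (M s).smul_mem i n r (x s) hr (hx s hs)

theorem mem_pi_deg {n : ℕ} {M : Fin n → GrMod 𝒜} {m : ℤ} {x : (pi M).carrier} :
    x ∈ (pi M).deg m ↔ ∀ s, x s ∈ (M s).deg m :=
  ⟨fun h s => h s trivial, fun h s _ => h s⟩

/-- The component of degree `m` of a product. -/
def piDegEquiv {n : ℕ} (M : Fin n → GrMod 𝒜) (m : ℤ) :
    (pi M).deg m ≃ₗ[k] (∀ s, (M s).deg m) where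
  toFun x s := ⟨x.1 s, x.2 s trivial⟩
  invFun y := ⟨fun s => (y s).1, fun s _ => (y s).2⟩
  map_add' _ _ := rfl
  map_smul' _ _ := rfl
  left_inv _ := rfl
  right_inv _ := rfl

theorem isInjective_pi {n : ℕ} {M : Fin n → GrMod 𝒜} (h : ∀ s, (M s).IsInjective) :
    (pi M).IsInjective := by
  intro L N g f hg
  choose e he using fun s => h s L N g ⟨LinearMap.proj s ∘ₗ f.toLinearMap,
    fun m x hx => f.map_deg m x hx s trivial⟩ hg
  exact ⟨⟨LinearMap.pi fun s => (e s).toLinearMap, fun m x hx s _ => (e s).map_deg m x hx⟩,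
    fun x => funext fun s => he s x⟩

/-- A graded module that is injective as an ungraded module is injective: from an ungraded
extension of a graded homomorphism one keeps the part that preserves degrees. -/
theorem isInjective_of_injective [Decomposition 𝒜] {E : GrMod 𝒜}
    (hE : Module.Injective A E.carrier) : E.IsInjective := by
  intro M N g f hg
  obtain ⟨h, hh⟩ := hE.out g.toLinearMap hg f.toLinearMap
  let h₀ : N.carrier →ₗ[k] E.carrier :=
    (DirectSum.toModule k ℤ E.carrier fun n =>
      E.component n ∘ₗ h.restrictScalars k ∘ₗ (N.deg n).subtype) ∘ₗ
        (decomposeLinearEquiv N.deg).toLinearMap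
  have h₀_of_mem : ∀ n, ∀ x ∈ N.deg n, h₀ x = E.component n (h x) := by
    intro n x hx
    have : decomposeLinearEquiv N.deg x = DirectSum.lof k ℤ (fun n => N.deg n) n ⟨x, hx⟩ :=
      decompose_of_mem _ hx
    rw [LinearMap.comp_apply, LinearEquiv.coe_coe, this, DirectSum.toModule_lof]
    rfl
  let h₁ : N.carrier →ₗ[A] E.carrier :=
    { h₀ with
      map_smul' := map_smul_of_homogeneous h₀ fun i r hr n x hx => by
        rw [h₀_of_mem _ _ (N.smul_mem i n r x hr hx), h₀_of_mem _ _ hx, map_smul,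
          E.component_smul hr] }
  refine ⟨⟨h₁, fun n x hx => ?_⟩, fun x => ?_⟩
  · change h₀ x ∈ _
    rw [h₀_of_mem n x hx]
    exact E.component_mem _ _
  · refine M.induction_homogeneous (C := fun x => h₁ (g x) = f x) x ?_ (fun x y hx hy => ?_)
      fun n x hx => ?_
    · rw [map_zero, map_zero, map_zero]
    · rw [map_add, map_add, map_add, hx, hy]
    · change h₀ (g x) = f x
      rw [h₀_of_mem n _ (g.map_deg n x hx), hh, E.component_of_mem (f.map_deg n x hx)]

theorem shift_deg (M : GrMod 𝒜) (i n : ℤ) : (M.shift i).deg n = M.deg (i + n) := rfl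

/-- A homomorphism out of `M(i)` is one from `M` to a module shifted back. -/
def Hom.unshift {M N : GrMod 𝒜} {i : ℤ} (f : Hom (M.shift i) N) : Hom M (N.shift (-i)) :=
  ⟨f.toLinearMap, fun n x hx => f.map_deg (-i + n) x (by
    rwa [shift_deg, add_neg_cancel_left])⟩

/-- A homomorphism into `N(i)` is one into `N` from a module shifted back. -/
def Hom.unshift' {M N : GrMod 𝒜} {i : ℤ} (f : Hom M (N.shift i)) : Hom (M.shift (-i)) N :=
  ⟨f.toLinearMap, fun n x hx => by
    have := f.map_deg (-i + n) x hx
    rwa [shift_deg, add_neg_cancel_left] at this⟩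

theorem IsInjective.shift {E : GrMod 𝒜} (h : E.IsInjective) (i : ℤ) :
    (E.shift i).IsInjective := by
  intro M N g f hg
  obtain ⟨e, he⟩ := h (M.shift (-i)) (N.shift (-i)) (g.shift (-i)) f.unshift' hg
  refine ⟨⟨e.toLinearMap, fun n x hx => e.map_deg (i + n) x ?_⟩, he⟩
  rwa [shift_deg, neg_add_cancel_left]

/-- Two projective covers of the same module are isomorphic over it. -/
theorem IsProjectiveCover.exists_bijective {P P' M : GrMod 𝒜} {p : Hom P M} {p' : Hom P' M}
    (h : IsProjectiveCover p) (h' : IsProjectiveCover p') :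
    ∃ e : Hom P P', Function.Bijective e ∧ ∀ x, p' (e x) = p x := by
  obtain ⟨e, he⟩ := h.1 P' M p' p h'.2.1
  have hes : Function.Surjective e := h'.2.2 P e (by
    rw [show p' ∘ e = p from funext he]
    exact h.2.1)
  obtain ⟨s, hs⟩ := h'.1 P P' e (Hom.id P') hes
  -- The splitting of `e` is onto because `p` is essential, so `e` is injective.
  have hss : Function.Surjective s := h.2.2 P' s (by
    intro m
    obtain ⟨x, hx⟩ := h'.2.1 m
    refine ⟨x, ?_⟩
    rw [Function.comp_apply, ← he, hs]
    exact hx)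
  refine ⟨e, ⟨?_, hes⟩, he⟩
  intro x y hxy
  obtain ⟨x, rfl⟩ := hss x
  obtain ⟨y, rfl⟩ := hss y
  rw [hs, hs] at hxy
  exact congrArg s hxy

/-- Two injective hulls of the same module are isomorphic under it. -/
theorem IsInjectiveHull.exists_bijective {E E' M : GrMod 𝒜} {i : Hom M E} {i' : Hom M E'}
    (h : IsInjectiveHull i) (h' : IsInjectiveHull i') :
    ∃ e : Hom E E', Function.Bijective e ∧ ∀ x, e (i x) = i' x := by
  obtain ⟨e, he⟩ := h'.1 M E i i' h.2.1
  have hei : Function.Injective e := h.2.2 E' e (by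
    rw [show e ∘ i = i' from funext he]
    exact h'.2.1)
  obtain ⟨s, hs⟩ := h.1 E E' e (Hom.id E) hei
  -- The retraction of `e` is injective because `i'` is essential, so `e` is onto.
  have hsi : Function.Injective s := h'.2.2 E s (by
    rw [show s ∘ i' = i from funext fun x => by rw [Function.comp_apply, ← he, hs]; rfl]
    exact h.2.1)
  exact ⟨e, ⟨hei, fun y => ⟨s y, hsi (hs (s y))⟩⟩, he⟩

end Basic
end GrMod

/-! ### Sums of the modules `A e_i`: projective covers and injective hulls -/

namespace GrMod

section Idempotents

variable {k : Type u} [Field k] {A : Type a} [Ring A] [Algebra k A] {𝒜 : ℕ → Submodule k A}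
  [GradedAlgebra 𝒜] {Q : Type v}

/-- The graded module `A e_i` generated by a degree-zero element `e_i` of the algebra. -/
def principal {e : Q → A} (he : ∀ i, e i ∈ 𝒜 0) (i : Q) : GrMod 𝒜 :=
  (regular 𝒜).cyclic (n := 0) (x := e i) (he i)

variable (𝒜) in
/-- A graded algebra with a complete system of orthogonal idempotents `e_i` spanning its component
of degree zero, such that the graded modules `A e_i` are injective of Loewy length three: they live
in the degrees `0`, `1`, `2`, of dimensions `1`, at least `2`, and `1`, their socles are the
components of degree `2`, and every simple module occurs as such a socle. -/
structure IsLoewyThree [Fintype Q] (e : Q → A) (he : ∀ i, e i ∈ 𝒜 0) : Prop where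
  idem : ∀ i, e i * e i = e i
  orth : ∀ i j, i ≠ j → e i * e j = 0
  sum_eq_one : ∑ i, e i = 1
  le_span : 𝒜 0 ≤ Submodule.span k (Set.range e)
  deg_eq_bot : ∀ i (n : ℤ), n ≠ 0 → n ≠ 1 → n ≠ 2 → (principal he i).deg n = ⊥
  finite : ∀ i n, Module.Finite k ((principal he i).deg n)
  finrank_zero : ∀ i, Module.finrank k ((principal he i).deg 0) = 1
  finrank_one : ∀ i, 2 ≤ Module.finrank k ((principal he i).deg 1)
  finrank_two : ∀ i, Module.finrank k ((principal he i).deg 2) = 1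
  socle_zero : ∀ i, ∀ x ∈ (principal he i).deg 0, (∀ y ∈ 𝒜 2, y • x = 0) → x = 0
  socle_one : ∀ i, ∀ x ∈ (principal he i).deg 1, (∀ y ∈ 𝒜 1, y • x = 0) → x = 0
  injective : ∀ i, (principal he i).IsInjective
  exists_socle : ∀ l, ∃ i, ∃ z ∈ (principal he i).deg 2, z ≠ 0 ∧ e l • z = z

theorem regular_smul_mem (M : GrMod 𝒜) {m n : ℤ} {r : A} {x : M.carrier}
    (hr : r ∈ (regular 𝒜).deg m) (hx : x ∈ M.deg n) : r • x ∈ M.deg (m + n) := by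
  match m, hr with
  | Int.ofNat m, hr => exact M.smul_mem m n r x hr hx
  | Int.negSucc m, hr =>
    rw [(Submodule.mem_bot k).1 hr, zero_smul]
    exact zero_mem _

section Principal

variable {e : Q → A} (he : ∀ i, e i ∈ 𝒜 0) (i : Q)

/-- The inclusion of `A e_i` into `A`. -/
def principalVal : (principal he i).carrier →ₗ[A] A := (Submodule.span A {e i}).subtype

/-- The generator `e_i` of `A e_i`. -/
def principalGen : (principal he i).carrier :=
  (⟨e i, Submodule.mem_span_singleton_self _⟩ : Submodule.span A {e i})

theorem principalVal_principalGen : principalVal he i (principalGen he i) = e i := rfl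

theorem principalVal_injective : Function.Injective (principalVal he i) :=
  Submodule.injective_subtype _

theorem mem_principal_deg {m : ℤ} {x : (principal he i).carrier} :
    x ∈ (principal he i).deg m ↔ principalVal he i x ∈ (regular 𝒜).deg m := Iff.rfl

theorem principalGen_mem : principalGen he i ∈ (principal he i).deg 0 := he i

theorem principalVal_mul (hidem : ∀ i, e i * e i = e i) (x : (principal he i).carrier) :
    principalVal he i x * e i = principalVal he i x := by
  have hx : principalVal he i x ∈ Submodule.span A {e i} :=
    Subtype.property (p := fun y => y ∈ Submodule.span A {e i}) x
  obtain ⟨r, hr⟩ := Submodule.mem_span_singleton.1 hx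
  rw [← hr, smul_eq_mul, mul_assoc, hidem]

theorem principalVal_smul_principalGen (hidem : ∀ i, e i * e i = e i)
    (x : (principal he i).carrier) :
    principalVal he i x • principalGen he i = x := by
  apply principalVal_injective
  rw [map_smul, principalVal_principalGen, smul_eq_mul, principalVal_mul he i hidem]

end Principal

section Free

variable {e : Q → A} (he : ∀ i, e i ∈ 𝒜 0) {n : ℕ} (v : Fin n → Q) (p : ℤ)

/-- The direct sum of the modules `A e_{v s}`, with generators in degree `p`. -/
def free : GrMod 𝒜 := pi fun s => (principal he (v s)).shift (-p)

/-- The coordinates of an element of `free he v p`. -/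
def freeCoord (s : Fin n) : (free he v p).carrier →ₗ[A] (principal he (v s)).carrier :=
  LinearMap.proj (φ := fun s => (principal he (v s)).carrier) s

/-- The inclusions of the summands of `free he v p`. -/
def freeSingle (s : Fin n) : (principal he (v s)).carrier →ₗ[A] (free he v p).carrier :=
  LinearMap.single A (fun s => (principal he (v s)).carrier) s

theorem freeCoord_single_same (s : Fin n) (x : (principal he (v s)).carrier) :
    freeCoord he v p s (freeSingle he v p s x) = x :=
  Pi.single_eq_same (M := fun s => (principal he (v s)).carrier) s x

theorem freeCoord_single_ne {s t : Fin n} (h : t ≠ s) (x : (principal he (v s)).carrier) :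
    freeCoord he v p t (freeSingle he v p s x) = 0 :=
  Pi.single_eq_of_ne (M := fun s => (principal he (v s)).carrier) h x

theorem free_ext {f g : (free he v p).carrier}
    (h : ∀ s, freeCoord he v p s f = freeCoord he v p s g) : f = g := funext h

theorem mem_free_deg {m : ℤ} {x : (free he v p).carrier} :
    x ∈ (free he v p).deg m ↔ ∀ s, freeCoord he v p s x ∈ (principal he (v s)).deg (-p + m) :=
  mem_pi_deg

theorem freeSingle_mem {m : ℤ} {s : Fin n} {x : (principal he (v s)).carrier}
    (hx : x ∈ (principal he (v s)).deg (-p + m)) :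
    freeSingle he v p s x ∈ (free he v p).deg m := by
  rw [mem_free_deg]
  intro t
  by_cases h : t = s
  · subst h
    rwa [freeCoord_single_same]
  · rw [freeCoord_single_ne he v p h]
    exact zero_mem _

theorem sum_freeSingle (f : (free he v p).carrier) :
    ∑ s, freeSingle he v p s (freeCoord he v p s f) = f := by
  refine free_ext he v p fun t => ?_
  rw [map_sum, Finset.sum_eq_single t]
  · rw [freeCoord_single_same]
  · intro s _ hs
    rw [freeCoord_single_ne he v p hs.symm]
  · simp

/-- The component of degree `p + m` of `free he v p`. -/
def freeDegEquiv (m : ℤ) :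
    (free he v p).deg (p + m) ≃ₗ[k] (∀ s, (principal he (v s)).deg m) :=
  (piDegEquiv _ _).trans (LinearEquiv.piCongrRight fun s =>
    LinearEquiv.ofEq _ _ (by rw [shift_deg, neg_add_cancel_left]))

/-- The generators of `free he v p`. -/
def freeGen (s : Fin n) : (free he v p).carrier := freeSingle he v p s (principalGen he (v s))

theorem freeGen_mem (s : Fin n) : freeGen he v p s ∈ (free he v p).deg p := by
  refine freeSingle_mem he v p ?_
  rw [neg_add_cancel]
  exact principalGen_mem he _

theorem sum_smul_freeGen (hidem : ∀ i, e i * e i = e i) (f : (free he v p).carrier) :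
    ∑ s, principalVal he _ (freeCoord he v p s f) • freeGen he v p s = f := by
  conv_rhs => rw [← sum_freeSingle he v p f]
  refine Finset.sum_congr rfl fun s _ => ?_
  rw [freeGen, ← map_smul, principalVal_smul_principalGen he _ hidem]

/-- The homomorphism out of `free he v p` that sends the generators to given elements. -/
def freeLift {N : GrMod 𝒜} (x : Fin n → N.carrier) (hx : ∀ s, x s ∈ N.deg p) :
    Hom (free he v p) N where
  toLinearMap := ∑ s, (LinearMap.toSpanSingleton A N.carrier (x s)) ∘ₗ
    principalVal he (v s) ∘ₗ freeCoord he v p s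
  map_deg m f hf := by
    rw [LinearMap.sum_apply]
    refine sum_mem fun s _ => ?_
    have := N.regular_smul_mem (r := principalVal he _ (freeCoord he v p s f)) (m := -p + m)
      ((mem_free_deg he v p).1 hf s) (hx s)
    rwa [neg_add_eq_sub, sub_add_cancel] at this

theorem freeLift_apply {N : GrMod 𝒜} (x : Fin n → N.carrier) (hx : ∀ s, x s ∈ N.deg p)
    (f : (free he v p).carrier) :
    freeLift he v p x hx f = ∑ s, principalVal he _ (freeCoord he v p s f) • x s := by
  change (∑ s, _ : (free he v p).carrier →ₗ[A] N.carrier) f = _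
  rw [LinearMap.sum_apply]
  rfl

theorem freeLift_freeGen {N : GrMod 𝒜} (x : Fin n → N.carrier) (hx : ∀ s, x s ∈ N.deg p)
    (s : Fin n) : freeLift he v p x hx (freeGen he v p s) = e (v s) • x s := by
  rw [freeLift_apply, Finset.sum_eq_single s]
  · rw [freeGen, freeCoord_single_same, principalVal_principalGen]
  · intro t _ h
    rw [freeGen, freeCoord_single_ne he v p h, map_zero, zero_smul]
  · simp

theorem Hom.free_apply (hidem : ∀ i, e i * e i = e i) {N : GrMod 𝒜} (g : Hom (free he v p) N)
    (f : (free he v p).carrier) :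
    g f = ∑ s, principalVal he _ (freeCoord he v p s f) • g (freeGen he v p s) := by
  conv_lhs => rw [← sum_smul_freeGen he v p hidem f]
  rw [map_sum]
  simp only [map_smul]

theorem isProjective_free (hidem : ∀ i, e i * e i = e i) : (free he v p).IsProjective := by
  intro M N g f hg
  choose y hy hgy using fun s =>
    g.exists_mem_deg hg (f.map_deg p _ (freeGen_mem he v p s))
  refine ⟨freeLift he v p y hy, fun x => ?_⟩
  rw [freeLift_apply, map_sum, f.free_apply he v p hidem]
  simp only [map_smul, hgy]

theorem generatedInDegree_free (hidem : ∀ i, e i * e i = e i) :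
    (free he v p).GeneratedInDegree p := by
  rw [GeneratedInDegree, eq_top_iff]
  intro f _
  rw [← sum_smul_freeGen he v p hidem f]
  exact sum_mem fun s _ => Submodule.smul_mem _ _ (Submodule.subset_span (freeGen_mem he v p s))

end Free

namespace IsLoewyThree

variable [Fintype Q] {e : Q → A} {he : ∀ i, e i ∈ 𝒜 0} (h : IsLoewyThree 𝒜 e he)
  {n : ℕ} (v : Fin n → Q) (p : ℤ)

include h

theorem finite_free (m : ℤ) : Module.Finite k ((free he v p).deg m) := by
  have := h.finite
  rw [← add_sub_cancel p m]
  exact Module.Finite.equiv (freeDegEquiv he v p (m - p)).symm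

theorem free_deg_eq_bot {m : ℤ} (h0 : m ≠ p) (h1 : m ≠ p + 1) (h2 : m ≠ p + 2) :
    (free he v p).deg m = ⊥ := by
  rw [eq_bot_iff]
  intro x hx
  rw [mem_free_deg] at hx
  refine (Submodule.mem_bot k).2 (free_ext he v p fun s => ?_)
  have := hx s
  rwa [h.deg_eq_bot _ _ (by omega) (by omega) (by omega), Submodule.mem_bot,
    ← map_zero (freeCoord he v p s)] at this

theorem finrank_free (m : ℤ) : Module.finrank k ((free he v p).deg (p + m)) =
    ∑ s, Module.finrank k ((principal he (v s)).deg m) := by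
  have := h.finite
  rw [(freeDegEquiv he v p m).finrank_eq, Module.finrank_pi_fintype]

theorem finrank_free_zero : Module.finrank k ((free he v p).deg p) = n := by
  have := h.finrank_free v p 0
  rw [add_zero] at this
  simp [this, h.finrank_zero]

theorem finrank_free_one : 2 * n ≤ Module.finrank k ((free he v p).deg (p + 1)) := by
  rw [h.finrank_free v p 1]
  calc 2 * n = ∑ _s : Fin n, 2 := by simp [mul_comm]
    _ ≤ _ := Finset.sum_le_sum fun s _ => h.finrank_one _

theorem finrank_free_two : Module.finrank k ((free he v p).deg (p + 2)) = n := by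
  simp [h.finrank_free v p 2, h.finrank_two]

theorem free_socle_zero {x : (free he v p).carrier} (hx : x ∈ (free he v p).deg p)
    (hy : ∀ y ∈ 𝒜 2, y • x = 0) : x = 0 := by
  rw [mem_free_deg, neg_add_cancel] at hx
  refine free_ext he v p fun s => ?_
  rw [map_zero]
  exact h.socle_zero _ _ (hx s) fun y h' => by rw [← map_smul, hy y h', map_zero]

theorem free_socle_one {x : (free he v p).carrier} (hx : x ∈ (free he v p).deg (p + 1))
    (hy : ∀ y ∈ 𝒜 1, y • x = 0) : x = 0 := by
  rw [mem_free_deg, neg_add_cancel_left] at hx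
  refine free_ext he v p fun s => ?_
  rw [map_zero]
  exact h.socle_one _ _ (hx s) fun y h' => by rw [← map_smul, hy y h', map_zero]

theorem isInjective_free : (free he v p).IsInjective :=
  isInjective_pi fun s => (h.injective (v s)).shift _

/-- A homomorphism out of a sum of modules `A e_i` is injective if it is so on the socle. -/
theorem injective_of_socle {L : GrMod 𝒜} (g : Hom (free he v p) L)
    (hg : ∀ x ∈ (free he v p).deg (p + 2), g x = 0 → x = 0) : Function.Injective g := by
  refine g.injective_of_deg fun m x hx hgx => ?_
  have key : ∀ i y, y ∈ 𝒜 i → i + m = p + 2 → y • x = 0 := by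
    intro i y hy hi
    refine hg _ ?_ (by rw [map_smul, hgx, smul_zero])
    rw [← hi]
    exact (free he v p).smul_mem i m y x hy hx
  by_cases h0 : m = p
  · subst h0
    exact h.free_socle_zero v m hx fun y hy => key 2 y hy (by push_cast; ring)
  by_cases h1 : m = p + 1
  · subst h1
    exact h.free_socle_one v p hx fun y hy => key 1 y hy (by push_cast; ring)
  by_cases h2 : m = p + 2
  · subst h2
    exact hg x hx hgx
  rwa [h.free_deg_eq_bot v p h0 h1 h2, Submodule.mem_bot] at hx

/-- A finite-dimensional component of a graded module has a basis of vectors that are each fixed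
by one of the idempotents. -/
theorem exists_basis (N : GrMod 𝒜) (p : ℤ) [Module.Finite k (N.deg p)] :
    ∃ (b : Module.Basis (Fin (Module.finrank k (N.deg p))) k (N.deg p))
      (v : Fin (Module.finrank k (N.deg p)) → Q), ∀ s, e (v s) • (b s : N.carrier) = b s := by
  classical
  let E : Q → N.deg p →ₗ[k] N.deg p := fun l =>
    ((Algebra.lsmul k k N.carrier (e l) : Module.End k N.carrier)).restrict (fun x hx => by
      have := N.smul_mem 0 p (e l) x (he l) hx
      rwa [Nat.cast_zero, zero_add] at this)
  have hE : ∀ l x, (E l x : N.carrier) = e l • (x : N.carrier) := fun l x => rfl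
  let W : Q → Submodule k (N.deg p) := fun l => LinearMap.range (E l)
  have hW : ∀ l, ∀ x ∈ W l, e l • (x : N.carrier) = x := by
    rintro l _ ⟨x, rfl⟩
    rw [hE, smul_smul, h.idem]
  have hint : IsInternal W := by
    refine isInternal_of_proj W E (fun l x hx => Subtype.ext (hW l x hx))
      (fun l l' hl x hx => ?_) ?_
    · obtain ⟨x, rfl⟩ := hx
      apply Subtype.ext
      rw [hE, hE, smul_smul, h.orth _ _ hl.symm, zero_smul]
      rfl
    · rw [eq_top_iff]
      intro x _
      have : x = ∑ l, E l x := by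
        apply Subtype.ext
        rw [AddSubmonoidClass.coe_finsetSum]
        simp only [hE]
        rw [← Finset.sum_smul, h.sum_eq_one, one_smul]
      rw [this]
      exact sum_mem fun l _ => Submodule.mem_iSup_of_mem l ⟨x, rfl⟩
  let B := hint.collectedBasis fun l => Module.finBasis k (W l)
  let σ := Fintype.equivFinOfCardEq (Module.finrank_eq_card_basis B).symm
  refine ⟨B.reindex σ, fun s => (σ.symm s).1, fun s => ?_⟩
  rw [Module.Basis.reindex_apply]
  exact hW _ _ (hint.collectedBasis_mem _ _)

/-- A graded module with finite-dimensional component of degree `p` receives a homomorphism from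
a sum of modules `A e_i` generated in degree `p` that is bijective in degree `p`. -/
theorem exists_free_hom (N : GrMod 𝒜) (p : ℤ) [Module.Finite k (N.deg p)] :
    ∃ (v : Fin (Module.finrank k (N.deg p)) → Q) (π : Hom (free he v p) N),
      Function.Bijective (π.onDeg p) := by
  obtain ⟨b, v, hb⟩ := h.exists_basis N p
  let π := freeLift he v p (fun s => (b s : N.carrier)) (fun s => (b s).2)
  have hsurj : Function.Surjective (π.onDeg p) := by
    rw [← LinearMap.range_eq_top, ← top_le_iff, ← b.span_eq, Submodule.span_le]
    rintro _ ⟨s, rfl⟩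
    refine ⟨⟨freeGen he v p s, freeGen_mem he v p s⟩, Subtype.ext ?_⟩
    rw [Hom.coe_onDeg]
    exact (freeLift_freeGen he v p _ _ s).trans (hb s)
  have := h.finite_free v p p
  exact ⟨v, π, (LinearMap.injective_iff_surjective_of_finrank_eq_finrank
    (h.finrank_free_zero v p)).2 hsurj, hsurj⟩

/-- The sum of modules `A e_i` above a module generated in degree `p` is a projective cover. -/
theorem isProjectiveCover {N : GrMod 𝒜} (hN : N.GeneratedInDegree p)
    (π : Hom (free he v p) N) (hπ : Function.Bijective (π.onDeg p)) : IsProjectiveCover π := by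
  refine ⟨isProjective_free he v p h.idem, π.surjective_of_onDeg hN hπ.2, fun L g hg => ?_⟩
  refine g.surjective_of_onDeg (generatedInDegree_free he v p h.idem) fun y => ?_
  obtain ⟨x, hx, hxy⟩ := (π.comp g).exists_mem_deg hg (π.onDeg p y).2
  exact ⟨⟨x, hx⟩, hπ.1 (Subtype.ext hxy)⟩

/-- A module generated in degree `p` has at most as many dimensions in degree `p + 2` as in
degree `p`, because the socles of the modules `A e_i` are one-dimensional. -/
theorem finrank_add_two_le {N : GrMod 𝒜} (hN : N.GeneratedInDegree p)
    [Module.Finite k (N.deg p)] : Module.Finite k (N.deg (p + 2)) ∧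
      Module.finrank k (N.deg (p + 2)) ≤ Module.finrank k (N.deg p) := by
  obtain ⟨v, π, hπ⟩ := h.exists_free_hom N p
  have := h.finite_free v p (p + 2)
  have hs := π.onDeg_surjective (π.surjective_of_onDeg hN hπ.2) (p + 2)
  refine ⟨Module.Finite.of_surjective _ hs, ?_⟩
  rw [← h.finrank_free_two v p]
  exact LinearMap.finrank_le_finrank_of_surjective hs

/-- A finite-dimensional graded module in the degrees `p + 1`, `p + 2` whose socle lies in degree
`p + 2` has an injective hull that is a sum of modules `A e_i`. -/
theorem exists_injectiveHull (X : GrMod 𝒜) (p : ℤ) (hX : ∀ m, m ≠ p + 1 → m ≠ p + 2 → X.deg m = ⊥)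
    [Module.Finite k (X.deg (p + 2))]
    (hsoc : ∀ x ∈ X.deg (p + 1), (∀ y ∈ 𝒜 1, y • x = 0) → x = 0) :
    ∃ (v : Fin (Module.finrank k (X.deg (p + 2))) → Q) (ι : Hom X (free he v p)),
      IsInjectiveHull ι ∧ Function.Bijective (ι.onDeg (p + 2)) := by
  classical
  obtain ⟨b, l, hb⟩ := h.exists_basis X (p + 2)
  choose v z hz hz0 hlz using fun s => h.exists_socle (l s)
  refine ⟨v, ?_⟩
  let E := free he v p
  -- On the component of degree `p + 2` the embedding sends basis vectors to socle elements.
  let θ : X.deg (p + 2) →ₗ[k] E.carrier := b.constr k fun s => freeSingle he v p s (z s)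
  have hθb : ∀ s, θ (b s) = freeSingle he v p s (z s) := fun s => b.constr_basis k _ s
  have hθx : ∀ x, θ x = ∑ s, b.repr x s • θ (b s) := by
    intro x
    conv_lhs => rw [← b.sum_repr x]
    rw [map_sum]
    simp only [map_smul]
  have hθdeg : ∀ x, θ x ∈ E.deg (p + 2) := by
    intro x
    rw [hθx]
    refine sum_mem fun s _ => Submodule.smul_mem _ _ ?_
    rw [hθb]
    refine freeSingle_mem he v _ ?_
    rw [neg_add_cancel_left]
    exact hz s
  have hθinj : ∀ x, θ x = 0 → x = 0 := by
    intro x hx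
    refine b.ext_elem fun s => ?_
    have hs : (freeCoord he v p s).restrictScalars k (θ x) = 0 := by rw [hx, map_zero]
    rw [hθx, map_sum, Finset.sum_eq_single s, map_smul, hθb] at hs
    · rw [LinearMap.restrictScalars_apply, freeCoord_single_same] at hs
      rw [map_zero, Finsupp.zero_apply]
      exact (smul_eq_zero.1 hs).resolve_right (hz0 s)
    · intro t _ ht
      rw [map_smul, hθb, LinearMap.restrictScalars_apply, freeCoord_single_ne he v _ ht.symm,
        smul_zero]
    · simp
  have hzero : ∀ r ∈ 𝒜 0, ∀ x : X.deg (p + 2), r • (x : X.carrier) ∈ X.deg (p + 2) := by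
    intro r hr x
    have := X.smul_mem 0 (p + 2) r x hr x.2
    rwa [Nat.cast_zero, zero_add] at this
  have hθe : ∀ i (x : X.deg (p + 2)), θ ⟨e i • (x : X.carrier), hzero _ (he i) x⟩ = e i • θ x := by
    intro i
    let f₁ : X.deg (p + 2) →ₗ[k] E.carrier := θ ∘ₗ
      (Algebra.lsmul k k X.carrier (e i) : Module.End k X.carrier).restrict
        (fun x hx => hzero _ (he i) ⟨x, hx⟩)
    let f₂ : X.deg (p + 2) →ₗ[k] E.carrier :=
      (Algebra.lsmul k k E.carrier (e i) : Module.End k E.carrier) ∘ₗ θ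
    suffices f₁ = f₂ from fun x => LinearMap.congr_fun this x
    refine b.ext fun s => ?_
    change θ ⟨e i • (b s : X.carrier), hzero _ (he i) (b s)⟩ = e i • θ (b s)
    by_cases hil : i = l s
    · subst hil
      rw [hθb, ← map_smul, hlz, ← hθb]
      exact congrArg θ (Subtype.ext (hb s))
    · rw [hθb, ← map_smul, ← hlz, smul_smul, h.orth _ _ hil, zero_smul, map_zero, ← map_zero θ]
      refine congrArg θ (Subtype.ext ?_)
      change e i • (b s : X.carrier) = 0
      rw [← hb, smul_smul, h.orth _ _ hil, zero_smul]
  have hθsmul : ∀ r (hr : r ∈ 𝒜 0) (x : X.deg (p + 2)),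
      θ ⟨r • (x : X.carrier), hzero r hr x⟩ = r • θ x := by
    intro r hr x
    have hr' := h.le_span hr
    suffices ∃ hr : r • (x : X.carrier) ∈ X.deg (p + 2), θ ⟨r • (x : X.carrier), hr⟩ = r • θ x from
      this.2
    clear hr
    induction hr' using Submodule.span_induction with
    | mem r hr => obtain ⟨i, rfl⟩ := hr; exact ⟨_, hθe i x⟩
    | zero =>
      simp only [zero_smul]
      exact ⟨zero_mem _, map_zero θ⟩
    | add r r' _ _ h1 h2 =>
      simp only [add_smul]
      obtain ⟨m1, h1⟩ := h1
      obtain ⟨m2, h2⟩ := h2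
      refine ⟨add_mem m1 m2, ?_⟩
      rw [← h1, ← h2, ← map_add]
      rfl
    | smul c r _ h1 =>
      simp only [smul_assoc]
      obtain ⟨m1, h1⟩ := h1
      refine ⟨Submodule.smul_mem _ c m1, ?_⟩
      rw [← h1, ← map_smul]
      rfl
  have hpos : ∀ i ≠ 0, ∀ r ∈ 𝒜 i, ∀ x ∈ X.deg (p + 2), r • x = 0 := by
    intro i hi r hr x hx
    have := X.smul_mem i (p + 2) r x hr hx
    rwa [hX _ (by omega) (by omega), Submodule.mem_bot] at this
  -- The component of degree `p + 2` is a submodule.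
  let N : Submodule A X.carrier :=
    { X.deg (p + 2) with
      smul_mem' := by
        intro r x hx
        induction r using Decomposition.inductionOn 𝒜 with
        | zero => rw [zero_smul]; exact zero_mem (X.deg (p + 2))
        | @homogeneous i r =>
          by_cases hi : i = 0
          · subst hi
            exact hzero r r.2 ⟨x, hx⟩
          · rw [hpos i hi r r.2 x hx]
            exact zero_mem (X.deg (p + 2))
        | add r s hr hs => rw [add_smul]; exact add_mem (S := Submodule k X.carrier) hr hs }
  have hN : N.IsHomogeneous X.deg := by
    intro m x hx
    change X.component m x ∈ X.deg (p + 2)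
    change x ∈ X.deg (p + 2) at hx
    by_cases hm : p + 2 = m
    · subst hm
      rwa [X.component_of_mem hx]
    · rw [X.component_of_mem_ne hx hm]
      exact zero_mem _
  let θ₁ : (X.sub N hN).carrier →ₗ[k] E.carrier := θ
  have hθ₁ : ∀ (r : A) x, θ₁ (r • x) = r • θ₁ x := by
    refine map_smul_of_homogeneous θ₁ fun i r hr m x hx => ?_
    by_cases hi : i = 0
    · subst hi
      exact hθsmul r hr x
    · have h1 : r • x = 0 := Subtype.ext (hpos i hi r hr x.1 x.2)
      rw [h1, map_zero]
      have := E.smul_mem i (p + 2) r _ hr (hθdeg x)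
      rw [h.free_deg_eq_bot v p (by omega) (by omega) (by omega), Submodule.mem_bot] at this
      exact this.symm
  let f : Hom (X.sub N hN) E := ⟨{ θ₁ with map_smul' := hθ₁ }, fun m x hx => by
    by_cases hm : m = p + 2
    · subst hm
      exact hθdeg x
    · have : x = 0 := Subtype.ext (X.disjoint_deg hm hx x.2)
      rw [this, map_zero]
      exact zero_mem _⟩
  obtain ⟨ι, hι⟩ := h.isInjective_free v p _ _ (X.ofSub N hN) f (X.ofSub_injective N hN)
  have hιθ : ∀ x : X.deg (p + 2), ι (x : X.carrier) = θ x := fun x => hι x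
  have hιtop : ∀ x ∈ X.deg (p + 2), ι x = 0 → x = 0 := fun x hx h0 =>
    congrArg Subtype.val (hθinj ⟨x, hx⟩ ((hιθ ⟨x, hx⟩).symm.trans h0))
  have hιinj : Function.Injective ι := by
    refine ι.injective_of_deg fun m x hx h0 => ?_
    by_cases hm : m = p + 1
    · subst hm
      refine hsoc x hx fun y hy => hιtop _ ?_ (by rw [map_smul, h0, smul_zero])
      have := X.smul_mem 1 (p + 1) y x hy hx
      rwa [show ((1 : ℕ) : ℤ) + (p + 1) = p + 2 by push_cast; ring] at this
    by_cases hm1 : m = p + 2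
    · subst hm1
      exact hιtop x hx h0
    rwa [hX m hm hm1, Submodule.mem_bot] at hx
  have := h.finite_free v p (p + 2)
  have hbij : Function.Bijective (ι.onDeg (p + 2)) := by
    have hi := ι.onDeg_injective hιinj (p + 2)
    refine ⟨hi, (LinearMap.injective_iff_surjective_of_finrank_eq_finrank ?_).1 hi⟩
    exact (h.finrank_free_two v p).symm
  refine ⟨ι, ⟨h.isInjective_free v _, hιinj, fun L g hg => ?_⟩, hbij⟩
  refine h.injective_of_socle v p g fun x hx hgx => ?_
  obtain ⟨y, hy⟩ := hbij.2 ⟨x, hx⟩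
  have hy' : ι (y : X.carrier) = x := congrArg Subtype.val hy
  have : (y : X.carrier) = 0 := hg (by
    rw [Function.comp_apply, Function.comp_apply, hy', hgx, map_zero, map_zero])
  rw [← hy', this, map_zero]

end IsLoewyThree
end Idempotents
end GrMod

/-! ### The inequality for quotients and syzygies -/

namespace GrMod

section Dimensions

variable {k : Type u} [Field k] {A : Type a} [Ring A] [Algebra k A] {𝒜 : ℕ → Submodule k A}

theorem subsingleton_of_deg {M : GrMod 𝒜} (h : ∀ n, M.deg n = ⊥) : Subsingleton M.carrier :=
  subsingleton_of_forall_eq 0 fun x => M.eq_zero_of_component fun n =>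
    (Submodule.mem_bot k).1 (h n ▸ M.component_mem n x)

namespace Hom

variable {M N : GrMod 𝒜} (f : Hom M N)

theorem deg_eq_bot_of_surjective (hf : Function.Surjective f) {n : ℤ} (h : M.deg n = ⊥) :
    N.deg n = ⊥ := by
  rw [eq_bot_iff]
  intro y hy
  obtain ⟨x, hx, rfl⟩ := f.exists_mem_deg hf hy
  rw [h, Submodule.mem_bot] at hx
  rw [hx, map_zero]
  exact zero_mem _

theorem deg_eq_bot_of_injective (hf : Function.Injective f) {n : ℤ} (h : N.deg n = ⊥) :
    M.deg n = ⊥ := by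
  rw [eq_bot_iff]
  intro x hx
  have := f.map_deg n x hx
  rw [h, Submodule.mem_bot] at this
  exact (Submodule.mem_bot k).2 (hf (this.trans (map_zero _).symm))

theorem finite_of_surjective (hf : Function.Surjective f) (n : ℤ) [Module.Finite k (M.deg n)] :
    Module.Finite k (N.deg n) := Module.Finite.of_surjective _ (f.onDeg_surjective hf n)

theorem finite_of_injective (hf : Function.Injective f) (n : ℤ) [Module.Finite k (N.deg n)] :
    Module.Finite k (M.deg n) := Module.Finite.of_injective _ (f.onDeg_injective hf n)

theorem finrank_le_of_surjective (hf : Function.Surjective f) (n : ℤ)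
    [Module.Finite k (M.deg n)] : Module.finrank k (N.deg n) ≤ Module.finrank k (M.deg n) :=
  LinearMap.finrank_le_finrank_of_surjective (f.onDeg_surjective hf n)

theorem finrank_le_of_injective (hf : Function.Injective f) (n : ℤ)
    [Module.Finite k (N.deg n)] : Module.finrank k (M.deg n) ≤ Module.finrank k (N.deg n) :=
  LinearMap.finrank_le_finrank_of_injective (f.onDeg_injective hf n)

theorem generatedInDegree_of_surjective (hf : Function.Surjective f) {p : ℤ}
    (h : M.GeneratedInDegree p) : N.GeneratedInDegree p := by
  have : Submodule.map f.toLinearMap (Submodule.span A (M.deg p : Set M.carrier)) = ⊤ := by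
    rw [show Submodule.span A (M.deg p : Set M.carrier) = ⊤ from h, Submodule.map_top]
    exact LinearMap.range_eq_top.2 hf
  rw [Submodule.map_span] at this
  refine top_le_iff.1 (this.symm.le.trans (Submodule.span_mono ?_))
  rintro _ ⟨x, hx, rfl⟩
  exact f.map_deg p x hx

/-- The inclusion of the kernel of a homomorphism. -/
def kerIncl : Hom f.ker M := M.ofSub _ f.isHomogeneous_ker

theorem kerIncl_injective : Function.Injective f.kerIncl := M.ofSub_injective _ _

theorem exact_kerIncl : Function.Exact f.kerIncl f := fun x =>
  ⟨fun h => ⟨⟨x, h⟩, rfl⟩, fun ⟨y, hy⟩ => hy ▸ y.2⟩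

end Hom

/-- Dimensions add up along short exact sequences. -/
theorem finrank_of_exact {N P X : GrMod 𝒜} {i : Hom N P} {π : Hom P X}
    (hi : Function.Injective i) (hex : Function.Exact i π) (hπ : Function.Surjective π) (n : ℤ)
    [Module.Finite k (P.deg n)] : Module.finrank k (P.deg n) =
      Module.finrank k (N.deg n) + Module.finrank k (X.deg n) := by
  have hker : LinearMap.ker (π.onDeg n) = LinearMap.range (i.onDeg n) := by
    ext x
    constructor
    · intro hx
      obtain ⟨y, hy⟩ := (hex x).1 (congrArg Subtype.val hx)
      exact ⟨⟨y, i.mem_deg_of_injective hi (by rw [hy]; exact x.2)⟩, Subtype.ext hy⟩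
    · rintro ⟨y, rfl⟩
      exact Subtype.ext ((hex _).2 ⟨y, rfl⟩)
  rw [← LinearMap.finrank_range_add_finrank_ker (π.onDeg n),
    LinearMap.range_eq_top.2 (π.onDeg_surjective hπ n), finrank_top, add_comm, hker,
    LinearMap.finrank_range_of_inj (i.onDeg_injective hi n)]

/-- Dimensions are subadditive along three-term complexes that are exact in the middle. -/
theorem finrank_le_of_exact {N P X : GrMod 𝒜} {i : Hom N P} {π : Hom P X}
    (hex : ∀ x, π x = 0 → ∃ y, i y = x) (n : ℤ) [Module.Finite k (N.deg n)]
    [Module.Finite k (P.deg n)] [Module.Finite k (X.deg n)] : Module.finrank k (P.deg n) ≤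
      Module.finrank k (N.deg n) + Module.finrank k (X.deg n) := by
  rw [← LinearMap.finrank_range_add_finrank_ker (π.onDeg n), add_comm]
  refine add_le_add ?_ (Submodule.finrank_le _)
  refine le_trans (Submodule.finrank_mono ?_) (LinearMap.finrank_range_le (i.onDeg n))
  intro x hx
  obtain ⟨y, hy⟩ := hex x (congrArg Subtype.val hx)
  refine ⟨⟨N.component n y, N.component_mem n y⟩, Subtype.ext ?_⟩
  change i (N.component n y) = x
  rw [← i.component_map, hy, P.component_of_mem x.2]

/-- If two of its components vanish, so does a module that lives in two degrees. -/
theorem subsingleton_of_two {M : GrMod 𝒜} {p : ℤ}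
    (hM : ∀ m, m ≠ p → m ≠ p + 1 → M.deg m = ⊥) (h0 : M.deg p = ⊥) (h1 : M.deg (p + 1) = ⊥) :
    Subsingleton M.carrier := by
  refine subsingleton_of_deg fun m => ?_
  by_cases hm : m = p
  · rwa [hm]
  by_cases hm' : m = p + 1
  · rwa [hm']
  exact hM m hm hm'

theorem finrank_eq_zero_of_deg {M : GrMod 𝒜} {n : ℤ} (h : M.deg n = ⊥) :
    Module.finrank k (M.deg n) = 0 := by rw [h, finrank_bot]

theorem nontrivial_of_finrank {M : GrMod 𝒜} {n : ℤ} (h : Module.finrank k (M.deg n) ≠ 0) :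
    Nontrivial M.carrier := by
  by_contra hM
  rw [not_nontrivial_iff_subsingleton] at hM
  exact h (finrank_eq_zero_of_deg (eq_bot_iff.2 fun x _ =>
    (Submodule.mem_bot k).2 (Subsingleton.elim x 0)))

/-- In a module living in the degrees `p` and `p + 1`, the elements of degree `p` that lie in the
socle. -/
def lowSocle [GradedAlgebra 𝒜] (M : GrMod 𝒜) (p : ℤ)
    (hM : ∀ m, m ≠ p → m ≠ p + 1 → M.deg m = ⊥) : Submodule A M.carrier where
  carrier := {x | x ∈ M.deg p ∧ ∀ y ∈ 𝒜 1, y • x = 0}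
  zero_mem' := ⟨zero_mem _, fun y _ => smul_zero y⟩
  add_mem' hx hy := ⟨add_mem hx.1 hy.1, fun r hr => by
    rw [smul_add, hx.2 r hr, hy.2 r hr, add_zero]⟩
  smul_mem' := by
    rintro r x ⟨hx, hx1⟩
    induction r using Decomposition.inductionOn 𝒜 with
    | zero =>
      rw [zero_smul]
      exact ⟨zero_mem _, fun y _ => smul_zero y⟩
    | @homogeneous i r =>
      have hr := M.smul_mem i p r x r.2 hx
      by_cases h0 : i = 0
      · subst h0
        rw [Nat.cast_zero, zero_add] at hr
        exact ⟨hr, fun y hy => by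
          rw [smul_smul]
          exact hx1 _ (SetLike.GradedMul.mul_mem (A := 𝒜) hy r.2)⟩
      · suffices (r : A) • x = 0 by
          rw [this]
          exact ⟨zero_mem _, fun y _ => smul_zero y⟩
        by_cases h1 : i = 1
        · subst h1
          exact hx1 r r.2
        · rwa [hM _ (by omega) (by omega), Submodule.mem_bot] at hr
    | add r s hr hs =>
      rw [add_smul]
      exact ⟨add_mem hr.1 hs.1, fun y hy => by rw [smul_add, hr.2 y hy, hs.2 y hy, add_zero]⟩

theorem isHomogeneous_lowSocle [GradedAlgebra 𝒜] (M : GrMod 𝒜) (p : ℤ)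
    (hM : ∀ m, m ≠ p → m ≠ p + 1 → M.deg m = ⊥) :
    (M.lowSocle p hM).IsHomogeneous M.deg := by
  intro m x hx
  change M.component m x ∈ M.lowSocle p hM
  by_cases h : p = m
  · subst h
    rwa [M.component_of_mem hx.1]
  · rw [M.component_of_mem_ne hx.1 h]
    exact zero_mem _

end Dimensions

section Linear

variable {k : Type u} [Field k] {A : Type a} [Ring A] [Algebra k A] {𝒜 : ℕ → Submodule k A}

/-- A finite-dimensional graded module in the degrees `p` and `p + 1`, each of whose nonzero graded
quotients `U` satisfies `dim U_{p + 1} + ε ≤ dim U_p`. For `ε = 1` this is the strict inequality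
that holds for the syzygies of simple modules, for `ε = 0` the weak one that is left for the
kernels of their homomorphisms to simple modules. -/
structure IsLinear (ε : ℕ) (p : ℤ) (X : GrMod 𝒜) : Prop where
  deg_eq_bot : ∀ m, m ≠ p → m ≠ p + 1 → X.deg m = ⊥
  finite : ∀ m, Module.Finite k (X.deg m)
  bound : ∀ (U : GrMod 𝒜) (g : Hom X U), Function.Surjective g → Nontrivial U.carrier →
    Module.finrank k (U.deg (p + 1)) + ε ≤ Module.finrank k (U.deg p)

namespace IsLinear

variable {ε : ℕ} {p : ℤ} {X : GrMod 𝒜}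

theorem of_isIso {Y : GrMod 𝒜} (hX : IsLinear ε p X) (e : IsIso X Y) : IsLinear ε p Y := by
  obtain ⟨f, hf⟩ := e.exists_hom
  refine ⟨fun m h h' => f.deg_eq_bot_of_surjective hf.2 (hX.deg_eq_bot m h h'), fun m => ?_,
    fun U g hg hU => hX.bound U (g.comp f) (hg.comp hf.2) hU⟩
  have := hX.finite m
  exact f.finite_of_surjective hf.2 m

theorem shift (hX : IsLinear ε p X) {q : ℤ} (i : ℤ) (hq : i + q = p) :
    IsLinear ε q (X.shift i) := by
  subst hq
  refine ⟨fun m h h' => hX.deg_eq_bot _ (by omega) (by omega), fun m => hX.finite _,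
    fun U g hg hU => ?_⟩
  have := hX.bound (U.shift (-i)) g.unshift hg hU
  rwa [shift_deg, shift_deg, add_assoc, neg_add_cancel_left, neg_add_cancel_left] at this

theorem finrank_add_le (hX : IsLinear ε p X) [Nontrivial X.carrier] :
    Module.finrank k (X.deg (p + 1)) + ε ≤ Module.finrank k (X.deg p) :=
  hX.bound X (Hom.id X) Function.surjective_id inferInstance

/-- The kernel of a homomorphism to a module that is at most one-dimensional in degree `p` loses
at most one in the inequality for quotients. -/
theorem ker (hX : IsLinear (ε + 1) p X) {S : GrMod 𝒜} (f : Hom X S)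
    [Module.Finite k (S.deg p)] (hS : Module.finrank k (S.deg p) ≤ 1) : IsLinear ε p f.ker := by
  have := hX.finite
  refine ⟨fun m h h' => f.kerIncl.deg_eq_bot_of_injective f.kerIncl_injective
    (hX.deg_eq_bot m h h'), fun m => f.kerIncl.finite_of_injective f.kerIncl_injective m,
    fun U g hg hU => ?_⟩
  let L := (LinearMap.ker g.toLinearMap).map f.kerIncl.toLinearMap
  have hL : L.IsHomogeneous X.deg := isHomogeneous_map f.kerIncl g.isHomogeneous_ker
  let q := X.toQuot L hL
  have hq := X.toQuot_surjective L hL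
  obtain ⟨j, hj⟩ := Hom.exists_factor g hg (q.comp f.kerIncl) fun x hx =>
    (X.toQuot_eq_zero L hL _).2 ⟨x, hx, rfl⟩
  have hji : Function.Injective j := by
    refine (injective_iff_map_eq_zero j.toLinearMap).2 fun u hu => ?_
    obtain ⟨x, rfl⟩ := hg u
    rw [hj] at hu
    obtain ⟨y, hy, hyx⟩ := (X.toQuot_eq_zero L hL _).1 hu
    rw [← f.kerIncl_injective hyx]
    exact hy
  obtain ⟨f', hf'⟩ := Hom.exists_factor q hq f fun x hx => by
    obtain ⟨y, _, rfl⟩ := (X.toQuot_eq_zero L hL _).1 hx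
    exact (f.exact_kerIncl _).2 ⟨y, rfl⟩
  have hV := q.finite_of_surjective hq p
  have hV1 := q.finite_of_surjective hq (p + 1)
  have hU0 := j.finite_of_injective hji p
  have h1 := j.finrank_le_of_injective hji (p + 1)
  have h2 := finrank_le_of_exact (i := j) (π := f') (fun x hx => by
    obtain ⟨x, rfl⟩ := hq x
    rw [hf'] at hx
    obtain ⟨y, rfl⟩ := (f.exact_kerIncl x).1 hx
    exact ⟨g y, hj y⟩) p
  have h3 := hX.bound _ q hq hji.nontrivial
  omega

variable [GradedAlgebra 𝒜]

theorem generatedInDegree (hX : IsLinear ε p X) : X.GeneratedInDegree p := by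
  have := hX.finite
  let S := Submodule.span A (X.deg p : Set X.carrier)
  have hS : S.IsHomogeneous X.deg := X.isHomogeneous_span le_rfl
  let q := X.toQuot S hS
  have hq := X.toQuot_surjective S hS
  have h0 : (X.quot S hS).deg p = ⊥ := by
    rw [eq_bot_iff]
    intro y hy
    obtain ⟨x, hx, rfl⟩ := q.exists_mem_deg hq hy
    exact (Submodule.mem_bot k).2 ((X.toQuot_eq_zero S hS x).2 (Submodule.subset_span hx))
  have hsub : Subsingleton (X.quot S hS).carrier := by
    by_contra hU
    rw [not_subsingleton_iff_nontrivial] at hU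
    have hb := hX.bound _ q hq hU
    rw [finrank_eq_zero_of_deg h0] at hb
    have := q.finite_of_surjective hq (p + 1)
    have h1 := Submodule.finrank_eq_zero.1
      (show Module.finrank k ((X.quot S hS).deg (p + 1)) = 0 by omega)
    have := subsingleton_of_two (fun m h h' => q.deg_eq_bot_of_surjective hq
      (hX.deg_eq_bot m h h')) h0 h1
    exact not_subsingleton _ this
  exact eq_top_iff.2 fun x _ => (X.toQuot_eq_zero S hS x).1 (Subsingleton.elim _ _)

end IsLinear
end Linear

section Syzygies

variable {k : Type u} [Field k] {A : Type a} [Ring A] [Algebra k A] {𝒜 : ℕ → Submodule k A}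
  [GradedAlgebra 𝒜] {Q : Type v} [Fintype Q] {e : Q → A} {he : ∀ i, e i ∈ 𝒜 0}

namespace IsLoewyThree

variable (h : IsLoewyThree 𝒜 e he)

include h

/-- A syzygy of a module generated in degree `p` is the kernel of a projective cover by a sum of
modules `A e_i`. -/
theorem exists_presentation {X N : GrMod 𝒜} {p : ℤ} [Module.Finite k (X.deg p)]
    (hX : X.GeneratedInDegree p) (hN : IsSyzygy X N) :
    ∃ (v : Fin (Module.finrank k (X.deg p)) → Q) (i : Hom N (free he v p))
      (π : Hom (free he v p) X), Function.Bijective (π.onDeg p) ∧ Function.Injective i ∧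
        Function.Exact i π ∧ Function.Surjective π := by
  obtain ⟨P, i, π, hcov, hi, hex⟩ := hN
  obtain ⟨v, π', hπ'⟩ := h.exists_free_hom X p
  have hcov' := h.isProjectiveCover v p hX π' hπ'
  obtain ⟨s, hs, hsπ⟩ := hcov.exists_bijective hcov'
  refine ⟨v, s.comp i, π', hπ', hs.1.comp hi, fun x => ?_, hcov'.2.1⟩
  obtain ⟨x, rfl⟩ := hs.2 x
  rw [hsπ, hex]
  exact ⟨fun ⟨y, hy⟩ => ⟨y, congrArg s hy⟩, fun ⟨y, hy⟩ => ⟨y, hs.1 hy⟩⟩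

theorem exists_syzygy {X : GrMod 𝒜} {p : ℤ} [Module.Finite k (X.deg p)]
    (hX : X.GeneratedInDegree p) : ∃ (P N : GrMod 𝒜) (i : Hom N P) (π : Hom P X),
      P.GeneratedInDegree p ∧ IsProjectiveCover π ∧ Function.Injective i ∧
        Function.Exact i π := by
  obtain ⟨v, π, hπ⟩ := h.exists_free_hom X p
  exact ⟨_, _, π.kerIncl, π, generatedInDegree_free he v p h.idem,
    h.isProjectiveCover v p hX π hπ, π.kerIncl_injective, π.exact_kerIncl⟩

/-- The bound for those quotients of a syzygy that have no socle in the lower degree. -/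
theorem finrank_add_le_of_lowSocle_eq_bot {X N U : GrMod 𝒜} {ε : ℕ} {p : ℤ} (hX : IsLinear ε p X)
    {n : ℕ} {v : Fin n → Q} {i : Hom N (free he v p)} {π : Hom (free he v p) X}
    (hi : Function.Injective i) (hex : Function.Exact i π) (hπ : Function.Surjective π)
    (g : Hom N U) (hg : Function.Surjective g) [Nontrivial U.carrier]
    (hU : ∀ m, m ≠ p + 1 → m ≠ p + 2 → U.deg m = ⊥) (hUf : ∀ m, Module.Finite k (U.deg m))
    (hsoc : ∀ x ∈ U.deg (p + 1), (∀ y ∈ 𝒜 1, y • x = 0) → x = 0) :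
    Module.finrank k (U.deg (p + 2)) + ε ≤ Module.finrank k (U.deg (p + 1)) := by
  have hb0 : Module.finrank k (U.deg (p + 2)) ≠ 0 := by
    intro hb
    have hbot := Submodule.finrank_eq_zero.1 hb
    refine not_subsingleton U.carrier (subsingleton_of_two (p := p + 1) (fun m h h' =>
      hU m h (by omega)) ?_ (by rwa [add_assoc]))
    rw [eq_bot_iff]
    intro x hx
    refine (Submodule.mem_bot k).2 (hsoc x hx fun y hy => ?_)
    have := U.smul_mem 1 (p + 1) y x hy hx
    rwa [show ((1 : ℕ) : ℤ) + (p + 1) = p + 2 by push_cast; ring, hbot, Submodule.mem_bot] at this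
  obtain ⟨w, ι, hι, hι2⟩ := h.exists_injectiveHull U p hU hsoc
  have hE := h.finite_free w p
  obtain ⟨φ, hφ⟩ := hι.1 _ _ i (ι.comp g) hi
  -- The image of `φ` contains the socle of `E`, so it has full dimension in degree `p` too.
  have hφs : Function.Surjective φ := by
    let R := LinearMap.range φ.toLinearMap
    let W := (free he w p).sub R φ.isHomogeneous_range
    let j : Hom W (free he w p) := (free he w p).ofSub R φ.isHomogeneous_range
    have hj : Function.Injective j := (free he w p).ofSub_injective R _
    obtain ⟨φ', hφ'⟩ := Hom.exists_lift j hj φ fun x => ⟨⟨φ x, ⟨x, rfl⟩⟩, rfl⟩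
    have hφ's : Function.Surjective φ' := by
      rintro ⟨_, x, rfl⟩
      exact ⟨x, hj (hφ' x)⟩
    have hWgen := φ'.generatedInDegree_of_surjective hφ's (generatedInDegree_free he v p h.idem)
    have := j.finite_of_injective hj p
    have h2 := (h.finrank_add_two_le p hWgen).2
    have := (h.finrank_add_two_le p hWgen).1
    have h3 : Module.finrank k ((free he w p).deg (p + 2)) ≤ Module.finrank k (W.deg (p + 2)) := by
      refine LinearMap.finrank_le_finrank_of_surjective (f := j.onDeg (p + 2)) fun y => ?_
      obtain ⟨u, hu⟩ := hι2.2 y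
      obtain ⟨x, hx⟩ := hg u
      have hy : j (φ' (i x)) = y := by
        rw [hφ', hφ, Hom.comp_apply, hx]
        exact congrArg Subtype.val hu
      exact ⟨⟨φ' (i x), j.mem_deg_of_injective hj (by rw [hy]; exact y.2)⟩, Subtype.ext hy⟩
    have h4 := j.finrank_le_of_injective hj p
    rw [h.finrank_free_two] at h3
    rw [h.finrank_free_zero] at h4
    have hjs : Function.Surjective j := j.surjective_of_onDeg (generatedInDegree_free he w p h.idem)
      ((LinearMap.injective_iff_surjective_of_finrank_eq_finrank
        (by rw [h.finrank_free_zero]; omega)).1 (j.onDeg_injective hj p))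
    intro y
    obtain ⟨x, rfl⟩ := hjs y
    obtain ⟨x, rfl⟩ := hφ's x
    exact ⟨x, (hφ' x).symm⟩
  let R := LinearMap.range ι.toLinearMap
  let q := (free he w p).toQuot R ι.isHomogeneous_range
  have hq : Function.Surjective q := (free he w p).toQuot_surjective R _
  have hιq : Function.Exact ι q := (free he w p).toQuot_eq_zero R _
  obtain ⟨r, hr⟩ := Hom.exists_factor π hπ (q.comp φ) fun x hx => by
    obtain ⟨y, rfl⟩ := (hex x).1 hx
    rw [Hom.comp_apply, hφ]
    exact (hιq _).2 ⟨g y, rfl⟩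
  have hrs : Function.Surjective r := fun y => by
    obtain ⟨x, rfl⟩ := hq y
    obtain ⟨x, rfl⟩ := hφs x
    exact ⟨π x, hr x⟩
  have d0 := finrank_of_exact hι.2.1 hιq hq p
  have d1 := finrank_of_exact hι.2.1 hιq hq (p + 1)
  rw [h.finrank_free_zero, finrank_eq_zero_of_deg (hU p (by omega) (by omega)), zero_add] at d0
  have e1 := h.finrank_free_one w p
  have hb := hX.bound _ r hrs (nontrivial_of_finrank (n := p) (by rw [← d0]; exact hb0))
  omega

/-- The inequality for quotients passes to syzygies: a quotient of `Ω X` that violates it has,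
after division by its socle in the lower degree, an injective hull whose cokernel is a quotient
of `X` that violates it. -/
theorem isLinear_syzygy {X N : GrMod 𝒜} {ε : ℕ} (hε : ε ≤ 1) {p : ℤ} (hX : IsLinear ε p X)
    (hN : IsSyzygy X N) : IsLinear ε (p + 1) N := by
  have := hX.finite
  obtain ⟨v, i, π, hπ, hi, hex, hπs⟩ := h.exists_presentation hX.generatedInDegree hN
  have hP := h.finite_free v p
  have hNbot : ∀ m, m ≠ p + 1 → m ≠ p + 2 → N.deg m = ⊥ := by
    intro m h1 h2
    by_cases h0 : m = p
    · subst h0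
      rw [eq_bot_iff]
      intro x hx
      have : π.onDeg m ⟨i x, i.map_deg m x hx⟩ = 0 := Subtype.ext ((hex _).2 ⟨x, rfl⟩)
      have := congrArg Subtype.val (hπ.1 (this.trans (map_zero _).symm))
      exact (Submodule.mem_bot k).2 (hi (this.trans (map_zero _).symm))
    · exact i.deg_eq_bot_of_injective hi (h.free_deg_eq_bot v p h0 h1 h2)
  have hNf : ∀ m, Module.Finite k (N.deg m) := fun m => i.finite_of_injective hi m
  refine ⟨fun m h1 h2 => hNbot m h1 (by omega), hNf, fun U g hg hU => ?_⟩
  have hUbot : ∀ m, m ≠ p + 1 → m ≠ p + 1 + 1 → U.deg m = ⊥ := fun m h1 h2 =>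
    g.deg_eq_bot_of_surjective hg (hNbot m h1 (by omega))
  have hUf : ∀ m, Module.Finite k (U.deg m) := fun m => g.finite_of_surjective hg m
  let T := U.lowSocle (p + 1) hUbot
  let q := U.toQuot T (U.isHomogeneous_lowSocle _ _)
  have hq : Function.Surjective q := U.toQuot_surjective T _
  have hq0 : ∀ x, q x = 0 ↔ x ∈ T := U.toQuot_eq_zero T _
  rw [show p + 1 + 1 = p + 2 by ring] at hUbot ⊢
  have hle : Module.finrank k (U.deg (p + 2)) ≤
      Module.finrank k ((U.quot T (U.isHomogeneous_lowSocle _ _)).deg (p + 2)) := by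
    have := q.finite_of_surjective hq (p + 2)
    refine LinearMap.finrank_le_finrank_of_injective (f := q.onDeg (p + 2))
      ((injective_iff_map_eq_zero _).2 fun x hx => Subtype.ext ?_)
    exact U.disjoint_deg (by omega) ((hq0 x).1 (congrArg Subtype.val hx)).1 x.2
  have hle' := q.finrank_le_of_surjective hq (p + 1)
  by_cases hnt : Nontrivial (U.quot T (U.isHomogeneous_lowSocle _ _)).carrier
  · have := h.finrank_add_le_of_lowSocle_eq_bot hX hi hex hπs (q.comp g) (hq.comp hg)
      (fun m h1 h2 => q.deg_eq_bot_of_surjective hq (hUbot m h1 h2))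
      (fun m => q.finite_of_surjective hq m) (fun x hx hx1 => by
        obtain ⟨x, hx', rfl⟩ := q.exists_mem_deg hq hx
        refine (hq0 x).2 ⟨hx', fun y hy => ?_⟩
        have h2 := (hq0 (y • x)).1 (by rw [map_smul]; exact hx1 y hy)
        exact U.disjoint_deg (by push_cast; omega) (U.smul_mem 1 (p + 1) y x hy hx') h2.1)
    omega
  · -- Here `U` is its own socle, concentrated in the lower degree.
    have : Subsingleton (U.quot T (U.isHomogeneous_lowSocle _ _)).carrier :=
      not_nontrivial_iff_subsingleton.1 hnt
    have hb : Module.finrank k (U.deg (p + 2)) = 0 :=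
      Nat.le_zero.1 (hle.trans (finrank_eq_zero_of_deg (eq_bot_iff.2 fun x _ =>
        (Submodule.mem_bot k).2 (Subsingleton.elim x 0))).le)
    have ha : Module.finrank k (U.deg (p + 1)) ≠ 0 := fun ha =>
      not_subsingleton U.carrier (subsingleton_of_two (p := p + 1)
        (fun m h1 h2 => hUbot m h1 (by omega)) (Submodule.finrank_eq_zero.1 ha)
        (by rw [add_assoc]; exact Submodule.finrank_eq_zero.1 hb))
    omega

/-- Syzygies of nonzero modules with the strict inequality do not vanish. -/
theorem nontrivial_syzygy {X N : GrMod 𝒜} {p : ℤ} (hX : IsLinear 1 p X) [Nontrivial X.carrier]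
    (hN : IsSyzygy X N) : Nontrivial N.carrier := by
  have := hX.finite
  obtain ⟨v, i, π, hπ, hi, hex, hπs⟩ := h.exists_presentation hX.generatedInDegree hN
  have hP := h.finite_free v p
  have h1 := hX.finrank_add_le
  have h2 := finrank_of_exact hi hex hπs (p + 2)
  rw [h.finrank_free_two,
    finrank_eq_zero_of_deg (hX.deg_eq_bot (p + 2) (by omega) (by omega))] at h2
  exact nontrivial_of_finrank (n := p + 2) (by omega)

/-- Modules with the inequality for quotients are Koszul. -/
theorem isKoszul {X : GrMod 𝒜} {ε : ℕ} (hε : ε ≤ 1) (hX : IsLinear ε 0 X) : X.IsKoszul := by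
  refine ⟨hX.generatedInDegree, ?_⟩
  have step : ∀ (n : ℕ) (Y : {Y : GrMod 𝒜 // IsLinear ε n Y}),
      ∃ (N : {N : GrMod 𝒜 // IsLinear ε (n + 1 : ℕ) N}) (P : GrMod 𝒜) (i : Hom N.1 P)
        (π : Hom P Y.1), P.GeneratedInDegree n ∧ IsProjectiveCover π ∧ Function.Injective i ∧
          Function.Exact i π := by
    rintro n ⟨Y, hY⟩
    have := hY.finite
    obtain ⟨P, N, i, π, hP, hcov, hi, hex⟩ := h.exists_syzygy hY.generatedInDegree
    refine ⟨⟨N, ?_⟩, P, i, π, hP, hcov, hi, hex⟩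
    push_cast
    exact h.isLinear_syzygy hε hY ⟨P, i, π, hcov, hi, hex⟩
  choose N P i π hP hcov hi hex using step
  let Z : ∀ n : ℕ, {Y : GrMod 𝒜 // IsLinear ε n Y} := fun n =>
    Nat.rec ⟨X, hX⟩ (fun n Y => N n Y) n
  exact ⟨{
    P := fun n => P n (Z n)
    Z := fun n => (Z n).1
    Z_zero := IsIso.refl X
    p := fun n => π n (Z n)
    i := fun n => i n (Z n)
    cover := fun n => hcov n (Z n)
    injective := fun n => hi n (Z n)
    exact := fun n => hex n (Z n) }, fun n => hP n (Z n)⟩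

end IsLoewyThree
end Syzygies
end GrMod

/-! ### The inequality for submodules and cosyzygies -/

namespace GrMod

section CoLinear

variable {k : Type u} [Field k] {A : Type a} [Ring A] [Algebra k A] {𝒜 : ℕ → Submodule k A}

/-- A finite-dimensional graded module in the degrees `p` and `p + 1`, each of whose nonzero graded
submodules `U` satisfies `dim U_p < dim U_{p + 1}`. -/
structure IsCoLinear (p : ℤ) (X : GrMod 𝒜) : Prop where
  deg_eq_bot : ∀ m, m ≠ p → m ≠ p + 1 → X.deg m = ⊥
  finite : ∀ m, Module.Finite k (X.deg m)
  bound : ∀ (U : GrMod 𝒜) (g : Hom U X), Function.Injective g → Nontrivial U.carrier →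
    Module.finrank k (U.deg p) < Module.finrank k (U.deg (p + 1))

namespace IsCoLinear

variable {p : ℤ} {X : GrMod 𝒜}

theorem of_isIso {Y : GrMod 𝒜} (hX : IsCoLinear p X) (e : IsIso X Y) : IsCoLinear p Y := by
  obtain ⟨f, hf⟩ := e.symm.exists_hom
  refine ⟨fun m h h' => f.deg_eq_bot_of_injective hf.1 (hX.deg_eq_bot m h h'), fun m => ?_,
    fun U g hg hU => hX.bound U (f.comp g) (hf.1.comp hg) hU⟩
  have := hX.finite m
  exact f.finite_of_injective hf.1 m

theorem shift (hX : IsCoLinear p X) {q : ℤ} (i : ℤ) (hq : i + q = p) :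
    IsCoLinear q (X.shift i) := by
  subst hq
  refine ⟨fun m h h' => hX.deg_eq_bot _ (by omega) (by omega), fun m => hX.finite _,
    fun U g hg hU => ?_⟩
  have := hX.bound (U.shift (-i)) g.unshift' hg hU
  rwa [shift_deg, shift_deg, add_assoc, neg_add_cancel_left, neg_add_cancel_left] at this

theorem finrank_lt (hX : IsCoLinear p X) [Nontrivial X.carrier] :
    Module.finrank k (X.deg p) < Module.finrank k (X.deg (p + 1)) :=
  hX.bound X (Hom.id X) Function.injective_id inferInstance

theorem eq_zero_of_smul [GradedAlgebra 𝒜] (hX : IsCoLinear p X) {x : X.carrier}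
    (hx : x ∈ X.deg p) (hx1 : ∀ y ∈ 𝒜 1, y • x = 0) : x = 0 := by
  by_contra h0
  let T := X.lowSocle p hX.deg_eq_bot
  have hT := X.isHomogeneous_lowSocle p hX.deg_eq_bot
  have hb := hX.bound (X.sub T hT) (X.ofSub T hT) (X.ofSub_injective T hT)
    ⟨⟨x, hx, hx1⟩, 0, fun h => h0 (congrArg Subtype.val h)⟩
  have hbot : (X.sub T hT).deg (p + 1) = ⊥ := eq_bot_iff.2 fun y hy =>
    (Submodule.mem_bot k).2 (Subtype.ext (X.disjoint_deg (m := p) (by omega) y.2.1 hy))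
  rw [finrank_eq_zero_of_deg hbot] at hb
  exact absurd hb (Nat.not_lt_zero _)

end IsCoLinear
end CoLinear

section Cosyzygies

variable {k : Type u} [Field k] {A : Type a} [Ring A] [Algebra k A] {𝒜 : ℕ → Submodule k A}
  [GradedAlgebra 𝒜] {Q : Type v} [Fintype Q] {e : Q → A} {he : ∀ i, e i ∈ 𝒜 0}

namespace IsLoewyThree

variable (h : IsLoewyThree 𝒜 e he)

include h

theorem exists_hull_of_isCoLinear {X : GrMod 𝒜} {p : ℤ} (hX : IsCoLinear (p + 1) X) :
    ∃ (v : Fin (Module.finrank k (X.deg (p + 2))) → Q) (ι : Hom X (free he v p)),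
      IsInjectiveHull ι ∧ Function.Bijective (ι.onDeg (p + 2)) := by
  have := hX.finite
  exact h.exists_injectiveHull X p (fun m h1 h2 => hX.deg_eq_bot m h1 (by omega))
    fun x hx hx1 => hX.eq_zero_of_smul hx hx1

/-- A cosyzygy is the cokernel of an injective hull in a sum of modules `A e_i`. -/
theorem exists_copresentation {X N : GrMod 𝒜} {p : ℤ} (hX : IsCoLinear (p + 1) X)
    (hN : IsCosyzygy X N) :
    ∃ (v : Fin (Module.finrank k (X.deg (p + 2))) → Q) (ι : Hom X (free he v p))
      (π : Hom (free he v p) N), Function.Bijective (ι.onDeg (p + 2)) ∧ Function.Injective ι ∧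
        Function.Exact ι π ∧ Function.Surjective π := by
  obtain ⟨E, ι, π, hhull, hπ, hex⟩ := hN
  obtain ⟨v, ι', hhull', hι'⟩ := h.exists_hull_of_isCoLinear hX
  obtain ⟨s, hs, hsι⟩ := hhull'.exists_bijective hhull
  refine ⟨v, ι', π.comp s, hι', hhull'.2.1, fun x => ?_, hπ.comp hs.2⟩
  rw [Hom.comp_apply, hex]
  constructor
  · rintro ⟨y, hy⟩
    exact ⟨y, hs.1 (by rw [hsι, hy])⟩
  · rintro ⟨y, rfl⟩
    exact ⟨y, (hsι y).symm⟩

theorem exists_cosyzygy {X : GrMod 𝒜} {p : ℤ} (hX : IsCoLinear (p + 1) X) :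
    ∃ N, IsCosyzygy X N := by
  obtain ⟨v, ι, hι, -⟩ := h.exists_hull_of_isCoLinear hX
  exact ⟨_, _, ι, (free he v p).toQuot _ ι.isHomogeneous_range, hι,
    (free he v p).toQuot_surjective _ _, (free he v p).toQuot_eq_zero _ _⟩

/-- A homomorphism between sums of modules `A e_i` that is injective on the generators is
injective: its cokernel cannot be larger in degree `p + 2` than in degree `p`. -/
theorem injective_of_injective_onDeg {m n : ℕ} {v : Fin m → Q} {w : Fin n → Q} {p : ℤ}
    (φ : Hom (free he v p) (free he w p)) (hφ : Function.Injective (φ.onDeg p)) :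
    Function.Injective φ := by
  have hP := h.finite_free v p
  have hE := h.finite_free w p
  let R := LinearMap.range φ.toLinearMap
  have hR := φ.isHomogeneous_range
  let j : Hom ((free he w p).sub R hR) (free he w p) := (free he w p).ofSub R hR
  have hj : Function.Injective j := (free he w p).ofSub_injective R hR
  let q := (free he w p).toQuot R hR
  have hq : Function.Surjective q := (free he w p).toQuot_surjective R hR
  have hjq : Function.Exact j q := fun x => by
    refine ((free he w p).toQuot_eq_zero R hR x).trans ⟨fun hx => ⟨⟨x, hx⟩, rfl⟩, ?_⟩
    rintro ⟨y, rfl⟩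
    exact y.2
  obtain ⟨φ', hφ'⟩ := Hom.exists_lift j hj φ fun x => ⟨⟨φ x, ⟨x, rfl⟩⟩, rfl⟩
  have hφ's : Function.Surjective φ' := by
    rintro ⟨_, x, rfl⟩
    exact ⟨x, hj (hφ' x)⟩
  have d0 := finrank_of_exact hj hjq hq p
  have d2 := finrank_of_exact hj hjq hq (p + 2)
  have hWf := fun n => j.finite_of_injective hj n
  have hVf := fun n => q.finite_of_surjective hq n
  have hV := (h.finrank_add_two_le p (q.generatedInDegree_of_surjective hq
    (generatedInDegree_free he w p h.idem))).2
  have h0 : Module.finrank k ((free he v p).deg p) ≤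
      Module.finrank k (((free he w p).sub R hR).deg p) := by
    refine LinearMap.finrank_le_finrank_of_injective (f := φ'.onDeg p) fun x y hxy => hφ ?_
    refine Subtype.ext ?_
    rw [Hom.coe_onDeg, Hom.coe_onDeg, ← hφ', ← hφ']
    exact congrArg (fun z => j z.1) hxy
  have h2 := φ'.finrank_le_of_surjective hφ's (p + 2)
  rw [h.finrank_free_zero] at d0 h0
  rw [h.finrank_free_two] at d2 h2
  have hinj : Function.Injective (φ'.onDeg (p + 2)) :=
    (LinearMap.injective_iff_surjective_of_finrank_eq_finrank (by
      rw [h.finrank_free_two]; omega)).2 (φ'.onDeg_surjective hφ's _)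
  refine h.injective_of_socle v p φ fun x hx hφx => ?_
  have : φ'.onDeg (p + 2) ⟨x, hx⟩ = 0 := Subtype.ext (hj (by
    rw [Hom.coe_onDeg, hφ']
    exact hφx.trans (map_zero _).symm))
  exact congrArg Subtype.val (hinj (this.trans (map_zero _).symm))

/-- The inequality for submodules passes to cosyzygies: a submodule of `Ω⁻¹ X` that violates it
has a syzygy that embeds in `X` and violates it. -/
theorem isCoLinear_cosyzygy {X N : GrMod 𝒜} {p : ℤ} (hX : IsCoLinear (p + 1) X)
    (hN : IsCosyzygy X N) : IsCoLinear p N := by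
  have := hX.finite
  obtain ⟨v, ι, π, hι, hιi, hex, hπ⟩ := h.exists_copresentation hX hN
  have hE := h.finite_free v p
  have hNbot : ∀ m, m ≠ p → m ≠ p + 1 → N.deg m = ⊥ := by
    intro m h0 h1
    by_cases h2 : m = p + 2
    · subst h2
      rw [eq_bot_iff]
      intro y hy
      obtain ⟨x, hx, rfl⟩ := π.exists_mem_deg hπ hy
      obtain ⟨z, hz⟩ := hι.2 ⟨x, hx⟩
      exact (Submodule.mem_bot k).2 ((hex x).2 ⟨z, congrArg Subtype.val hz⟩)
    · exact π.deg_eq_bot_of_surjective hπ (h.free_deg_eq_bot v p h0 h1 h2)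
  have hNf : ∀ m, Module.Finite k (N.deg m) := fun m => π.finite_of_surjective hπ m
  refine ⟨hNbot, hNf, fun U g hg hU => ?_⟩
  have hUbot : ∀ m, m ≠ p → m ≠ p + 1 → U.deg m = ⊥ := fun m h0 h1 =>
    g.deg_eq_bot_of_injective hg (hNbot m h0 h1)
  have hUf : ∀ m, Module.Finite k (U.deg m) := fun m => g.finite_of_injective hg m
  by_cases ha : Module.finrank k (U.deg p) = 0
  · rw [ha, Nat.pos_iff_ne_zero]
    intro hb
    exact not_subsingleton U.carrier (subsingleton_of_two hUbot
      (Submodule.finrank_eq_zero.1 ha) (Submodule.finrank_eq_zero.1 hb))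
  obtain ⟨w, ρ, hρ⟩ := h.exists_free_hom U p
  have hP := h.finite_free w p
  obtain ⟨φ, hφ⟩ := isProjective_free he w p h.idem _ _ π (g.comp ρ) hπ
  have hφi : Function.Injective φ := by
    refine h.injective_of_injective_onDeg φ fun x y hxy => hρ.1 (Subtype.ext (hg ?_))
    have := congrArg (fun z : (free he v p).deg p => π z.1) hxy
    exact (hφ _).symm.trans (this.trans (hφ _))
  -- The kernel of `ρ` is sent into the kernel of `π`, which is `X`.
  obtain ⟨κ, hκ⟩ := Hom.exists_lift ι hιi (φ.comp ρ.kerIncl) fun x => (hex _).1 (by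
    rw [Hom.comp_apply, hφ, Hom.comp_apply, (ρ.exact_kerIncl _).2 ⟨x, rfl⟩, map_zero])
  have hκi : Function.Injective κ := fun x y hxy =>
    ρ.kerIncl_injective (hφi (by
      rw [← Hom.comp_apply, ← Hom.comp_apply, ← hκ, ← hκ, hxy]))
  have hKf : ∀ m, Module.Finite k (ρ.ker.deg m) := fun m =>
    ρ.kerIncl.finite_of_injective ρ.kerIncl_injective m
  have d1 := finrank_le_of_exact (i := ρ.kerIncl) (π := ρ)
    (fun x hx => (ρ.exact_kerIncl x).1 hx) (p + 1)
  have d2 := finrank_le_of_exact (i := ρ.kerIncl) (π := ρ)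
    (fun x hx => (ρ.exact_kerIncl x).1 hx) (p + 2)
  have d3 := ρ.kerIncl.finrank_le_of_injective ρ.kerIncl_injective (p + 2)
  have e1 := h.finrank_free_one w p
  rw [h.finrank_free_two] at d2 d3
  rw [finrank_eq_zero_of_deg (hUbot (p + 2) (by omega) (by omega))] at d2
  have hb := hX.bound _ κ hκi (nontrivial_of_finrank (n := p + 2) (by omega))
  rw [show p + 1 + 1 = p + 2 by ring] at hb
  omega

/-- Cosyzygies of nonzero modules with the inequality for submodules do not vanish. -/
theorem nontrivial_cosyzygy {X N : GrMod 𝒜} {p : ℤ} (hX : IsCoLinear (p + 1) X)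
    [Nontrivial X.carrier] (hN : IsCosyzygy X N) : Nontrivial N.carrier := by
  have := hX.finite
  obtain ⟨v, ι, π, hι, hιi, hex, hπ⟩ := h.exists_copresentation hX hN
  have hE := h.finite_free v p
  have h1 := hX.finrank_lt
  rw [show p + 1 + 1 = p + 2 by ring] at h1
  have h2 := finrank_of_exact hιi hex hπ p
  rw [h.finrank_free_zero, finrank_eq_zero_of_deg (hX.deg_eq_bot p (by omega) (by omega))] at h2
  exact nontrivial_of_finrank (n := p) (by omega)

end IsLoewyThree
end Cosyzygies

section Iterates

variable {k : Type u} [Field k] {A : Type a} [Ring A] [Algebra k A] {𝒜 : ℕ → Submodule k A}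

/-- Properties preserved by isomorphisms and by an operation hold for its iterates. -/
theorem Iterate.induction {R : GrMod 𝒜 → GrMod 𝒜 → Prop} {C : ℕ → GrMod 𝒜 → Prop}
    {M : GrMod 𝒜} (hM : ∀ X, IsIso M X → C 0 X)
    (hR : ∀ n X Y, C n X → R X Y → C (n + 1) Y) :
    ∀ {n : ℕ} {X : GrMod 𝒜}, Iterate R n M X → C n X
  | 0, X, hX => hM X hX
  | _ + 1, _, ⟨_, hL, hLX⟩ => hR _ _ _ (Iterate.induction hM hR hL) hLX

theorem Iterate.exists_of {R : GrMod 𝒜 → GrMod 𝒜 → Prop} {C : ℕ → GrMod 𝒜 → Prop}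
    {M : GrMod 𝒜} (hM : ∀ X, IsIso M X → C 0 X)
    (hR : ∀ n X Y, C n X → R X Y → C (n + 1) Y) (hex : ∀ n X, C n X → ∃ Y, R X Y) :
    ∀ n, ∃ X, Iterate R n M X
  | 0 => ⟨M, IsIso.refl M⟩
  | n + 1 => by
    obtain ⟨L, hL⟩ := Iterate.exists_of hM hR hex n
    obtain ⟨Y, hY⟩ := hex n L (Iterate.induction hM hR hL)
    exact ⟨Y, L, hL, hY⟩

theorem hasHilbertSeries_of_two {X : GrMod 𝒜} (hX : ∀ m, m ≠ 0 → m ≠ 1 → X.deg m = ⊥)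
    (hf : ∀ m, Module.Finite k (X.deg m)) :
    X.HasHilbertSeries (LaurentPolynomial.C (Module.finrank k (X.deg 0)) +
      LaurentPolynomial.C (Module.finrank k (X.deg 1)) * LaurentPolynomial.T 1) := by
  intro n
  refine ⟨hf n, ?_⟩
  rw [AddMonoidAlgebra.coeff_add, Finsupp.add_apply, LaurentPolynomial.C_apply,
    ← LaurentPolynomial.single_eq_C_mul_T, AddMonoidAlgebra.coeff_single, Finsupp.single_apply]
  by_cases h0 : n = 0
  · subst h0
    simp
  by_cases h1 : n = 1
  · subst h1
    simp
  rw [finrank_eq_zero_of_deg (hX n h0 h1), if_neg h0, if_neg (Ne.symm h1), zero_add]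

theorem IsIso.nontrivial {M N : GrMod 𝒜} (e : IsIso M N) (hM : Nontrivial M.carrier) :
    Nontrivial N.carrier := by
  obtain ⟨f, hf⟩ := e.exists_hom
  exact hf.1.nontrivial

variable [GradedAlgebra 𝒜] {Q : Type v} [Fintype Q] {e : Q → A} {he : ∀ i, e i ∈ 𝒜 0}

namespace IsLoewyThree

variable (h : IsLoewyThree 𝒜 e he)

include h

theorem isLinear_isF {X Y : GrMod 𝒜} (hX : IsLinear 1 0 X ∧ Nontrivial X.carrier)
    (hY : IsF X Y) : IsLinear 1 0 Y ∧ Nontrivial Y.carrier := by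
  obtain ⟨L, hL, hLY⟩ := hY
  have := hX.2
  have hnt : Nontrivial L.carrier := h.nontrivial_syzygy hX.1 hL
  exact ⟨((h.isLinear_syzygy le_rfl hX.1 hL).shift 1 (by norm_num)).of_isIso hLY,
    hLY.nontrivial hnt⟩

theorem isCoLinear_isFInv {X Y : GrMod 𝒜} (hX : IsCoLinear 0 X ∧ Nontrivial X.carrier)
    (hY : IsFInv X Y) : IsCoLinear 0 Y ∧ Nontrivial Y.carrier := by
  obtain ⟨L, hL, hLY⟩ := hY
  have := hX.2
  have hX' : IsCoLinear (-1 + 1) X := hX.1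
  have hnt : Nontrivial L.carrier := h.nontrivial_cosyzygy hX' hL
  exact ⟨((h.isCoLinear_cosyzygy hX' hL).shift (-1) (by norm_num)).of_isIso hLY,
    hLY.nontrivial hnt⟩

/-- The modules `F^n M` exist and have Hilbert series `a + b t` with `b < a`, if the nonzero
quotients of `M` satisfy this inequality. -/
theorem iterate_isF {M : GrMod 𝒜} (hM : IsLinear 1 0 M) [Nontrivial M.carrier] (n : ℕ) :
    (∃ X, Iterate IsF n M X) ∧ ∀ X, Iterate IsF n M X → ∃ a b : ℕ, b < a ∧
      X.HasHilbertSeries (LaurentPolynomial.C a +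
        LaurentPolynomial.C b * LaurentPolynomial.T 1) := by
  have h0 : ∀ X, IsIso M X → IsLinear 1 0 X ∧ Nontrivial X.carrier := fun X hX =>
    ⟨hM.of_isIso hX, hX.nontrivial inferInstance⟩
  refine ⟨Iterate.exists_of (C := fun _ X => IsLinear 1 0 X ∧ Nontrivial X.carrier) h0
    (fun _ X Y => h.isLinear_isF) (fun _ X hX => ?_) n, fun X hX => ?_⟩
  · have := hX.1.finite
    obtain ⟨P, N, i, π, _, hcov, hi, hex⟩ := h.exists_syzygy hX.1.generatedInDegree
    exact ⟨_, N, ⟨P, i, π, hcov, hi, hex⟩, IsIso.refl _⟩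
  · obtain ⟨hX, _⟩ := Iterate.induction (C := fun _ X => IsLinear 1 0 X ∧ Nontrivial X.carrier)
      h0 (fun _ X Y => h.isLinear_isF) hX
    exact ⟨_, _, hX.finrank_add_le, hasHilbertSeries_of_two hX.deg_eq_bot hX.finite⟩

/-- The modules `F^{-n} M` exist and have Hilbert series `a + b t` with `a < b`, if the nonzero
submodules of `M` satisfy this inequality. -/
theorem iterate_isFInv {M : GrMod 𝒜} (hM : IsCoLinear 0 M) [Nontrivial M.carrier] (n : ℕ) :
    (∃ X, Iterate IsFInv n M X) ∧ ∀ X, Iterate IsFInv n M X → ∃ a b : ℕ, a < b ∧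
      X.HasHilbertSeries (LaurentPolynomial.C a +
        LaurentPolynomial.C b * LaurentPolynomial.T 1) := by
  have h0 : ∀ X, IsIso M X → IsCoLinear 0 X ∧ Nontrivial X.carrier := fun X hX =>
    ⟨hM.of_isIso hX, hX.nontrivial inferInstance⟩
  refine ⟨Iterate.exists_of (C := fun _ X => IsCoLinear 0 X ∧ Nontrivial X.carrier) h0
    (fun _ X Y => h.isCoLinear_isFInv) (fun _ X hX => ?_) n, fun X hX => ?_⟩
  · have hX' : IsCoLinear (-1 + 1) X := hX.1
    obtain ⟨N, hN⟩ := h.exists_cosyzygy hX'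
    exact ⟨_, N, hN, IsIso.refl _⟩
  · obtain ⟨hX, _⟩ := Iterate.induction (C := fun _ X => IsCoLinear 0 X ∧ Nontrivial X.carrier)
      h0 (fun _ X Y => h.isCoLinear_isFInv) hX
    exact ⟨_, _, hX.finrank_lt, hasHilbertSeries_of_two hX.deg_eq_bot hX.finite⟩

/-- The kernels of homomorphisms from shifted syzygies of `M` to modules that are at most
one-dimensional in degree zero are Koszul. -/
theorem isKoszul_ker {M : GrMod 𝒜} (hM : IsLinear 1 0 M) {n : ℕ} {X S : GrMod 𝒜}
    (hX : Iterate IsSyzygy n M X) [Module.Finite k (S.deg 0)]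
    (hS : Module.finrank k (S.deg 0) ≤ 1) (f : Hom (X.shift n) S) : f.ker.IsKoszul := by
  have : IsLinear 1 n X := Iterate.induction (C := fun n X => IsLinear 1 n X)
    (fun X hX => hM.of_isIso hX) (fun n X Y hX hXY => by
      push_cast
      exact h.isLinear_syzygy le_rfl hX hXY) hX
  exact h.isKoszul (ε := 0) zero_le_one ((this.shift n (add_zero _)).ker f hS)

end IsLoewyThree
end Iterates
end GrMod

/-! ### The socle of a self-injective quiver algebra of Loewy length three -/

section PathAlgebra

variable {k : Type u} [Field k] {Q : Type v} [Quiver.{w} Q]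

theorem vertexElt_mul_pathElt (p : Paths Q) :
    vertexElt k p.2.1 * pathElt k p = pathElt k p := by
  obtain ⟨i, j, p⟩ := p
  rw [vertexElt, pathElt_mul_pathElt, pathMul_comp, Quiver.Path.comp_nil]

theorem vertexElt_mul_self (i : Q) : vertexElt k i * vertexElt k i = vertexElt k i :=
  vertexElt_mul_pathElt ⟨i, i, Quiver.Path.nil⟩

theorem vertexElt_mul_pathElt_ne {j : Q} {p : Paths Q} (h : p.2.1 ≠ j) :
    vertexElt k j * pathElt k p = 0 := by
  rw [vertexElt, pathElt_mul_pathElt, pathMul_ne h]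

theorem vertexElt_mul_vertexElt_ne {i j : Q} (h : i ≠ j) :
    vertexElt k i * vertexElt k j = 0 :=
  vertexElt_mul_pathElt_ne (p := ⟨j, j, Quiver.Path.nil⟩) h.symm

theorem length_of_mem_pathGrading [Fintype Q] {n : ℕ} {x : PathAlgebra k Q}
    (hx : x ∈ pathGrading k Q n) {p : Paths Q} (hp : (pathBasis k Q).repr x p ≠ 0) :
    p.2.2.length = n := by
  have : x ∈ Submodule.span k (pathBasis k Q '' {p : Paths Q | p.2.2.length = n}) := hx
  rw [Module.Basis.mem_span_image] at this
  exact this (Finsupp.mem_support_iff.2 hp)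

/-- A path of length zero is trivial. -/
theorem pathElt_of_length_zero {p : Paths Q} (hp : p.2.2.length = 0) :
    pathElt k p = vertexElt k p.1 := by
  obtain ⟨i, j, p⟩ := p
  cases p with
  | nil => rfl
  | cons p a => simp at hp

/-- A path of length one is an arrow. -/
theorem exists_arrow {p : Paths Q} (hp : p.2.2.length = 1) :
    ∃ a : p.1 ⟶ p.2.1, p = ⟨p.1, p.2.1, a.toPath⟩ := by
  obtain ⟨i, j, p⟩ := p
  cases p with
  | nil => simp at hp
  | cons p a =>
    cases p with
    | nil => exact ⟨a, rfl⟩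
    | cons p b => simp at hp

end PathAlgebra

namespace RelationIdeal

variable {k : Type u} [Field k] {Q : Type v} [Fintype Q] [Quiver.{w} Q] (I : RelationIdeal k Q)

/-- Relations have no part of degree less than two. -/
theorem eq_zero_of_quot {n : ℕ} (hn : n < 2) {x : PathAlgebra k Q}
    (hx : x ∈ pathGrading k Q n) (h : I.quot x = 0) : x = 0 := by
  refine (pathBasis k Q).ext_elem fun p => ?_
  rw [map_zero, Finsupp.zero_apply]
  by_contra hp
  have h2 := I.le_two x (I.quot_eq_zero.1 h) p hp
  rw [length_of_mem_pathGrading hx hp] at h2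
  omega

theorem quot_pathElt_ne_zero {p : Paths Q} (hp : p.2.2.length < 2) :
    I.quot (pathElt k p) ≠ 0 := fun h =>
  (pathBasis k Q).ne_zero p (I.eq_zero_of_quot hp (pathElt_mem p) h)

theorem idem_ne_zero (i : Q) : I.idem i ≠ 0 := I.quot_pathElt_ne_zero (by simp)

theorem idem_mul_idem (i : Q) : I.idem i * I.idem i = I.idem i := by
  rw [idem, ← map_mul, vertexElt_mul_self]

theorem idem_mul_idem_ne {i j : Q} (h : i ≠ j) : I.idem i * I.idem j = 0 := by
  rw [idem, idem, ← map_mul, vertexElt_mul_vertexElt_ne h, map_zero]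

theorem sum_idem : ∑ i, I.idem i = 1 := by
  simp only [idem]
  rw [← map_sum, ← one_def, map_one]

theorem grading_zero_le : I.grading 0 ≤ Submodule.span k (Set.range I.idem) := by
  rintro _ ⟨x, hx, rfl⟩
  suffices pathGrading k Q 0 ≤ (Submodule.span k (Set.range I.idem)).comap I.quot.toLinearMap from
    this hx
  rw [pathGrading, Submodule.span_le]
  rintro _ ⟨p, hp, rfl⟩
  rw [pathElt_of_length_zero hp]
  exact Submodule.subset_span ⟨p.1, rfl⟩

/-- The component of degree `n` of the right ideal `e_j Λ`. -/
def piece (j : Q) (n : ℕ) : Submodule k I.Alg :=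
  I.grading n ⊓ LinearMap.eqLocus (LinearMap.mulLeft k (I.idem j)) LinearMap.id

theorem mem_piece {j : Q} {n : ℕ} {x : I.Alg} :
    x ∈ I.piece j n ↔ x ∈ I.grading n ∧ I.idem j * x = x := Iff.rfl

theorem mul_mem_grading {m n : ℕ} {x y : I.Alg} (hx : x ∈ I.grading m) (hy : y ∈ I.grading n) :
    x * y ∈ I.grading (m + n) := SetLike.GradedMul.mul_mem hx hy

theorem mul_idem_mem {n : ℕ} {x : I.Alg} (hx : x ∈ I.grading n) (l : Q) :
    x * I.idem l ∈ I.grading n := by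
  have := I.mul_mem_grading hx (I.idem_mem l)
  rwa [add_zero] at this

theorem sum_mul_idem (x : I.Alg) : ∑ l, x * I.idem l = x := by
  rw [← Finset.mul_sum, sum_idem, mul_one]

theorem disjoint_grading {m n : ℕ} (h : m ≠ n) {x : I.Alg} (hm : x ∈ I.grading m)
    (hn : x ∈ I.grading n) : x = 0 := by
  rw [← decompose_of_mem_same I.grading hn, decompose_of_mem_ne I.grading hm h]

theorem piece_zero (j : Q) : I.piece j 0 = Submodule.span k {I.idem j} := by
  refine le_antisymm ?_ ?_
  · rintro x ⟨hx, hjx⟩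
    change I.idem j * x = x at hjx
    rw [← hjx]
    have := I.grading_zero_le hx
    clear hx hjx
    induction this using Submodule.span_induction with
    | mem x hx =>
      obtain ⟨i, rfl⟩ := hx
      by_cases h : j = i
      · subst h
        rw [idem_mul_idem]
        exact Submodule.mem_span_singleton_self _
      · rw [idem_mul_idem_ne I h]
        exact zero_mem _
    | zero => rw [mul_zero]; exact zero_mem _
    | add x y _ _ hx hy => rw [mul_add]; exact add_mem hx hy
    | smul c x _ hx => rw [mul_smul_comm]; exact Submodule.smul_mem _ c hx
  · rw [Submodule.span_singleton_le_iff_mem]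
    exact ⟨I.idem_mem j, I.idem_mul_idem j⟩

theorem finrank_piece_zero (j : Q) : Module.finrank k (I.piece j 0) = 1 := by
  rw [piece_zero, finrank_span_singleton (I.idem_ne_zero j)]

/-- The element of `Λ` given by an arrow with target `j`. -/
def arrow {j : Q} (a : Σ i : Q, (i ⟶ j)) : I.Alg := I.quot (pathElt k ⟨a.1, j, a.2.toPath⟩)

theorem arrow_mem {j : Q} (a : Σ i : Q, (i ⟶ j)) : I.arrow a ∈ I.piece j 1 := by
  refine ⟨⟨_, pathElt_mem (k := k) (⟨a.1, j, a.2.toPath⟩ : Paths Q), rfl⟩, ?_⟩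
  change I.idem j * I.arrow a = I.arrow a
  have h : vertexElt k j * pathElt k ⟨a.1, j, a.2.toPath⟩ = pathElt k ⟨a.1, j, a.2.toPath⟩ :=
    vertexElt_mul_pathElt ⟨a.1, j, a.2.toPath⟩
  rw [arrow, idem, ← map_mul, h]

theorem arrow_ne_zero {j : Q} (a : Σ i : Q, (i ⟶ j)) : I.arrow a ≠ 0 :=
  I.quot_pathElt_ne_zero (by simp)

theorem piece_one (j : Q) : I.piece j 1 = Submodule.span k (Set.range (I.arrow (j := j))) := by
  refine le_antisymm ?_ ?_
  · rintro x ⟨⟨y, hy, rfl⟩, hjx⟩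
    change I.idem j * I.quot y = I.quot y at hjx
    change I.quot y ∈ _
    rw [← hjx]
    clear hjx
    change y ∈ Submodule.span k _ at hy
    induction hy using Submodule.span_induction with
    | mem x hx =>
      obtain ⟨p, hp, rfl⟩ := hx
      rw [idem, ← map_mul]
      by_cases h : p.2.1 = j
      · subst h
        rw [vertexElt_mul_pathElt]
        obtain ⟨a, ha⟩ := exists_arrow hp
        exact Submodule.subset_span ⟨⟨p.1, a⟩, congrArg (fun q => I.quot (pathElt k q)) ha.symm⟩
      · rw [vertexElt_mul_pathElt_ne h, map_zero]
        exact zero_mem _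
    | zero => rw [map_zero, mul_zero]; exact zero_mem _
    | add x y _ _ hx hy => rw [map_add, mul_add]; exact add_mem hx hy
    | smul c x _ hx => rw [map_smul, mul_smul_comm]; exact Submodule.smul_mem _ c hx
  · rw [Submodule.span_le]
    rintro _ ⟨a, rfl⟩
    exact I.arrow_mem a

theorem linearIndependent_arrow (j : Q) : LinearIndependent k (I.arrow (j := j)) := by
  have hv : LinearIndependent k fun a : Σ i : Q, (i ⟶ j) =>
      pathBasis k Q ⟨a.1, j, a.2.toPath⟩ := by
    refine (pathBasis k Q).linearIndependent.comp
      (fun a : Σ i : Q, (i ⟶ j) => (⟨a.1, j, a.2.toPath⟩ : Paths Q)) ?_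
    rintro ⟨i, a⟩ ⟨i', a'⟩ h
    obtain rfl : i = i' := congrArg Sigma.fst h
    simp only [Sigma.mk.injEq, heq_eq_eq, true_and] at h
    exact congrArg _ (by simpa [Quiver.Hom.toPath] using h)
  refine hv.map (f := I.quot.toLinearMap) ?_
  rw [Submodule.disjoint_def]
  intro x hx h0
  refine I.eq_zero_of_quot (n := 1) one_lt_two ?_ h0
  refine Submodule.span_mono ?_ hx
  rintro _ ⟨a, rfl⟩
  exact ⟨⟨a.1, j, a.2.toPath⟩, by simp, rfl⟩

theorem finrank_piece_one [∀ i j : Q, Finite (i ⟶ j)] (j : Q) :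
    Module.finrank k (I.piece j 1) = indegree j := by
  have := Fintype.ofFinite (Σ i : Q, (i ⟶ j))
  rw [piece_one, finrank_span_eq_card (I.linearIndependent_arrow j), indegree,
    Nat.card_eq_fintype_card]

/-- The indegree of a vertex is the row sum of the incidence matrix. -/
theorem indegree_eq_sum [∀ i j : Q, Finite (i ⟶ j)] (j : Q) :
    indegree j = ∑ i, incidence Q j i := by
  rw [indegree, Nat.card_sigma]
  rfl

section Socle

/-- An element that is annihilated by the elements of positive degree lies in the socle. -/
theorem mem_rightSocle {x : I.Alg} (hx : ∀ m ≠ 0, ∀ y ∈ I.grading m, x * y = 0) :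
    x ∈ rightSocle I.Alg := by
  rw [← I.sum_mul_idem x]
  refine sum_mem fun l _ => ?_
  by_cases h0 : x * I.idem l = 0
  · rw [h0]
    exact zero_mem _
  have hspan : ∀ r : I.Alg, ∃ c : k, x * I.idem l * r = c • (x * I.idem l) := by
    intro r
    induction r using Decomposition.inductionOn I.grading with
    | zero => exact ⟨0, by rw [mul_zero, zero_smul]⟩
    | @homogeneous i r =>
      by_cases hi : i = 0
      · subst hi
        have hr := I.grading_zero_le r.2
        obtain ⟨r, hr0⟩ := r
        change r ∈ _ at hr
        change ∃ c : k, x * I.idem l * r = c • (x * I.idem l)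
        clear hr0
        induction hr using Submodule.span_induction with
        | mem r hr =>
          obtain ⟨i, rfl⟩ := hr
          by_cases hil : l = i
          · subst hil
            exact ⟨1, by rw [mul_assoc, idem_mul_idem, one_smul]⟩
          · exact ⟨0, by rw [mul_assoc, idem_mul_idem_ne I hil, mul_zero, zero_smul]⟩
        | zero => exact ⟨0, by rw [mul_zero, zero_smul]⟩
        | add r s _ _ hr hs =>
          obtain ⟨c, hc⟩ := hr
          obtain ⟨d, hd⟩ := hs
          exact ⟨c + d, by rw [mul_add, hc, hd, add_smul]⟩
        | smul a r _ hr =>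
          obtain ⟨c, hc⟩ := hr
          exact ⟨a * c, by rw [mul_smul_comm, hc, smul_smul]⟩
      · refine ⟨0, ?_⟩
        rw [mul_assoc, zero_smul]
        refine hx i hi _ ?_
        have := I.mul_mem_grading (I.idem_mem l) r.2
        rwa [zero_add] at this
    | add r s hr hs =>
      obtain ⟨c, hc⟩ := hr
      obtain ⟨d, hd⟩ := hs
      exact ⟨c + d, by rw [mul_add, hc, hd, add_smul]⟩
  refine Submodule.mem_sSup_of_mem (s := Submodule.span I.Algᵐᵒᵖ {x * I.idem l}) ?_
    (Submodule.mem_span_singleton_self _)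
  change IsSimpleModule _ _
  rw [isSimpleModule_iff_isAtom]
  refine ⟨fun h => h0 (Submodule.span_singleton_eq_bot.1 h), fun N hN => ?_⟩
  by_contra hN0
  obtain ⟨y, hy, hy0⟩ := N.ne_bot_iff.1 hN0
  refine hN.not_ge ?_
  rw [Submodule.span_singleton_le_iff_mem]
  obtain ⟨r, rfl⟩ := Submodule.mem_span_singleton.1 (hN.le hy)
  obtain ⟨c, hc⟩ := hspan r.unop
  rw [MulOpposite.smul_eq_mul_unop, hc] at hy hy0
  have hc0 : c ≠ 0 := fun h => hy0 (by rw [h, zero_smul])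
  have := N.smul_mem (MulOpposite.op (algebraMap k I.Alg c⁻¹)) hy
  rwa [MulOpposite.smul_eq_mul_unop, MulOpposite.unop_op, ← Algebra.commutes,
    ← Algebra.smul_def, smul_smul, inv_mul_cancel₀ hc0, one_smul] at this

variable {I} (hsoc : (rightSocle I.Alg : Set I.Alg) = I.grading 2)

include hsoc

theorem mem_grading_two {x : I.Alg} (hx : ∀ m ≠ 0, ∀ y ∈ I.grading m, x * y = 0) :
    x ∈ I.grading 2 := by
  have : x ∈ (rightSocle I.Alg : Set I.Alg) := I.mem_rightSocle hx
  rwa [hsoc] at this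

/-- The top degree of `Λ` lies in the socle, so it is at most two. -/
theorem grading_eq_bot (hfin : Module.Finite k I.Alg) {n : ℕ} (hn : 3 ≤ n) :
    I.grading n = ⊥ := by
  have hf : {n | I.grading n ≠ ⊥}.Finite :=
    Submodule.finite_ne_bot_of_iSupIndep
      (Decomposition.isInternal I.grading).submodule_iSupIndep
  by_contra h
  obtain ⟨N, hN, hmax⟩ := hf.exists_maximalFor id _ ⟨n, h⟩
  have hnN : n ≤ N := by
    rcases le_total n N with h' | h'
    · exact h'
    · exact hmax h h'
  obtain ⟨x, hx, hx0⟩ := (I.grading N).ne_bot_iff.1 hN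
  refine hx0 (I.disjoint_grading (m := N) (n := 2) (by omega) hx
    (mem_grading_two hsoc fun m hm y hy => ?_))
  have hxy := I.mul_mem_grading hx hy
  by_contra hne
  have hNm : I.grading (N + m) ≠ ⊥ := (Submodule.ne_bot_iff _).2 ⟨_, hxy, hne⟩
  have : N + m ≤ N := hmax hNm (Nat.le_add_right N m)
  omega

variable (hfin : Module.Finite k I.Alg)

include hfin

theorem eq_zero_of_mul_grading_one {x : I.Alg} (hx : x ∈ I.grading 1)
    (hx1 : ∀ y ∈ I.grading 1, x * y = 0) : x = 0 := by
  refine I.disjoint_grading (m := 1) (n := 2) (by omega) hx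
    (mem_grading_two hsoc fun m hm y hy => ?_)
  by_cases h1 : m = 1
  · subst h1
    exact hx1 y hy
  · have := I.mul_mem_grading hx hy
    rwa [grading_eq_bot hsoc hfin (by omega), Submodule.mem_bot] at this

/-- Because `Λ` is injective as a right module, every linear endomorphism of the socle that is
compatible with the right action of the idempotents is the left multiplication by an element of
degree zero. -/
theorem exists_scalars (hQF : IsQuasiFrobenius I.Alg) (θ : I.Alg →ₗ[k] I.Alg)
    (hθ2 : ∀ x ∈ I.grading 2, θ x ∈ I.grading 2)
    (hθ : ∀ x ∈ I.grading 2, ∀ l, θ (x * I.idem l) = θ x * I.idem l) :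
    ∃ c : Q → k, ∀ i, ∀ x ∈ I.piece i 2, θ x = c i • x := by
  have hmem : ∀ x, x ∈ rightSocle I.Alg ↔ x ∈ I.grading 2 := fun x => by
    rw [← SetLike.mem_coe, hsoc, SetLike.mem_coe]
  have hpos : ∀ i ≠ 0, ∀ r ∈ I.grading i, ∀ x ∈ I.grading 2, x * r = 0 := by
    intro i hi r hr x hx
    have := I.mul_mem_grading hx hr
    rwa [grading_eq_bot hsoc hfin (by omega), Submodule.mem_bot] at this
  have hpos' : ∀ i ≠ 0, ∀ r ∈ I.grading i, ∀ x ∈ I.grading 2, r * x = 0 := by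
    intro i hi r hr x hx
    have := I.mul_mem_grading hr hx
    rwa [grading_eq_bot hsoc hfin (by omega), Submodule.mem_bot] at this
  have hθr : ∀ x ∈ I.grading 2, ∀ r, θ (x * r) = θ x * r := by
    intro x hx r
    induction r using Decomposition.inductionOn I.grading with
    | zero => rw [mul_zero, map_zero, mul_zero]
    | @homogeneous i r =>
      by_cases hi : i = 0
      · subst hi
        have hr := I.grading_zero_le r.2
        obtain ⟨r, hr0⟩ := r
        change r ∈ _ at hr
        change θ (x * r) = θ x * r
        clear hr0
        induction hr using Submodule.span_induction with
        | mem r hr =>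
          obtain ⟨i, rfl⟩ := hr
          exact hθ x hx i
        | zero => rw [mul_zero, map_zero, mul_zero]
        | add r s _ _ hr hs => rw [mul_add, map_add, mul_add, hr, hs]
        | smul a r _ hr => rw [mul_smul_comm, map_smul, mul_smul_comm, hr]
      · rw [hpos i hi r r.2 x hx, map_zero, hpos i hi r r.2 _ (hθ2 x hx)]
    | add r s hr hs => rw [mul_add, map_add, mul_add, hr, hs]
  let g : rightSocle I.Alg →ₗ[I.Algᵐᵒᵖ] I.Alg :=
    { toFun := fun x => θ x
      map_add' := fun x y => map_add θ x.1 y.1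
      map_smul' := fun r x => hθr x.1 ((hmem _).1 x.2) r.unop }
  obtain ⟨f, hf⟩ := hQF.2.out (rightSocle I.Alg).subtype Subtype.val_injective g
  have hfx : ∀ x ∈ I.grading 2, θ x = f 1 * x := by
    intro x hx
    have h1 : f x = θ x := hf ⟨x, (hmem x).2 hx⟩
    have h2 := f.map_smul (MulOpposite.op x) 1
    rw [MulOpposite.smul_eq_mul_unop, MulOpposite.smul_eq_mul_unop, MulOpposite.unop_op,
      one_mul] at h2
    rw [← h1, h2]
  have hy : ∀ y : I.Alg, ∃ c : Q → k, ∀ i, ∀ x ∈ I.piece i 2, y * x = c i • x := by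
    intro y
    induction y using Decomposition.inductionOn I.grading with
    | zero => exact ⟨0, fun i x _ => by rw [zero_mul, Pi.zero_apply, zero_smul]⟩
    | @homogeneous j r =>
      by_cases hj : j = 0
      · subst hj
        have hr := I.grading_zero_le r.2
        obtain ⟨r, hr0⟩ := r
        change r ∈ _ at hr
        change ∃ c : Q → k, ∀ i, ∀ x ∈ I.piece i 2, r * x = c i • x
        clear hr0
        induction hr using Submodule.span_induction with
        | mem r hr =>
          classical
          obtain ⟨j, rfl⟩ := hr
          refine ⟨Pi.single j 1, fun i x hx => ?_⟩
          by_cases hij : i = j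
          · subst hij
            rw [Pi.single_eq_same, one_smul]
            exact hx.2
          · rw [Pi.single_eq_of_ne hij, zero_smul, ← (I.mem_piece.1 hx).2, ← mul_assoc,
              idem_mul_idem_ne I (Ne.symm hij), zero_mul]
        | zero => exact ⟨0, fun i x _ => by rw [zero_mul, Pi.zero_apply, zero_smul]⟩
        | add r s _ _ hr hs =>
          obtain ⟨c, hc⟩ := hr
          obtain ⟨d, hd⟩ := hs
          exact ⟨c + d, fun i x hx => by
            rw [add_mul, hc i x hx, hd i x hx, Pi.add_apply, add_smul]⟩
        | smul a r _ hr =>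
          obtain ⟨c, hc⟩ := hr
          exact ⟨a • c, fun i x hx => by
            rw [smul_mul_assoc, hc i x hx, Pi.smul_apply, smul_smul, smul_eq_mul]⟩
      · exact ⟨0, fun i x hx => by
          rw [hpos' j hj r r.2 x hx.1, Pi.zero_apply, zero_smul]⟩
    | add r s hr hs =>
      obtain ⟨c, hc⟩ := hr
      obtain ⟨d, hd⟩ := hs
      exact ⟨c + d, fun i x hx => by
        rw [add_mul, hc i x hx, hd i x hx, Pi.add_apply, add_smul]⟩
  obtain ⟨c, hc⟩ := hy (f 1)
  exact ⟨c, fun i x hx => by rw [hfx x hx.1, hc i x hx]⟩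

/-- An isotypic component of the socle is at most one-dimensional. -/
theorem exists_smul_eq (hQF : IsQuasiFrobenius I.Alg) {i l : Q} {x x' : I.Alg}
    (hx : x ∈ I.piece i 2) (hx0 : x ≠ 0) (hxl : x * I.idem l = x) (hx' : x' ∈ I.grading 2)
    (hxl' : x' * I.idem l = x') : ∃ c : k, x' = c • x := by
  obtain ⟨f, hf⟩ : ∃ f : Module.Dual k I.Alg, f x ≠ 0 := by
    by_contra! h
    exact hx0 ((Module.forall_dual_apply_eq_zero_iff k x).1 h)
  obtain ⟨c, hc⟩ := exists_scalars hsoc hfin hQF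
    ((f ∘ₗ LinearMap.mulRight k (I.idem l)).smulRight x')
    (fun x _ => Submodule.smul_mem _ _ hx') (fun x _ m => by
      simp only [LinearMap.smulRight_apply, LinearMap.comp_apply, LinearMap.mulRight_apply,
        smul_mul_assoc]
      by_cases hml : m = l
      · subst hml
        rw [mul_assoc, idem_mul_idem, hxl']
      · rw [mul_assoc, idem_mul_idem_ne I hml, mul_zero, map_zero, zero_smul, ← hxl', mul_assoc,
          idem_mul_idem_ne I (Ne.symm hml), mul_zero, smul_zero])
  have := hc i x hx
  simp only [LinearMap.smulRight_apply, LinearMap.comp_apply, LinearMap.mulRight_apply, hxl] at this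
  exact ⟨(f x)⁻¹ * c i, by rw [mul_smul, ← this, smul_smul, inv_mul_cancel₀ hf, one_smul]⟩

/-- The socle of `e_i Λ` is isotypic. -/
theorem eq_zero_of_idem_ne (hQF : IsQuasiFrobenius I.Alg) {i l l' : Q} {x x' : I.Alg}
    (hx : x ∈ I.piece i 2) (hx0 : x ≠ 0) (hxl : x * I.idem l = x) (hx' : x' ∈ I.piece i 2)
    (hxl' : x' * I.idem l' = x') (hl : l ≠ l') : x' = 0 := by
  obtain ⟨c, hc⟩ := exists_scalars hsoc hfin hQF (LinearMap.mulRight k (I.idem l))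
    (fun x hx => I.mul_idem_mem hx l) (fun x _ m => by
      simp only [LinearMap.mulRight_apply]
      by_cases hml : m = l
      · rw [hml]
      · rw [mul_assoc, mul_assoc, idem_mul_idem_ne I hml, idem_mul_idem_ne I (Ne.symm hml)])
  have h1 := hc i x hx
  have h2 := hc i x' hx'
  rw [LinearMap.mulRight_apply] at h1 h2
  rw [hxl] at h1
  rw [← hxl', mul_assoc, idem_mul_idem_ne I hl.symm, mul_zero, hxl'] at h2
  have hc0 : c i ≠ 0 := fun h => hx0 (by rw [h1, h, zero_smul])
  exact (smul_eq_zero.1 h2.symm).resolve_left hc0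

/-- The socle of `e_i Λ` is a simple module at a vertex `ν i`, and `ν` is a permutation of the
vertices, the Nakayama permutation. -/
theorem exists_socle_generator [∀ i j : Q, Finite (i ⟶ j)] (hQF : IsQuasiFrobenius I.Alg)
    (hin : ∀ j : Q, 2 ≤ indegree j) : ∃ (ν : Q → Q) (z : Q → I.Alg), Function.Bijective ν ∧
      ∀ i, z i ≠ 0 ∧ z i * I.idem (ν i) = z i ∧ I.piece i 2 = Submodule.span k {z i} := by
  have hex : ∀ i, ∃ (l : Q) (z : I.Alg), z ∈ I.piece i 2 ∧ z ≠ 0 ∧ z * I.idem l = z := by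
    intro i
    have hne : Nonempty (Σ j : Q, (j ⟶ i)) := by
      by_contra h
      rw [not_nonempty_iff] at h
      have := hin i
      rw [indegree, Nat.card_of_isEmpty] at this
      omega
    obtain ⟨α⟩ := hne
    have hα := I.arrow_mem α
    obtain ⟨y, hy, hαy⟩ : ∃ y ∈ I.grading 1, I.arrow α * y ≠ 0 := by
      by_contra! h
      exact I.arrow_ne_zero α (eq_zero_of_mul_grading_one hsoc hfin hα.1 h)
    obtain ⟨l, hl⟩ : ∃ l, I.arrow α * y * I.idem l ≠ 0 := by
      by_contra! h
      exact hαy (by rw [← I.sum_mul_idem (I.arrow α * y)]; exact Finset.sum_eq_zero fun l _ => h l)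
    refine ⟨l, _, I.mem_piece.2 ⟨I.mul_idem_mem (I.mul_mem_grading hα.1 hy) l, ?_⟩, hl, ?_⟩
    · rw [← mul_assoc, ← mul_assoc, (I.mem_piece.1 hα).2]
    · rw [mul_assoc _ (I.idem l), idem_mul_idem]
  choose ν z hz hz0 hzν using hex
  refine ⟨ν, z, Finite.injective_iff_bijective.1 fun i i' h => ?_, fun i => ⟨hz0 i, hzν i, ?_⟩⟩
  · by_contra hne
    obtain ⟨c, hc⟩ := exists_smul_eq hsoc hfin hQF (hz i) (hz0 i) (hzν i) (hz i').1
      (by rw [h]; exact hzν i')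
    refine hz0 i' ?_
    rw [← (I.mem_piece.1 (hz i')).2, hc, mul_smul_comm, ← (I.mem_piece.1 (hz i)).2, ← mul_assoc,
      idem_mul_idem_ne I (Ne.symm hne), zero_mul, smul_zero]
  · refine le_antisymm (fun x hx => ?_) ((Submodule.span_singleton_le_iff_mem _ _).2 (hz i))
    rw [← I.sum_mul_idem x]
    refine sum_mem fun l _ => ?_
    have hxl : x * I.idem l ∈ I.piece i 2 := I.mem_piece.2 ⟨I.mul_idem_mem hx.1 l, by
      rw [← mul_assoc, (I.mem_piece.1 hx).2]⟩
    have hxll : x * I.idem l * I.idem l = x * I.idem l := by rw [mul_assoc, idem_mul_idem]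
    by_cases hl : ν i = l
    · subst hl
      obtain ⟨c, hc⟩ := exists_smul_eq hsoc hfin hQF (hz i) (hz0 i) (hzν i) hxl.1 hxll
      exact Submodule.mem_span_singleton.2 ⟨c, hc.symm⟩
    · rw [eq_zero_of_idem_ne hsoc hfin hQF (hz i) (hz0 i) (hzν i) hxl hxll hl]
      exact zero_mem _

end Socle

end RelationIdeal

/-! ### The graded right modules `e_j Λ` and `S_j` -/

namespace GrMod

section Simple

variable {k : Type u} [Field k] {A : Type a} [Ring A] [Algebra k A] {𝒜 : ℕ → Submodule k A}

/-- A graded module concentrated in a single degree satisfies both inequalities. -/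
theorem isLinear_of_concentrated {S : GrMod 𝒜} {p : ℤ} (hS : ∀ m, m ≠ p → S.deg m = ⊥)
    [Module.Finite k (S.deg p)] : IsLinear 1 p S := by
  refine ⟨fun m h _ => hS m h, fun m => ?_, fun U g hg hU => ?_⟩
  · by_cases h : m = p
    · rwa [h]
    · rw [hS m h]
      infer_instance
  · have hU' : ∀ m, m ≠ p → U.deg m = ⊥ := fun m h => g.deg_eq_bot_of_surjective hg (hS m h)
    have := g.finite_of_surjective hg p
    rw [finrank_eq_zero_of_deg (hU' (p + 1) (by omega)), zero_add, Nat.one_le_iff_ne_zero]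
    intro h
    exact not_subsingleton U.carrier (subsingleton_of_two (fun m h _ => hU' m h)
      (Submodule.finrank_eq_zero.1 h) (hU' (p + 1) (by omega)))

theorem isCoLinear_of_concentrated {S : GrMod 𝒜} {p : ℤ} (hS : ∀ m, m ≠ p + 1 → S.deg m = ⊥)
    [Module.Finite k (S.deg (p + 1))] : IsCoLinear p S := by
  refine ⟨fun m _ h => hS m h, fun m => ?_, fun U g hg hU => ?_⟩
  · by_cases h : m = p + 1
    · rwa [h]
    · rw [hS m h]
      infer_instance
  · have hU' : ∀ m, m ≠ p + 1 → U.deg m = ⊥ := fun m h => g.deg_eq_bot_of_injective hg (hS m h)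
    have := g.finite_of_injective hg (p + 1)
    rw [finrank_eq_zero_of_deg (hU' p (by omega)), Nat.pos_iff_ne_zero]
    intro h
    exact not_subsingleton U.carrier (subsingleton_of_two (fun m _ h => hU' m h)
      (hU' p (by omega)) (Submodule.finrank_eq_zero.1 h))

end Simple

end GrMod

namespace RelationIdeal

open MulOpposite GrMod

variable {k : Type u} [Field k] {Q : Type v} [Fintype Q] [Quiver.{w} Q] (I : RelationIdeal k Q)

/-- The idempotents of the opposite algebra given by the vertices. -/
def opIdem (i : Q) : I.Algᵐᵒᵖ := op (I.idem i)

theorem opIdem_mem (i : Q) : I.opIdem i ∈ opGrading I.grading 0 := mem_opGrading.2 (I.idem_mem i)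

theorem opIdem_idem (i : Q) : I.opIdem i * I.opIdem i = I.opIdem i := by
  rw [opIdem, ← op_mul, idem_mul_idem]

theorem opIdem_orth {i j : Q} (h : i ≠ j) : I.opIdem i * I.opIdem j = 0 := by
  rw [opIdem, opIdem, ← op_mul, idem_mul_idem_ne I h.symm, op_zero]

theorem opGrading_zero_le :
    opGrading I.grading 0 ≤ Submodule.span k (Set.range I.opIdem) := by
  refine (Submodule.map_mono I.grading_zero_le).trans ?_
  rw [Submodule.map_span, ← Set.range_comp]
  exact le_rfl

theorem projective_eq (j : Q) : I.projective j = principal I.opIdem_mem j := rfl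

theorem unop_principalVal_mem_piece {j : Q} {n : ℕ} {x : (principal I.opIdem_mem j).carrier}
    (hx : x ∈ (principal I.opIdem_mem j).deg n) :
    (principalVal I.opIdem_mem j x).unop ∈ I.piece j n := by
  refine I.mem_piece.2 ⟨mem_opGrading.1 hx, ?_⟩
  have := congrArg unop (principalVal_mul I.opIdem_mem j I.opIdem_idem x)
  rwa [unop_mul] at this

/-- The component of degree `n` of `e_j Λ`. -/
def principalDegEquiv (j : Q) (n : ℕ) : (principal I.opIdem_mem j).deg n ≃ₗ[k] I.piece j n :=
  LinearEquiv.ofBijective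
    (LinearMap.codRestrict (I.piece j n)
      ((opLinearEquiv k).symm.toLinearMap ∘ₗ (principalVal I.opIdem_mem j).restrictScalars k ∘ₗ
        ((principal I.opIdem_mem j).deg n).subtype) fun x => I.unop_principalVal_mem_piece x.2)
    (by
      constructor
      · intro x y hxy
        exact Subtype.ext (principalVal_injective _ _ (unop_injective (congrArg Subtype.val hxy)))
      · rintro ⟨y, hy⟩
        have hy' : principalVal I.opIdem_mem j (op y • principalGen I.opIdem_mem j) = op y := by
          rw [map_smul, principalVal_principalGen, smul_eq_mul, opIdem, ← op_mul,
            (I.mem_piece.1 hy).2]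
        refine ⟨⟨op y • principalGen I.opIdem_mem j, ?_⟩, Subtype.ext ?_⟩
        · rw [mem_principal_deg, hy']
          exact mem_opGrading.2 hy.1
        · exact congrArg unop hy')

theorem finrank_principal (j : Q) (n : ℕ) :
    Module.finrank k ((principal I.opIdem_mem j).deg n) = Module.finrank k (I.piece j n) :=
  (I.principalDegEquiv j n).finrank_eq

theorem principal_deg_eq_bot (j : Q) {n : ℤ} (hn : ∀ m : ℕ, (m : ℤ) = n → I.grading m = ⊥) :
    (principal I.opIdem_mem j).deg n = ⊥ := by
  rw [eq_bot_iff]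
  intro x hx
  rw [mem_principal_deg] at hx
  refine (Submodule.mem_bot k).2 (principalVal_injective _ _ ?_)
  rw [map_zero]
  match n, hn, hx with
  | Int.ofNat m, hn, hx =>
    have h : (principalVal I.opIdem_mem j x).unop ∈ I.grading m := mem_opGrading.1 hx
    rw [hn m rfl, Submodule.mem_bot] at h
    exact unop_injective h
  | Int.negSucc m, hn, hx => exact (Submodule.mem_bot k).1 hx

/-- The right modules `e_j Λ` are injective if `Λ` is, being direct summands of `Λ`. -/
theorem isInjective_principal (hQF : IsQuasiFrobenius I.Alg) (j : Q) :
    (principal I.opIdem_mem j).IsInjective := by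
  refine isInjective_of_injective ⟨fun X Y _ _ _ _ f hf g => ?_⟩
  let g' : X →ₗ[I.Algᵐᵒᵖ] I.Alg :=
    { toFun := fun x => (principalVal I.opIdem_mem j (g x)).unop
      map_add' := fun x y => by rw [map_add, map_add, unop_add]
      map_smul' := fun r x => by
        rw [map_smul, map_smul, smul_eq_mul, unop_mul, RingHom.id_apply, smul_eq_mul_unop] }
  obtain ⟨t, ht⟩ := hQF.2.out f hf g'
  refine ⟨
    { toFun := fun y => op (t y) • principalGen I.opIdem_mem j
      map_add' := fun x y => by rw [map_add, op_add, add_smul]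
      map_smul' := fun r x => by
        rw [map_smul, RingHom.id_apply, smul_eq_mul_unop, op_mul, op_unop, mul_smul] },
    fun x => ?_⟩
  change op (t (f x)) • principalGen I.opIdem_mem j = g x
  rw [ht]
  exact principalVal_smul_principalGen I.opIdem_mem j I.opIdem_idem (g x)

theorem isLoewyThree [∀ i j : Q, Finite (i ⟶ j)] (hfin : Module.Finite k I.Alg)
    (hQF : IsQuasiFrobenius I.Alg) (hsoc : (rightSocle I.Alg : Set I.Alg) = I.grading 2)
    (hin : ∀ j : Q, 2 ≤ indegree j) :
    IsLoewyThree (opGrading I.grading) I.opIdem I.opIdem_mem := by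
  obtain ⟨ν, z, hν, hz⟩ := exists_socle_generator hsoc hfin hQF hin
  have hzmem : ∀ i, z i ∈ I.piece i 2 := fun i => by
    rw [(hz i).2.2]
    exact Submodule.mem_span_singleton_self _
  have hval : ∀ {i} {y : I.Algᵐᵒᵖ} {x : (principal I.opIdem_mem i).carrier}, y • x = 0 →
      (principalVal I.opIdem_mem i x).unop * y.unop = 0 := by
    intro i y x h
    have := congrArg unop (congrArg (principalVal I.opIdem_mem i) h)
    rwa [map_smul, map_zero, smul_eq_mul, unop_mul, unop_zero] at this
  exact
  { idem := I.opIdem_idem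
    orth := fun i j h => I.opIdem_orth h
    sum_eq_one := by
      simp only [opIdem]
      rw [← Finset.op_sum, sum_idem, op_one]
    le_span := I.opGrading_zero_le
    deg_eq_bot := fun i n h0 h1 h2 => I.principal_deg_eq_bot i fun m hm =>
      grading_eq_bot hsoc hfin (by omega)
    finite := fun i n => by
      have : Module.Finite k I.Algᵐᵒᵖ := Module.Finite.equiv (opLinearEquiv k)
      refine Module.Finite.of_injective ((principalVal I.opIdem_mem i).restrictScalars k ∘ₗ
        ((principal I.opIdem_mem i).deg n).subtype) ?_
      exact (principalVal_injective _ _).comp Subtype.val_injective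
    finrank_zero := fun i => (I.finrank_principal i 0).trans (I.finrank_piece_zero i)
    finrank_one := fun i => by
      refine (hin i).trans (le_of_eq ?_)
      exact ((I.finrank_principal i 1).trans (I.finrank_piece_one i)).symm
    finrank_two := fun i => by
      refine (I.finrank_principal i 2).trans ?_
      rw [(hz i).2.2, finrank_span_singleton (hz i).1]
    socle_zero := fun i x hx hx2 => by
      have hx' := I.unop_principalVal_mem_piece (n := 0) hx
      rw [piece_zero, Submodule.mem_span_singleton] at hx'
      obtain ⟨c, hc⟩ := hx'
      have h := hval (hx2 (op (z i)) (mem_opGrading.2 (hzmem i).1))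
      rw [← hc, unop_op, smul_mul_assoc, (I.mem_piece.1 (hzmem i)).2] at h
      rw [(smul_eq_zero.1 h).resolve_right (hz i).1, zero_smul] at hc
      exact principalVal_injective _ _ ((unop_injective hc.symm).trans (map_zero _).symm)
    socle_one := fun i x hx hx1 => by
      have hx' := I.unop_principalVal_mem_piece (n := 1) hx
      have h := eq_zero_of_mul_grading_one hsoc hfin hx'.1 fun y hy =>
        hval (hx1 (op y) (mem_opGrading.2 hy))
      exact principalVal_injective _ _ ((unop_injective h).trans (map_zero _).symm)
    injective := I.isInjective_principal hQF
    exists_socle := fun l => by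
      obtain ⟨i, rfl⟩ := hν.2 l
      refine ⟨i, op (z i) • principalGen I.opIdem_mem i, ?_, fun h => (hz i).1 ?_, ?_⟩
      · exact (principal I.opIdem_mem i).smul_mem 2 0 (op (z i)) _ (mem_opGrading.2 (hzmem i).1)
          (principalGen_mem _ _)
      · have := hval h
        rwa [principalVal_principalGen, opIdem, unop_op, unop_op,
          (I.mem_piece.1 (hzmem i)).2] at this
      · rw [smul_smul, opIdem, ← op_mul, (hz i).2.1] }

theorem hasHilbertSeries_projective [∀ i j : Q, Finite (i ⟶ j)]
    (h : IsLoewyThree (opGrading I.grading) I.opIdem I.opIdem_mem) (j : Q) :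
    (I.projective j).HasHilbertSeries (1 + LaurentPolynomial.C (∑ i, incidence Q j i) *
      LaurentPolynomial.T 1 + LaurentPolynomial.T 2) := by
  intro n
  rw [projective_eq]
  refine ⟨h.finite j n, ?_⟩
  have hd : Module.finrank k ((principal I.opIdem_mem j).deg 1) = ∑ i, incidence Q j i := by
    rw [← indegree_eq_sum]
    exact (I.finrank_principal j 1).trans (I.finrank_piece_one j)
  rw [← map_one LaurentPolynomial.C, AddMonoidAlgebra.coeff_add, AddMonoidAlgebra.coeff_add,
    Finsupp.add_apply, Finsupp.add_apply, LaurentPolynomial.C_apply, LaurentPolynomial.T_apply,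
    ← LaurentPolynomial.single_eq_C_mul_T, AddMonoidAlgebra.coeff_single, Finsupp.single_apply]
  by_cases h0 : n = 0
  · subst h0
    simp [h.finrank_zero]
  by_cases h1 : n = 1
  · subst h1
    simp [hd]
  by_cases h2 : n = 2
  · subst h2
    simp [h.finrank_two]
  rw [h.deg_eq_bot j n h0 h1 h2, finrank_bot, if_neg h0, if_neg (Ne.symm h1), if_neg (Ne.symm h2),
    add_zero, add_zero]

theorem simple_deg_eq_bot (j : Q) {n : ℤ} (hn : n ≠ 0) : (I.simple j).deg n = ⊥ := by
  rw [eq_bot_iff]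
  intro x hx
  have hx' : x.1 ∈ (degreeZero (opGrading I.grading)).deg n := hx
  have hbot : (degreeZero (opGrading I.grading)).deg n = ⊥ := if_neg hn
  rw [hbot, Submodule.mem_bot] at hx'
  exact (Submodule.mem_bot k).2 (Subtype.ext hx')

/-- The generator of the simple module at `j`. -/
def simpleGen (j : Q) : (I.simple j).carrier :=
  (⟨_, Submodule.mem_span_singleton_self _⟩ : Submodule.span I.Algᵐᵒᵖ
    {(Submodule.Quotient.mk (I.opIdem j) :
      I.Algᵐᵒᵖ ⧸ (HomogeneousIdeal.irrelevant (opGrading I.grading)).toIdeal)})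

theorem smul_simpleGen_eq_zero {j : Q} {r : I.Algᵐᵒᵖ}
    (h : r * I.opIdem j ∈ HomogeneousIdeal.irrelevant (opGrading I.grading)) :
    r • I.simpleGen j = 0 :=
  Subtype.ext ((Submodule.Quotient.mk_eq_zero _).2 h)

theorem simpleGen_ne_zero (j : Q) : I.simpleGen j ≠ 0 := by
  intro h
  have h' := (Submodule.Quotient.mk_eq_zero _).1 (congrArg Subtype.val h)
  have h2 : I.opIdem j ∈ HomogeneousIdeal.irrelevant (opGrading I.grading) := h'
  rw [HomogeneousIdeal.mem_irrelevant_iff, GradedRing.proj_apply,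
    decompose_of_mem_same _ (I.opIdem_mem j)] at h2
  exact I.idem_ne_zero j (op_injective h2)

theorem exists_smul_simpleGen (j : Q) (x : (I.simple j).carrier) :
    ∃ c : k, c • I.simpleGen j = x := by
  have key : ∀ r : I.Algᵐᵒᵖ, ∃ c : k, c • I.simpleGen j = r • I.simpleGen j := by
    intro r
    induction r using Decomposition.inductionOn (opGrading I.grading) with
    | zero => exact ⟨0, by rw [zero_smul, zero_smul]⟩
    | @homogeneous i r =>
      by_cases hi : i = 0
      · subst hi
        have hr := I.opGrading_zero_le r.2
        obtain ⟨r, hr0⟩ := r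
        change r ∈ _ at hr
        change ∃ c : k, c • I.simpleGen j = r • I.simpleGen j
        clear hr0
        induction hr using Submodule.span_induction with
        | mem r hr =>
          obtain ⟨i, rfl⟩ := hr
          by_cases hij : i = j
          · subst hij
            refine ⟨1, ?_⟩
            rw [one_smul]
            exact Subtype.ext (congrArg Submodule.Quotient.mk (I.opIdem_idem i)).symm
          · refine ⟨0, ?_⟩
            rw [zero_smul, smul_simpleGen_eq_zero]
            rw [I.opIdem_orth hij]
            exact zero_mem _
        | zero => exact ⟨0, by rw [zero_smul, zero_smul]⟩
        | add r s _ _ hr hs =>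
          obtain ⟨c, hc⟩ := hr
          obtain ⟨d, hd⟩ := hs
          exact ⟨c + d, by rw [add_smul, add_smul, hc, hd]⟩
        | smul a r _ hr =>
          obtain ⟨c, hc⟩ := hr
          exact ⟨a * c, by rw [mul_smul, hc, smul_assoc]⟩
      · refine ⟨0, ?_⟩
        rw [zero_smul, smul_simpleGen_eq_zero]
        have := SetLike.GradedMul.mul_mem (A := opGrading I.grading) r.2 (I.opIdem_mem j)
        exact HomogeneousIdeal.mem_irrelevant_of_mem _ (by omega) this
    | add r s hr hs =>
      obtain ⟨c, hc⟩ := hr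
      obtain ⟨d, hd⟩ := hs
      exact ⟨c + d, by rw [add_smul, add_smul, hc, hd]⟩
  obtain ⟨r, hr⟩ := Submodule.mem_span_singleton.1 x.2
  obtain ⟨c, hc⟩ := key r
  exact ⟨c, hc.trans (Subtype.ext hr)⟩

theorem simple_deg_zero (j : Q) :
    (I.simple j).deg 0 = Submodule.span k {I.simpleGen j} := by
  refine le_antisymm (fun x _ => Submodule.mem_span_singleton.2 (I.exists_smul_simpleGen j x)) ?_
  rw [Submodule.span_singleton_le_iff_mem]
  exact I.idem_mem_degreeZero j

theorem finite_simple (j : Q) : Module.Finite k ((I.simple j).deg 0) := by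
  rw [simple_deg_zero]
  infer_instance

theorem finrank_simple (j : Q) : Module.finrank k ((I.simple j).deg 0) = 1 := by
  rw [simple_deg_zero, finrank_span_singleton (I.simpleGen_ne_zero j)]

theorem nontrivial_simple (j : Q) : Nontrivial (I.simple j).carrier :=
  ⟨_, _, I.simpleGen_ne_zero j⟩

end RelationIdeal

end KoszulQuiver

end

theorem proposition5p2 {k : Type u} [Field k] {Q : Type v} [Fintype Q] [Quiver.{w} Q]
    [∀ i j : Q, Finite (i ⟶ j)] (I : RelationIdeal k Q)
    (hfin : Module.Finite k I.Alg)
    (hQF : IsQuasiFrobenius I.Alg)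
    (hKoszul : IsKoszulAlgebra I.grading)
    (hsoc : (rightSocle I.Alg : Set I.Alg) = I.grading 2)
    (hin : ∀ j : Q, 2 ≤ indegree j) :
    (∀ j : Q, 2 ≤ ∑ i, incidence Q j i ∧
      (I.projective j).HasHilbertSeries (1 + C (∑ i, incidence Q j i) * T 1 + T 2)) ∧
    (∀ (n : ℕ) (j : Q),
      (∃ X, GrMod.Iterate GrMod.IsF n (I.simple j) X) ∧
      ∀ X, GrMod.Iterate GrMod.IsF n (I.simple j) X →
        ∃ a b : ℕ, b < a ∧ X.HasHilbertSeries (C a + C b * T 1)) ∧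
    (∀ (n : ℕ) (j : Q),
      (∃ X, GrMod.Iterate GrMod.IsFInv n ((I.simple j).shift (-1)) X) ∧
      ∀ X, GrMod.Iterate GrMod.IsFInv n ((I.simple j).shift (-1)) X →
        ∃ a b : ℕ, a < b ∧ X.HasHilbertSeries (C a + C b * T 1)) ∧
    I.KoszulSyzygyCondition := by
  have h := I.isLoewyThree hfin hQF hsoc hin
  have hS := I.finite_simple
  have hbot : ∀ (j : Q) (m : ℤ), m ≠ 0 → (I.simple j).deg m = ⊥ := fun j m =>
    I.simple_deg_eq_bot j
  have hlin : ∀ j, GrMod.IsLinear 1 0 (I.simple j) := fun j =>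
    GrMod.isLinear_of_concentrated (hbot j)
  refine ⟨fun j => ⟨?_, I.hasHilbertSeries_projective h j⟩, fun n j => ?_, fun n j => ?_,
    fun i j l X hX f => ?_⟩
  · rw [← RelationIdeal.indegree_eq_sum]
    exact hin j
  · have := I.nontrivial_simple j
    exact h.iterate_isF (hlin j) n
  · have : Nontrivial ((I.simple j).shift (-1)).carrier := I.nontrivial_simple j
    have : Module.Finite k (((I.simple j).shift (-1)).deg (0 + 1)) := hS j
    have hco : GrMod.IsCoLinear 0 ((I.simple j).shift (-1)) :=
      GrMod.isCoLinear_of_concentrated fun m hm => hbot j (-1 + m) (by omega)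
    exact h.iterate_isFInv hco n
  · exact h.isKoszul_ker (hlin j) hX (I.finrank_simple l).le f
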